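/- Let $K$ be an algebraically closed field, $p\ge q\ge 0$ integers, $n=p+q$, $V=K^n$, and let $x=1+N\in SL_n(K)$ be unipotent of type $(p,q)$, i.e. $V$ has a basis $e_{1,1},\dots,e_{p,1},e_{1,2},\dots,e_{q,2}$ adapted to $x$: $N e_{i,j}=e_{i-1,j}$ with $e_{0,j}=0$. Fix such a basis. Let $\mathbb F_x$ be the Springer fiber, the variety of complete flags $F_1\subset\dots\subset F_n=V$, $\dim F_i=i$, with $xF_i\subseteq F_i$ for all $i$; it is a closed subvariety of $Gr(1,n)\times\dots\times Gr(n,n)$. A standard tableau $\sigma$ of type $(p,q)$ is a filling, by $1,\dots,n$ (each used once), of a left column of $p$ boxes and a right column of $q$ boxes, aligned at the top, with entries strictly decreasing from top to bottom and from left to right. Let $\psi(k)=1$ if $k$ is in the left column and $\psi(k)=2$ if it is in the right column. The stratum $X_\sigma=X_{\psi(n)\cdots\psi(1)}(V)$ consists of the flags obtained inductively as follows. If $\psi(1)=1$, then $F_1=\langle e_{1,1}\rangle$, and $V/F_1$ is given the adapted basis of classes of $e_{i+1,1}$ $(1\le i\le p-1)$ and $e_{i,2}$ $(1\le i\le q)$.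 If $\psi(1)=2$, then $F_1=\langle a e_{1,1}+e_{1,2}\rangle$ for some $a\in K$, and $V/F_1$ is given the adapted basis of classes of $e_{i,1}$ $(1\le i\le p)$ and $a e_{i+1,1}+e_{i+1,2}$ $(1\le i\le q-1)$. In both cases the flag $F_2/F_1\subset\dots\subset F_n/F_1$ is required to lie in $X_{\psi(n)\cdots\psi(2)}(V/F_1)$, defined in the same way with respect to this basis. Let $Y_\sigma$ be the Zariski closure of $X_\sigma$. For $0\le r\le n$ let $Y_\sigma(r)$ be the image of $Y_\sigma$ in $Gr(1,n)\times\dots\times Gr(r,n)$ (a point for $r=0$), with its induced structure of variety, and for $1\le r\le n$ let $f_r:Y_\sigma(r)\to Y_\sigma(r-1)$ be the natural projection. Theorem. $Y_\sigma$ is an irreducible component of $\mathbb F_x$, and for every $1\le r\le n$: (a) if $r$ lies in the left column of $\sigma$, then for every $z\in Y_\sigma(r-1)$ the fiber $f_r^{-1}(z)$ is a single point, and $f_r$ is an isomorphism of varieties; (b) if $r$ lies in the right column of $\sigma$, then for every $z\in Y_\sigma(r-1)$ the fiber $f_r^{-1}(z)$ is isomorphic to $\mathbb P^1$ as a variety,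 and $f_r$ is a $\mathbb P^1$-bundle: every point of $Y_\sigma(r-1)$ has a Zariski open neighbourhood $U$ with an isomorphism $f_r^{-1}(U)\cong U\times\mathbb P^1$ over $U$. -/

import Mathlib

/-! ### Classical varieties: Zariski topology, regular functions, morphisms

All varieties occurring here are subsets of products of Grassmannians and projective lines over an
algebraically closed field `K`.  Such a set is the set of orbits of a (saturated) set of
coordinate vectors in an affine space: nonzero vectors modulo scaling for a projective space,
bases modulo change of basis for a Grassmannian. -/

/-- A set `X` with homogeneous coordinates: `Coord a x` says that the vector `a`, in the affine
space with coordinates indexed by `Idx`, is a system of homogeneous coordinates of the point `x`. -/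
class HomCoords (K : Type*) [Field K] (X : Type*) where
  Idx : Type
  finite : Finite Idx
  Coord : (Idx → K) → X → Prop
  exists_coord : ∀ x, ∃ a, Coord a x
  coord_unique : ∀ a x y, Coord a x → Coord a y → x = y

namespace HomCoords

/-- The projective space of lines in `K ^ m`, with its usual homogeneous coordinates. -/
instance instProjectivization (K : Type*) [Field K] (m : ℕ) :
    HomCoords K (Projectivization K (Fin m → K)) where
  Idx := Fin m
  finite := inferInstance
  Coord a x := ∃ h : a ≠ 0, Projectivization.mk K a h = x
  exists_coord x := ⟨x.rep, x.rep_nonzero, x.mk_rep⟩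
  coord_unique := by
    rintro a x y ⟨h, rfl⟩ ⟨h', rfl⟩
    rfl

/-- A subset is described by the coordinates of its points in the ambient set. -/
instance instSubtype (K : Type*) [Field K] (X : Type*) [HomCoords K X] (P : X → Prop) :
    HomCoords K {x : X // P x} where
  Idx := Idx K X
  finite := finite
  Coord a x := Coord a x.1
  exists_coord x := exists_coord x.1
  coord_unique a x y hx hy := Subtype.ext (coord_unique a x.1 y.1 hx hy)

/-- Products. -/
instance instProd (K : Type*) [Field K] (X Y : Type*) [HomCoords K X] [HomCoords K Y] :
    HomCoords K (X × Y) where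
  Idx := Idx K X ⊕ Idx K Y
  finite := by
    have : Finite (Idx K X) := finite
    have : Finite (Idx K Y) := finite
    infer_instance
  Coord a z := Coord (fun i => a (Sum.inl i)) z.1 ∧ Coord (fun j => a (Sum.inr j)) z.2
  exists_coord z := by
    obtain ⟨a, ha⟩ := exists_coord (K := K) z.1
    obtain ⟨b, hb⟩ := exists_coord (K := K) z.2
    exact ⟨Sum.elim a b, ha, hb⟩
  coord_unique a z w hz hw :=
    Prod.ext (coord_unique _ _ _ hz.1 hw.1) (coord_unique _ _ _ hz.2 hw.2)

/-- Finite products of a family. -/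
instance instPi (K : Type*) [Field K] {ι : Type} [Finite ι] (X : ι → Type*)
    [∀ i, HomCoords K (X i)] : HomCoords K (∀ i, X i) where
  Idx := Σ i, Idx K (X i)
  finite := by
    have : ∀ i, Finite (Idx K (X i)) := fun i => finite
    infer_instance
  Coord a x := ∀ i, Coord (fun j => a ⟨i, j⟩) (x i)
  exists_coord x := by
    choose a ha using fun i => exists_coord (K := K) (x i)
    exact ⟨fun s => a s.1 s.2, ha⟩
  coord_unique a x y hx hy := funext fun i => coord_unique _ _ _ (hx i) (hy i)

end HomCoords

open HomCoords in
/-- The Zariski topology: the quotient of the Zariski topology on coordinate vectors.  A set `U` is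
open iff the set of coordinate vectors of its points is, within the set of all coordinate vectors of
points of `X`, a union of principal open sets `h ≠ 0` with `h` a polynomial. -/
@[reducible]
def zariski (K : Type*) [Field K] (X : Type*) [HomCoords K X] : TopologicalSpace X where
  IsOpen U := ∀ x ∈ U, ∀ a : Idx K X → K, Coord a x →
    ∃ h : MvPolynomial (Idx K X) K, MvPolynomial.eval a h ≠ 0 ∧
      ∀ (y : X) (b : Idx K X → K), Coord b y → MvPolynomial.eval b h ≠ 0 → y ∈ U
  isOpen_univ := fun _ _ _ _ => ⟨1, by simp, fun _ _ _ _ => trivial⟩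
  isOpen_inter := by
    intro U V hU hV x hx a ha
    obtain ⟨g, hg, hgU⟩ := hU x hx.1 a ha
    obtain ⟨h, hh, hhV⟩ := hV x hx.2 a ha
    refine ⟨g * h, by simp [hg, hh], fun y b hb hne => ?_⟩
    rw [map_mul] at hne
    exact ⟨hgU y b hb (left_ne_zero_of_mul hne), hhV y b hb (right_ne_zero_of_mul hne)⟩
  isOpen_sUnion := by
    intro S hS x hx a ha
    obtain ⟨U, hU, hxU⟩ := hx
    obtain ⟨h, hh, hhU⟩ := hS U hU x hxU a ha
    exact ⟨h, hh, fun y b hb hne => ⟨U, hU, hhU y b hb hne⟩⟩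

open HomCoords in
/-- `f` is a regular function on the open set `U`: as a function of the coordinate vectors of the
points of `U` it is, locally, a quotient of polynomials. The values of `f` off `U` are irrelevant. -/
def IsRegularOn (K : Type*) [Field K] {X : Type*} [HomCoords K X] (U : Set X) (f : X → K) : Prop :=
  ∀ x ∈ U, ∀ a : Idx K X → K, Coord a x →
    ∃ g h : MvPolynomial (Idx K X) K, MvPolynomial.eval a h ≠ 0 ∧
      ∀ y ∈ U, ∀ b : Idx K X → K, Coord b y → MvPolynomial.eval b h ≠ 0 →
        f y = MvPolynomial.eval b g / MvPolynomial.eval b h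

/-- Morphisms of varieties: Zariski continuous maps which pull regular functions on open sets back
to regular functions. -/
def IsMorphism (K : Type*) [Field K] {X Y : Type*} [HomCoords K X] [HomCoords K Y]
    (φ : X → Y) : Prop :=
  @Continuous X Y (zariski K X) (zariski K Y) φ ∧
    ∀ (V : Set Y) (f : Y → K), @IsOpen Y (zariski K Y) V → IsRegularOn K V f →
      IsRegularOn K (φ ⁻¹' V) (f ∘ φ)

/-- A bijection which is an isomorphism of varieties. -/
def IsVarietyIso (K : Type*) [Field K] {X Y : Type*} [HomCoords K X] [HomCoords K Y]
    (e : X ≃ Y) : Prop :=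
  IsMorphism K e ∧ IsMorphism K e.symm

/-- The projective line over `K`. -/
abbrev ProjLine (K : Type*) [Field K] : Type _ := Projectivization K (Fin 2 → K)

/-- `f : X → Y` is a `ℙ¹`-bundle, locally trivial for the Zariski topology. -/
def IsProjLineBundle (K : Type*) [Field K] {X Y : Type*} [HomCoords K X] [HomCoords K Y]
    (f : X → Y) : Prop :=
  IsMorphism K f ∧ ∀ y : Y, ∃ U : Set Y, @IsOpen Y (zariski K Y) U ∧ y ∈ U ∧
    ∃ e : {x : X // f x ∈ U} ≃ {z : Y // z ∈ U} × ProjLine K,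
      IsVarietyIso K e ∧ ∀ x, ((e x).1 : Y) = f x

/-! ### Grassmannians and flags -/

/-- The Grassmannian of `k`-dimensional subspaces of `K ^ n`. -/
def Gr (K : Type*) [Field K] (k n : ℕ) : Type _ :=
  {W : Submodule K (Fin n → K) // Module.finrank K W = k}

/-- The coordinates of a `k`-dimensional subspace `W` are the `k × n` matrices whose rows span `W`
(and hence form a basis of `W`). -/
instance Gr.instHomCoords (K : Type*) [Field K] (k n : ℕ) : HomCoords K (Gr K k n) where
  Idx := Fin k × Fin n
  finite := inferInstance
  Coord a W := Submodule.span K (Set.range fun (i : Fin k) (j : Fin n) => a (i, j)) = W.1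
  exists_coord W := by
    let b := Module.finBasisOfFinrankEq K W.1 W.2
    refine ⟨fun ij => (b ij.1 : Fin n → K) ij.2, ?_⟩
    have h : (Set.range fun (i : Fin k) (j : Fin n) => (b i : Fin n → K) j)
        = W.1.subtype '' Set.range b := by
      rw [← Set.range_comp]; rfl
    rw [h, Submodule.span_image, b.span_eq, Submodule.map_top, Submodule.range_subtype]
  coord_unique a V W hV hW := Subtype.ext (hV.symm.trans hW)

/-- The product `Gr(1,n) × ⋯ × Gr(r,n)`; the factor of index `i : Fin r` is `Gr(i+1,n)`. -/
abbrev GrProd (K : Type*) [Field K] (n r : ℕ) : Type _ := (i : Fin r) → Gr K (i + 1) n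

/-- Projection to the first `r` factors. -/
def GrProd.trunc (K : Type*) [Field K] {n r s : ℕ} (h : r ≤ s) (F : GrProd K n s) : GrProd K n r :=
  fun i => F (Fin.castLE h i)

/-- The variety of complete flags `F₁ ⊂ ⋯ ⊂ Fₙ` in `K ^ n`. -/
def flagVariety (K : Type*) [Field K] (n : ℕ) : Set (GrProd K n n) :=
  {F | ∀ i j : Fin n, i ≤ j → (F i).1 ≤ (F j).1}

/-- The Springer fiber over `x`: the complete flags fixed by `x`. -/
def springerFiber (K : Type*) [Field K] {n : ℕ} (x : Matrix.SpecialLinearGroup (Fin n) K) :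
    Set (GrProd K n n) :=
  {F | F ∈ flagVariety K n ∧
    ∀ i : Fin n, (F i).1.map (Matrix.toLin' (x : Matrix (Fin n) (Fin n) K)) ≤ (F i).1}

/-! ### Unipotent elements with two Jordan blocks, tableaux, strata, components -/

/-- The basis `e` is adapted to `x = 1 + n`: `n` maps `e_{i+1,j}` to `e_{i,j}` and kills `e_{1,j}`,
for both `j`.  Here `e_{i,1} = e (inl (i-1))` and `e_{i,2} = e (inr (i-1))`.  An element `x` is
unipotent with Jordan blocks of sizes `p, q` iff it has such a basis. -/
def IsAdaptedBasis (K : Type*) [Field K] {p q : ℕ}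
    (x : Matrix.SpecialLinearGroup (Fin (p + q)) K)
    (e : Module.Basis (Fin p ⊕ Fin q) K (Fin (p + q) → K)) : Prop :=
  let N := Matrix.toLin' ((x : Matrix (Fin (p + q)) (Fin (p + q)) K) - 1)
  (∀ i : Fin p, (i : ℕ) = 0 → N (e (Sum.inl i)) = 0) ∧
  (∀ i j : Fin p, (j : ℕ) = i + 1 → N (e (Sum.inl j)) = e (Sum.inl i)) ∧
  (∀ i : Fin q, (i : ℕ) = 0 → N (e (Sum.inr i)) = 0) ∧
  (∀ i j : Fin q, (j : ℕ) = i + 1 → N (e (Sum.inr j)) = e (Sum.inr i))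

/-- Standard tableaux of type `(p,q)`: a left column of `p` boxes and a right column of `q` boxes,
numbered from the top, filled bijectively with `1, …, p+q` (the number `r + 1` is represented by
`r : Fin (p + q)`), strictly decreasing from top to bottom and from left to right. -/
structure StandardTableau (p q : ℕ) where
  entry : Fin p ⊕ Fin q ≃ Fin (p + q)
  left_anti : StrictAnti fun i : Fin p => entry (Sum.inl i)
  right_anti : StrictAnti fun i : Fin q => entry (Sum.inr i)
  row_anti : ∀ (i : Fin p) (j : Fin q), (i : ℕ) = j → entry (Sum.inr j) < entry (Sum.inl i)

/-- The two columns of a tableau. -/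
inductive Column
  | left
  | right

/-- The column `ψ(r+1)` of `σ` in which the number `r + 1` appears. -/
def StandardTableau.column {p q : ℕ} (σ : StandardTableau p q) (r : Fin (p + q)) : Column :=
  match σ.entry.symm r with
  | Sum.inl _ => Column.left
  | Sum.inr _ => Column.right

universe v

/-- Membership of the flag `F 0 ⊂ F 1 ⊂ ⋯` of `V` in the stratum attached to the word `ψ(1), ψ(2), …`
and to an adapted basis of `V` with Jordan chains `u 0, u 1, …` and `w 0, w 1, …`.
* `ψ(1) = left`: the line `F 0` is spanned by `u 0`;
* `ψ(1) = right`: the line `F 0` is spanned by `a • u 0 + w 0` for some scalar `a`;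
and the flag induced in `V ⧸ F 0` lies in the stratum attached to `ψ(2), ψ(3), …` and to the
induced adapted basis of `V ⧸ F 0`, with chains the classes of `u 1, u 2, …` and `w 0, w 1, …` in the
first case, of `u 0, u 1, …` and `a • u 1 + w 1, a • u 2 + w 2, …` in the second. -/
def InStratum (K : Type*) [Field K] : List Column → ∀ (V : Type v) [AddCommGroup V] [Module K V],
    (ℕ → V) → (ℕ → V) → (ℕ → Submodule K V) → Prop
  | [], _, _, _, _, _, _ => True
  | Column.left :: ψ, V, _, _, u, w, F =>
      F 0 = Submodule.span K {u 0} ∧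
        InStratum K ψ (V ⧸ F 0) (fun i => (F 0).mkQ (u (i + 1))) (fun i => (F 0).mkQ (w i))
          (fun i => (F (i + 1)).map (F 0).mkQ)
  | Column.right :: ψ, V, _, _, u, w, F =>
      ∃ a : K, F 0 = Submodule.span K {a • u 0 + w 0} ∧
        InStratum K ψ (V ⧸ F 0) (fun i => (F 0).mkQ (u i))
          (fun i => (F 0).mkQ (a • u (i + 1) + w (i + 1)))
          (fun i => (F (i + 1)).map (F 0).mkQ)

/-- The stratum `X_σ`.  (Chains are prolonged by `0`, the flag by `⊤`; these values play no role.) -/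
def stratum (K : Type*) [Field K] {p q : ℕ}
    (e : Module.Basis (Fin p ⊕ Fin q) K (Fin (p + q) → K)) (σ : StandardTableau p q) :
    Set (GrProd K (p + q) (p + q)) :=
  {F | F ∈ flagVariety K (p + q) ∧
    InStratum K (List.ofFn σ.column) (Fin (p + q) → K)
      (fun i => if h : i < p then e (Sum.inl ⟨i, h⟩) else 0)
      (fun i => if h : i < q then e (Sum.inr ⟨i, h⟩) else 0)
      (fun i => if h : i < p + q then (F ⟨i, h⟩).1 else ⊤)}

/-- `Y_σ`, the Zariski closure of the stratum `X_σ`. -/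
def component (K : Type*) [Field K] {p q : ℕ}
    (e : Module.Basis (Fin p ⊕ Fin q) K (Fin (p + q) → K)) (σ : StandardTableau p q) :
    Set (GrProd K (p + q) (p + q)) :=
  @closure _ (zariski K (GrProd K (p + q) (p + q))) (stratum K e σ)

/-- `Y_σ(r)`, the image of `Y_σ` in `Gr(1,n) × ⋯ × Gr(r,n)`, `n = p + q`; for `r = 0` a point. -/
def componentImage (K : Type*) [Field K] {p q : ℕ}
    (e : Module.Basis (Fin p ⊕ Fin q) K (Fin (p + q) → K)) (σ : StandardTableau p q)
    (r : ℕ) (hr : r ≤ p + q) : Set (GrProd K (p + q) r) :=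
  GrProd.trunc K hr '' component K e σ

/-- The natural projection `Y_σ(r+1) → Y_σ(r)`. -/
def componentProj (K : Type*) [Field K] {p q : ℕ}
    (e : Module.Basis (Fin p ⊕ Fin q) K (Fin (p + q) → K)) (σ : StandardTableau p q)
    (r : Fin (p + q)) (y : componentImage K e σ (r + 1) r.2) : componentImage K e σ r r.2.le :=
  ⟨GrProd.trunc K (Nat.le_succ r) y.1, by
    obtain ⟨F, hF, h⟩ := y.2
    exact ⟨F, hF, by rw [← h]; rfl⟩⟩

/-!
Read the word `ψ(1) ψ(2) ⋯` as a string of parentheses, opened by `right` and closed by `left`. The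
closure `Y_σ` is the set of the flags *matched* to this word: `F_{i+1} ⊆ N⁻¹ F_i` for all `i`, a
completely matched interval of length `2k` from `i` to `j` forces `F_j = N^{-k} F_i`, and a prefix
of length `2t + u` with `u` unmatched `left`s, the last of them in its last position, forces
`F_{2t+u}` to be the preimage under `N^t` of the span of the first `u` vectors of the first chain.
Hence after a letter `left` the next member is determined by the previous ones, whereas after a
letter `right` it is given by any line in the two-dimensional space `N⁻¹ F_r / F_r`. So the sets of
matched partial flags form a tower of isomorphisms and `ℙ¹`-bundles, and are irreducible. The
stratum `X_σ` is the nonempty open subset of the matched flags which avoid the vectors of the first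
chain as long as possible, so it is dense.

Every flag in the Springer fiber is matched to some word, which is read off from the ranges of the
powers of `N` contained in its members. Thus the Springer fiber is a finite union of irreducible
closed sets. None of them contains another one: for words `v ≠ w`, the coordinate flag of `v`,
or that of a reflection of a part of the lattice path of `v`, lies in the set of `v` but not in that
of `w`.
-/

open Topology HomCoords

/-! ### Germs of rational functions on affine space -/

/-- The filter of Zariski neighbourhoods of a point of affine space. -/
def zarNhds {K : Type*} [Field K] {ι : Type*} (a : ι → K) : Filter (ι → K) where
  sets := {s | ∃ h : MvPolynomial ι K, MvPolynomial.eval a h ≠ 0 ∧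
    ∀ b, MvPolynomial.eval b h ≠ 0 → b ∈ s}
  univ_sets := ⟨1, by simp, fun _ _ => trivial⟩
  sets_of_superset := by
    rintro s t ⟨h, ha, hs⟩ hst
    exact ⟨h, ha, fun b hb => hst (hs b hb)⟩
  inter_sets := by
    rintro s t ⟨g, hga, hg⟩ ⟨h, hha, hh⟩
    refine ⟨g * h, by simp [hga, hha], fun b hb => ?_⟩
    rw [map_mul] at hb
    exact ⟨hg b (left_ne_zero_of_mul hb), hh b (right_ne_zero_of_mul hb)⟩

/-- `f` agrees near `a` with a quotient of polynomials whose denominator does not vanish at `a`. -/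
def IsRationalAt {K : Type*} [Field K] {ι : Type*} (f : (ι → K) → K) (a : ι → K) : Prop :=
  ∃ g h : MvPolynomial ι K, MvPolynomial.eval a h ≠ 0 ∧
    ∀ᶠ b in zarNhds a, f b = MvPolynomial.eval b g / MvPolynomial.eval b h

/-- The components of the map `L` between affine spaces are rational near `a`. -/
def IsRationalVecAt {K : Type*} [Field K] {ι κ : Type*} (L : (ι → K) → κ → K) (a : ι → K) : Prop :=
  ∀ j, IsRationalAt (fun b => L b j) a

section Rational

variable {K : Type*} [Field K] {ι κ : Type*} {a : ι → K}

lemma eventually_zarNhds_iff {P : (ι → K) → Prop} :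
    (∀ᶠ b in zarNhds a, P b) ↔ ∃ h : MvPolynomial ι K, MvPolynomial.eval a h ≠ 0 ∧
      ∀ b, MvPolynomial.eval b h ≠ 0 → P b := Iff.rfl

lemma self_of_eventually_zarNhds {P : (ι → K) → Prop} (h : ∀ᶠ b in zarNhds a, P b) : P a := by
  obtain ⟨g, ha, hP⟩ := h
  exact hP a ha

lemma eventually_eval_ne_zero {h : MvPolynomial ι K} (ha : MvPolynomial.eval a h ≠ 0) :
    ∀ᶠ b in zarNhds a, MvPolynomial.eval b h ≠ 0 :=
  ⟨h, ha, fun _ hb => hb⟩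

namespace IsRationalAt

variable {f g : (ι → K) → K}

lemma congr (hf : IsRationalAt f a) (h : g =ᶠ[zarNhds a] f) : IsRationalAt g a := by
  obtain ⟨p, q, hq, hpq⟩ := hf
  exact ⟨p, q, hq, h.trans hpq⟩

lemma polynomial (p : MvPolynomial ι K) : IsRationalAt (fun b => MvPolynomial.eval b p) a :=
  ⟨p, 1, by simp, by simp⟩

lemma const (c : K) : IsRationalAt (fun _ : ι → K => c) a := by
  simpa using polynomial (a := a) (MvPolynomial.C c : MvPolynomial ι K)

lemma coord (i : ι) : IsRationalAt (fun b : ι → K => b i) a := by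
  simpa using polynomial (a := a) (MvPolynomial.X i : MvPolynomial ι K)

lemma add (hf : IsRationalAt f a) (hg : IsRationalAt g a) :
    IsRationalAt (fun b => f b + g b) a := by
  obtain ⟨p, q, hq, hpq⟩ := hf
  obtain ⟨r, s, hs, hrs⟩ := hg
  refine ⟨p * s + q * r, q * s, by simp [hq, hs], ?_⟩
  filter_upwards [hpq, hrs, eventually_eval_ne_zero hq, eventually_eval_ne_zero hs]
    with b hfb hgb hqb hsb
  rw [hfb, hgb, div_add_div _ _ hqb hsb]
  simp

lemma mul (hf : IsRationalAt f a) (hg : IsRationalAt g a) :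
    IsRationalAt (fun b => f b * g b) a := by
  obtain ⟨p, q, hq, hpq⟩ := hf
  obtain ⟨r, s, hs, hrs⟩ := hg
  refine ⟨p * r, q * s, by simp [hq, hs], ?_⟩
  filter_upwards [hpq, hrs] with b hfb hgb
  rw [hfb, hgb, div_mul_div_comm]
  simp

lemma sum (s : Finset κ) {f : κ → (ι → K) → K} (hf : ∀ i ∈ s, IsRationalAt (f i) a) :
    IsRationalAt (fun b => ∑ i ∈ s, f i b) a := by
  classical
  induction s using Finset.induction_on with
  | empty => simpa using const (a := a) (0 : K)
  | insert i s hi ih =>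
    simp only [Finset.sum_insert hi]
    exact (hf i (Finset.mem_insert_self i s)).add
      (ih fun j hj => hf j (Finset.mem_insert_of_mem hj))

lemma prod (s : Finset κ) {f : κ → (ι → K) → K} (hf : ∀ i ∈ s, IsRationalAt (f i) a) :
    IsRationalAt (fun b => ∏ i ∈ s, f i b) a := by
  classical
  induction s using Finset.induction_on with
  | empty => simpa using const (a := a) (1 : K)
  | insert i s hi ih =>
    simp only [Finset.prod_insert hi]
    exact (hf i (Finset.mem_insert_self i s)).mul
      (ih fun j hj => hf j (Finset.mem_insert_of_mem hj))

lemma eval {L : (ι → K) → κ → K} (hL : IsRationalVecAt L a) (p : MvPolynomial κ K) :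
    IsRationalAt (fun b => MvPolynomial.eval (L b) p) a := by
  induction p using MvPolynomial.induction_on with
  | C c => simpa using const (a := a) c
  | add p q hp hq => simpa using hp.add hq
  | mul_X p j hp => simpa using hp.mul (hL j)

lemma exists_eq_div_of_ne_zero (hf : IsRationalAt f a) (ha : f a ≠ 0) :
    ∃ p q : MvPolynomial ι K, MvPolynomial.eval a p ≠ 0 ∧ MvPolynomial.eval a q ≠ 0 ∧
      ∀ᶠ b in zarNhds a, f b = MvPolynomial.eval b p / MvPolynomial.eval b q := by
  obtain ⟨p, q, hq, hpq⟩ := hf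
  refine ⟨p, q, fun hp => ha ?_, hq, hpq⟩
  rw [self_of_eventually_zarNhds hpq, hp, zero_div]

lemma eventually_ne_zero (hf : IsRationalAt f a) (ha : f a ≠ 0) : ∀ᶠ b in zarNhds a, f b ≠ 0 := by
  obtain ⟨p, q, hp, hq, hpq⟩ := hf.exists_eq_div_of_ne_zero ha
  filter_upwards [hpq, eventually_eval_ne_zero hp, eventually_eval_ne_zero hq] with b hfb hpb hqb
  rw [hfb]
  exact div_ne_zero hpb hqb

lemma inv (hf : IsRationalAt f a) (ha : f a ≠ 0) : IsRationalAt (fun b => (f b)⁻¹) a := by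
  obtain ⟨p, q, hp, -, hpq⟩ := hf.exists_eq_div_of_ne_zero ha
  refine ⟨q, p, hp, ?_⟩
  filter_upwards [hpq] with b hfb
  rw [hfb, inv_div]

lemma div (hf : IsRationalAt f a) (hg : IsRationalAt g a) (ha : g a ≠ 0) :
    IsRationalAt (fun b => f b / g b) a := by
  simpa only [div_eq_mul_inv] using hf.mul (hg.inv ha)

end IsRationalAt

lemma IsRationalVecAt.tendsto {L : (ι → K) → κ → K} (hL : IsRationalVecAt L a) :
    Filter.Tendsto L (zarNhds a) (zarNhds (L a)) := by
  rintro s ⟨h, ha, hs⟩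
  exact Filter.mem_of_superset ((IsRationalAt.eval hL h).eventually_ne_zero ha) fun b hb => hs _ hb

namespace IsRationalAt

lemma comp {L : (ι → K) → κ → K} (hL : IsRationalVecAt L a)
    {f : (κ → K) → K} (hf : IsRationalAt f (L a)) : IsRationalAt (fun b => f (L b)) a := by
  obtain ⟨p, q, hq, hpq⟩ := hf
  exact ((eval hL p).div (eval hL q) hq).congr (hL.tendsto.eventually hpq)

variable {m : Type*} [Fintype m] [DecidableEq m] {A : (ι → K) → Matrix m m K}

lemma det (hA : ∀ i j, IsRationalAt (fun b => A b i j) a) :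
    IsRationalAt (fun b => (A b).det) a := by
  simp only [Matrix.det_apply']
  exact sum _ fun σ _ => (const _).mul (prod _ fun i _ => hA _ _)

lemma matrix_inv (hA : ∀ i j, IsRationalAt (fun b => A b i j) a) (ha : (A a).det ≠ 0) (i j : m) :
    IsRationalAt (fun b => (A b)⁻¹ i j) a := by
  simp only [Matrix.inv_def, Matrix.smul_apply, smul_eq_mul, Ring.inverse_eq_inv',
    Matrix.adjugate_apply]
  refine ((det hA).inv ha).mul (det fun k l => ?_)
  by_cases hk : k = j
  · subst hk
    simpa using const (a := a) _
  · simpa [Matrix.updateRow_ne hk] using hA k l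

end IsRationalAt

lemma IsRationalVecAt.linearMap [Finite κ] {μ : Type*} {v : (ι → K) → κ → K}
    (hv : IsRationalVecAt v a) (T : (κ → K) →ₗ[K] (μ → K)) :
    IsRationalVecAt (fun b => T (v b)) a := by
  classical
  have := Fintype.ofFinite κ
  intro i
  have hT : ∀ b, T (v b) i = ∑ j, v b j * T (Pi.single j 1) i := by
    intro b
    conv_lhs => rw [pi_eq_sum_univ' (v b)]
    simp [map_sum]
  simp only [hT]
  exact IsRationalAt.sum _ fun j _ => (hv j).mul (IsRationalAt.const _)

end Rational

/-! ### Maps which lift locally to rational maps on coordinates -/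

/-- Locally, `φ` is given on coordinate vectors by rational functions.  All morphisms of the
development have this property, which is easier to check than `IsMorphism` and implies it. -/
def HasRationalLifts (K : Type*) [Field K] {X Y : Type*} [HomCoords K X] [HomCoords K Y]
    (φ : X → Y) : Prop :=
  ∀ (x : X) (a : Idx K X → K), Coord a x → ∃ L : (Idx K X → K) → (Idx K Y → K),
    IsRationalVecAt L a ∧ ∀ᶠ b in zarNhds a, ∀ y, Coord b y → Coord (L b) (φ y)

section Lifts

variable {K : Type*} [Field K] {X Y Z : Type*} [HomCoords K X] [HomCoords K Y] [HomCoords K Z]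

lemma isOpen_zariski_iff {U : Set X} : IsOpen[zariski K X] U ↔
    ∀ x ∈ U, ∀ a : Idx K X → K, Coord a x → ∀ᶠ b in zarNhds a, ∀ y, Coord b y → y ∈ U := by
  change (∀ x ∈ U, ∀ a : Idx K X → K, Coord a x → ∃ h : MvPolynomial (Idx K X) K,
    MvPolynomial.eval a h ≠ 0 ∧ ∀ (y : X) (b : Idx K X → K), Coord b y →
      MvPolynomial.eval b h ≠ 0 → y ∈ U) ↔ _
  simp only [eventually_zarNhds_iff]
  grind

namespace HasRationalLifts

lemma comp {ψ : Y → Z} {φ : X → Y} (hψ : HasRationalLifts K ψ) (hφ : HasRationalLifts K φ) :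
    HasRationalLifts K (ψ ∘ φ) := by
  intro x a ha
  obtain ⟨L, hL, hLφ⟩ := hφ x a ha
  obtain ⟨M, hM, hMψ⟩ := hψ (φ x) (L a) (self_of_eventually_zarNhds hLφ x ha)
  refine ⟨M ∘ L, fun j => IsRationalAt.comp hL (hM j), ?_⟩
  filter_upwards [hLφ, hL.tendsto.eventually hMψ] with b hLb hMb y hy
  exact hMb _ (hLb y hy)

lemma of_forall (φ : X → Y) (L : (Idx K X → K) → (Idx K Y → K))
    (hL : ∀ a, IsRationalVecAt L a) (h : ∀ b y, Coord b y → Coord (L b) (φ y)) :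
    HasRationalLifts K φ :=
  fun _ a _ => ⟨L, hL a, Filter.Eventually.of_forall h⟩

lemma val (P : X → Prop) : HasRationalLifts K (Subtype.val : {x // P x} → X) :=
  of_forall _ (fun b => b) (fun _ j => IsRationalAt.coord j) fun _ _ h => h

lemma subtype_mk {φ : X → Y} (hφ : HasRationalLifts K φ) {P : Y → Prop} (hP : ∀ x, P (φ x)) :
    HasRationalLifts K (fun x => (⟨φ x, hP x⟩ : {y // P y})) :=
  hφ

lemma fst : HasRationalLifts K (Prod.fst : X × Y → X) :=
  of_forall _ (fun b i => b (Sum.inl i)) (fun _ _ => IsRationalAt.coord _) fun _ _ h => h.1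

lemma snd : HasRationalLifts K (Prod.snd : X × Y → Y) :=
  of_forall _ (fun b i => b (Sum.inr i)) (fun _ _ => IsRationalAt.coord _) fun _ _ h => h.2

lemma prodMk {φ : X → Y} {ψ : X → Z} (hφ : HasRationalLifts K φ) (hψ : HasRationalLifts K ψ) :
    HasRationalLifts K (fun x => (φ x, ψ x)) := by
  intro x a ha
  obtain ⟨L, hL, hLφ⟩ := hφ x a ha
  obtain ⟨M, hM, hMψ⟩ := hψ x a ha
  refine ⟨fun b => Sum.elim (L b) (M b), Sum.rec hL hM, ?_⟩
  filter_upwards [hLφ, hMψ] with b hLb hMb y hy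
  exact ⟨hLb y hy, hMb y hy⟩

lemma id : HasRationalLifts K (fun x : X => x) :=
  of_forall _ (fun b => b) (fun _ j => IsRationalAt.coord j) fun _ _ h => h

lemma const (y : Y) : HasRationalLifts K (fun _ : X => y) := by
  obtain ⟨c, hc⟩ := exists_coord (K := K) y
  exact of_forall _ (fun _ => c) (fun _ _ => IsRationalAt.const _) fun _ _ _ => hc

lemma continuous {φ : X → Y} (hφ : HasRationalLifts K φ) :
    Continuous[zariski K X, zariski K Y] φ := by
  refine @Continuous.mk X Y (zariski K X) (zariski K Y) _ fun U hU => ?_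
  rw [isOpen_zariski_iff] at hU ⊢
  intro x hx a ha
  obtain ⟨L, hL, hLφ⟩ := hφ x a ha
  filter_upwards [hLφ, hL.tendsto.eventually
    (hU (φ x) hx (L a) (self_of_eventually_zarNhds hLφ x ha))] with b hLb hUb y hy
  exact hUb _ (hLb y hy)

lemma isMorphism {φ : X → Y} (hφ : HasRationalLifts K φ) : IsMorphism K φ := by
  refine ⟨hφ.continuous, fun V f _ hf x hx a ha => ?_⟩
  obtain ⟨L, hL, hLφ⟩ := hφ x a ha
  obtain ⟨g, h, hh, hgh⟩ := hf (φ x) hx (L a) (self_of_eventually_zarNhds hLφ x ha)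
  obtain ⟨G, H, hH, hGH⟩ := (IsRationalAt.eval hL g).div (IsRationalAt.eval hL h) hh
  obtain ⟨e, he, hev⟩ := eventually_zarNhds_iff.1
    ((hLφ.and hGH).and ((IsRationalAt.eval hL h).eventually_ne_zero hh))
  refine ⟨G * e, H * e, by simp [hH, he], fun y hy b hb hne => ?_⟩
  rw [map_mul] at hne
  have heb := right_ne_zero_of_mul hne
  obtain ⟨⟨hLb, hquot⟩, hhb⟩ := hev b heb
  beta_reduce at hquot
  rw [Function.comp_apply, hgh (φ y) hy (L b) (hLb y hb) hhb, hquot, map_mul, map_mul,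
    mul_div_mul_right _ _ heb]

lemma isVarietyIso {e : X ≃ Y} (h : HasRationalLifts K e) (h' : HasRationalLifts K e.symm) :
    IsVarietyIso K e :=
  ⟨h.isMorphism, h'.isMorphism⟩

end HasRationalLifts

end Lifts

/-! ### Irreducibility and projective line bundles -/

/-- A `ℙ¹`-bundle with local trivializations which lift to rational maps on coordinates. -/
def IsRationalProjLineBundle (K : Type*) [Field K] {X Y : Type*} [HomCoords K X] [HomCoords K Y]
    (f : X → Y) : Prop :=
  HasRationalLifts K f ∧ ∀ y : Y, ∃ U : Set Y, IsOpen[zariski K Y] U ∧ y ∈ U ∧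
    ∃ e : {x : X // f x ∈ U} ≃ {z : Y // z ∈ U} × ProjLine K,
      HasRationalLifts K e ∧ HasRationalLifts K e.symm ∧ ∀ x, ((e x).1 : Y) = f x

section Bundles

variable {K : Type*} [Field K] {X Y : Type*} [HomCoords K X] [HomCoords K Y]

lemma exists_eval_ne_zero [Infinite K] {ι : Type*} {h : MvPolynomial ι K} (hh : h ≠ 0) :
    ∃ c, MvPolynomial.eval c h ≠ 0 := by
  by_contra! hc
  exact hh (MvPolynomial.funext fun c => by rw [hc c, map_zero])

lemma irreducibleSpace_projectivization [Infinite K] (m : ℕ) :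
    @IrreducibleSpace (Projectivization K (Fin (m + 1) → K)) (zariski K _) := by
  refine @IrreducibleSpace.mk _ (zariski K _)
    (@PreirreducibleSpace.of_forall_nonempty_inter _ (zariski K _) ?_) inferInstance
  rintro U V hU hV ⟨x, hx⟩ ⟨y, hy⟩
  obtain ⟨a, ha⟩ := exists_coord (K := K) x
  obtain ⟨b, hb⟩ := exists_coord (K := K) y
  obtain ⟨g, hga, hg⟩ := hU x hx a ha
  obtain ⟨h, hhb, hh⟩ := hV y hy b hb
  have hg0 : g ≠ 0 := by rintro rfl; simp at hga
  have hh0 : h ≠ 0 := by rintro rfl; simp at hhb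
  obtain ⟨c, hc⟩ : ∃ c : Fin (m + 1) → K, _ := exists_eval_ne_zero
    (mul_ne_zero (mul_ne_zero hg0 hh0) (MvPolynomial.X_ne_zero (0 : Fin (m + 1))))
  rw [map_mul, map_mul, MvPolynomial.eval_X, mul_ne_zero_iff, mul_ne_zero_iff] at hc
  have hc0 : c ≠ 0 := fun h0 => hc.2 (congrFun h0 0)
  have hcoord : Coord (K := K) c (Projectivization.mk K c hc0) := ⟨hc0, rfl⟩
  exact ⟨Projectivization.mk K c hc0, hg _ c hcoord hc.1.1, hh _ c hcoord hc.1.2⟩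

lemma isOpen_fst_image {O : Set (X × Y)} (hO : IsOpen[zariski K (X × Y)] O) :
    IsOpen[zariski K X] (Prod.fst '' O) := by
  rw [isOpen_zariski_iff] at hO ⊢
  rintro _ ⟨⟨x, y⟩, hxy, rfl⟩ a ha
  obtain ⟨c, hc⟩ := exists_coord (K := K) y
  have hL : IsRationalVecAt
      (fun b : Idx K X → K => (Sum.elim b c : Idx K X ⊕ Idx K Y → K)) a :=
    Sum.rec (fun _ => IsRationalAt.coord _) fun _ => IsRationalAt.const _
  filter_upwards [hL.tendsto.eventually (hO (x, y) hxy (Sum.elim a c) ⟨ha, hc⟩)] with b hb z hz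
  exact ⟨(z, y), hb (z, y) ⟨hz, hc⟩, rfl⟩

lemma isOpen_val_image {U : Set X} (hU : IsOpen[zariski K X] U) {O : Set {x // x ∈ U}}
    (hO : IsOpen[zariski K {x // x ∈ U}] O) : IsOpen[zariski K X] (Subtype.val '' O) := by
  rw [isOpen_zariski_iff] at hO hU ⊢
  rintro _ ⟨x, hx, rfl⟩ a ha
  filter_upwards [hO x hx a ha, hU x x.2 a ha] with b hOb hUb y hy
  exact ⟨⟨y, hUb y hy⟩, hOb ⟨y, hUb y hy⟩ hy, rfl⟩

namespace IsRationalProjLineBundle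

variable {f : X → Y}

lemma isProjLineBundle (hf : IsRationalProjLineBundle K f) : IsProjLineBundle K f := by
  refine ⟨hf.1.isMorphism, fun y => ?_⟩
  obtain ⟨U, hU, hy, e, he, he', hfst⟩ := hf.2 y
  exact ⟨U, hU, hy, e, he.isVarietyIso he', hfst⟩

lemma exists_fiber_equiv (hf : IsRationalProjLineBundle K f) (z : Y) :
    ∃ φ : {x : X // f x = z} ≃ ProjLine K,
      HasRationalLifts K φ ∧ HasRationalLifts K φ.symm := by
  obtain ⟨U, -, hz, e, he, he', hfst⟩ := hf.2 z
  have hfiber : ∀ l, f (e.symm (⟨z, hz⟩, l)).1 = z := fun l => by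
    rw [← hfst, Equiv.apply_symm_apply]
  have hmem : ∀ y : {x : X // f x = z}, f y.1 ∈ U := fun y => by rw [y.2]; exact hz
  have hmk : ∀ y, (⟨z, hz⟩, (e ⟨y.1, hmem y⟩).2) = e ⟨y.1, hmem y⟩ := fun y =>
    Prod.ext (Subtype.ext (by rw [hfst, y.2])) rfl
  refine ⟨⟨fun y => (e ⟨y.1, hmem y⟩).2, fun l => ⟨(e.symm (⟨z, hz⟩, l)).1, hfiber l⟩, ?_, ?_⟩,
    ?_, ?_⟩
  · intro y
    apply Subtype.ext
    simp only [hmk, Equiv.symm_apply_apply]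
  · intro l
    simp only [Subtype.coe_eta, Equiv.apply_symm_apply]
  · exact HasRationalLifts.snd.comp (he.comp ((HasRationalLifts.val _).subtype_mk hmem))
  · exact ((HasRationalLifts.val _).comp
      (he'.comp ((HasRationalLifts.const _).prodMk HasRationalLifts.id))).subtype_mk hfiber

lemma isOpenMap (hf : IsRationalProjLineBundle K f) :
    @IsOpenMap X Y (zariski K X) (zariski K Y) f := by
  let _ := zariski K X
  let _ := zariski K Y
  intro O hO
  rw [isOpen_iff_mem_nhds]
  rintro _ ⟨x, hx, rfl⟩
  obtain ⟨U, hU, hz, e, -, he', hfst⟩ := hf.2 (f x)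
  have hOU := isOpen_val_image hU (isOpen_fst_image
    (continuous_def.1 ((HasRationalLifts.val (K := K) _).comp he').continuous O hO))
  refine Filter.mem_of_superset (hOU.mem_nhds ?_) ?_
  · exact ⟨⟨f x, hz⟩, ⟨e ⟨x, hz⟩, by simpa using hx, Subtype.ext (hfst _)⟩, rfl⟩
  · rintro _ ⟨_, ⟨w, hw, rfl⟩, rfl⟩
    exact ⟨_, hw, by rw [Function.comp_apply, ← hfst, Equiv.apply_symm_apply]⟩

lemma isIrreducible_fiber [Infinite K] (hf : IsRationalProjLineBundle K f) (y : Y) :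
    @IsIrreducible X (zariski K X) (f ⁻¹' {y}) := by
  let _ := zariski K X
  let _ := zariski K (ProjLine K)
  have : IrreducibleSpace (ProjLine K) := irreducibleSpace_projectivization 1
  obtain ⟨φ, -, hφ⟩ := hf.exists_fiber_equiv y
  have hrange : Set.range (Subtype.val ∘ φ.symm) = f ⁻¹' {y} := by
    rw [φ.symm.surjective.range_comp, Subtype.range_coe_subtype]
    rfl
  rw [← hrange, ← Set.image_univ]
  exact (IrreducibleSpace.isIrreducible_univ _).image _
    ((HasRationalLifts.val _).comp hφ).continuous.continuousOn

lemma irreducibleSpace [Infinite K] (hf : IsRationalProjLineBundle K f)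
    (hY : @IrreducibleSpace Y (zariski K Y)) : @IrreducibleSpace X (zariski K X) := by
  let _ := zariski K X
  let _ := zariski K Y
  rw [irreducibleSpace_def] at hY ⊢
  obtain ⟨y⟩ : Nonempty Y := ⟨hY.nonempty.some⟩
  obtain ⟨x, -⟩ := (hf.isIrreducible_fiber y).nonempty
  exact hY.preimage_of_isPreirreducible_fiber f hf.isOpenMap
    (fun z => (hf.isIrreducible_fiber z).isPreirreducible) ⟨f x, trivial, x, rfl⟩

end IsRationalProjLineBundle

end Bundles

/-! ### Rational families of vectors and subspaces -/

section RationalVectors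

variable {K : Type*} [Field K] {ι κ : Type*} {a : ι → K}

lemma det_ne_zero_iff_linearIndependent_rows {m : Type*} [Fintype m] [DecidableEq m]
    (A : Matrix m m K) : A.det ≠ 0 ↔ LinearIndependent K A.row := by
  rw [← isUnit_iff_ne_zero, ← Matrix.isUnit_iff_isUnit_det,
    Matrix.linearIndependent_rows_iff_isUnit]

namespace IsRationalVecAt

lemma const (v : κ → K) : IsRationalVecAt (fun _ : ι → K => v) a :=
  fun _ => IsRationalAt.const _

lemma sum_smul {μ : Type*} {s : Finset μ} {t : μ → (ι → K) → K} {v : μ → (ι → K) → κ → K}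
    (ht : ∀ j, IsRationalAt (t j) a) (hv : ∀ j, IsRationalVecAt (v j) a) :
    IsRationalVecAt (fun b => ∑ j ∈ s, t j b • v j b) a := by
  intro c
  simp only [Finset.sum_apply, Pi.smul_apply, smul_eq_mul]
  exact IsRationalAt.sum _ fun j _ => (ht j).mul (hv j c)

lemma exists_solution {m : Type*} [Fintype m] {y : m → (ι → K) → m → K} {x : (ι → K) → m → K}
    (hy : ∀ i, IsRationalVecAt (y i) a) (hx : IsRationalVecAt x a)
    (hli : LinearIndependent K fun i => y i a) :
    ∃ t : m → (ι → K) → K, (∀ i, IsRationalAt (t i) a) ∧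
      ∀ᶠ b in zarNhds a, ∑ i, t i b • y i b = x b := by
  classical
  let A : (ι → K) → Matrix m m K := fun b => Matrix.of fun i => y i b
  have hA : ∀ i j, IsRationalAt (fun b => A b i j) a := hy
  have hdet : (A a).det ≠ 0 := (det_ne_zero_iff_linearIndependent_rows _).2 hli
  refine ⟨fun i b => Matrix.vecMul (x b) (A b)⁻¹ i, fun i => ?_, ?_⟩
  · simp only [Matrix.vecMul, dotProduct]
    exact IsRationalAt.sum _ fun j _ => (hx j).mul (IsRationalAt.matrix_inv hA hdet j i)
  · filter_upwards [(IsRationalAt.det hA).eventually_ne_zero hdet] with b hb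
    have hsolve : Matrix.vecMul (Matrix.vecMul (x b) (A b)⁻¹) (A b) = x b := by
      rw [Matrix.vecMul_vecMul, Matrix.nonsing_inv_mul _ (isUnit_iff_ne_zero.2 hb),
        Matrix.vecMul_one]
    rwa [Matrix.vecMul_eq_sum] at hsolve

lemma eventually_linearIndependent {m : Type*} [Finite m] [Finite κ] {v : m → (ι → K) → κ → K}
    (hv : ∀ j, IsRationalVecAt (v j) a) {W : Type*} [AddCommGroup W] [Module K W]
    (T : (κ → K) →ₗ[K] W) (hli : LinearIndependent K fun j => T (v j a)) :
    ∀ᶠ b in zarNhds a, LinearIndependent K fun j => T (v j b) := by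
  classical
  have := Fintype.ofFinite m
  obtain ⟨g, hg⟩ := LinearMap.exists_leftInverse_of_injective
    (Fintype.linearCombination K fun j => T (v j a))
    (LinearMap.ker_eq_bot.2 (LinearIndependent.fintypeLinearCombination_injective hli))
  have hgv : ∀ j, g (T (v j a)) = Pi.single j 1 := fun j => by
    simpa [Fintype.linearCombination_apply_single] using LinearMap.congr_fun hg (Pi.single j 1)
  let A : (ι → K) → Matrix m m K := fun b => Matrix.of fun i => g (T (v i b))
  have hA : ∀ i j, IsRationalAt (fun b => A b i j) a := fun i => (hv i).linearMap (g ∘ₗ T)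
  have hAa : A a = 1 := by
    ext i j
    change g (T (v i a)) j = _
    rw [hgv, Matrix.one_apply, Pi.single_apply]
    simp only [eq_comm]
  filter_upwards [(IsRationalAt.det hA).eventually_ne_zero (by simp [hAa])] with b hb
  exact LinearIndependent.of_comp g ((det_ne_zero_iff_linearIndependent_rows _).1 hb)

end IsRationalVecAt

lemma linearIndependent_comp_iff_disjoint_ker {V V' : Type*} [AddCommGroup V] [Module K V]
    [AddCommGroup V'] [Module K V'] {m : ℕ} {v : Fin m → V} {W : Submodule K V}
    (hv : Submodule.span K (Set.range v) = W) (hW : Module.finrank K W = m) (T : V →ₗ[K] V') :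
    LinearIndependent K (fun j => T (v j)) ↔ Disjoint W (LinearMap.ker T) := by
  have hli : LinearIndependent K v := by
    rw [linearIndependent_iff_card_eq_finrank_span, Set.finrank, hv, hW, Fintype.card_fin]
  subst hv
  exact ⟨Submodule.range_ker_disjoint, hli.map⟩

end RationalVectors

/-- The family of subspaces `W` is spanned, locally on `X`, by vectors indexed by `κ` which depend
rationally on the coordinates. -/
def IsRationallySpanned {K : Type*} [Field K] {X : Type*} [HomCoords K X] {n : ℕ} (κ : Type*)
    (W : X → Submodule K (Fin n → K)) : Prop :=
  ∀ (x : X) (a : Idx K X → K), Coord a x → ∃ v : κ → (Idx K X → K) → Fin n → K,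
    (∀ j, IsRationalVecAt (v j) a) ∧
      ∀ᶠ b in zarNhds a, ∀ y, Coord b y → Submodule.span K (Set.range fun j => v j b) = W y

section Grassmannians

variable {K : Type*} [Field K] {n : ℕ}

namespace Gr

lemma coord_iff {m : ℕ} {a : Fin m × Fin n → K} {W : Gr K m n} :
    Coord (K := K) a W ↔
      Submodule.span K (Set.range fun (i : Fin m) (j : Fin n) => a (i, j)) = W.1 := Iff.rfl

lemma isOpen_disjoint (m : ℕ) (E : Submodule K (Fin n → K)) :
    IsOpen[zariski K (Gr K m n)] {W | Disjoint W.1 E} := by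
  rw [isOpen_zariski_iff]
  intro W hW a ha
  have hrows : ∀ᶠ b in zarNhds a, LinearIndependent K fun i => E.mkQ fun j => b (i, j) :=
    IsRationalVecAt.eventually_linearIndependent (v := fun (i : Fin m) b j => b (i, j))
      (fun i j => IsRationalAt.coord (i, j)) E.mkQ
      ((linearIndependent_comp_iff_disjoint_ker (coord_iff.1 ha) W.2 E.mkQ).2
        (by rwa [Submodule.ker_mkQ]))
  filter_upwards [hrows] with b hb W' hW'
  simpa only [Submodule.ker_mkQ] using
    (linearIndependent_comp_iff_disjoint_ker (coord_iff.1 hW') W'.2 E.mkQ).1 hb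

lemma isOpen_notMem (m : ℕ) (v : Fin n → K) :
    IsOpen[zariski K (Gr K m n)] {W | v ∉ W.1} := by
  by_cases hv : v = 0
  · subst hv
    simp
  · convert isOpen_disjoint m (Submodule.span K {v}) using 1
    ext W
    exact (Submodule.disjoint_span_singleton' hv).symm

end Gr

variable {X : Type*} [HomCoords K X]

lemma HasRationalLifts.isRationallySpanned {m : ℕ} {ψ : X → Gr K m n} (h : HasRationalLifts K ψ) :
    IsRationallySpanned (Fin m) fun x => (ψ x).1 := by
  intro x a ha
  obtain ⟨L, hL, hψ⟩ := h x a ha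
  exact ⟨fun i b j => L b (i, j), fun i j => hL _, hψ⟩

namespace IsRationallySpanned

variable {κ μ : Type*} {W W' : X → Submodule K (Fin n → K)}

lemma hasRationalLifts [Finite κ] {m : ℕ} {ψ : X → Gr K m n}
    (h : IsRationallySpanned κ fun x => (ψ x).1) (hκ : Nat.card κ = m) : HasRationalLifts K ψ := by
  subst hκ
  intro x a ha
  obtain ⟨v, hv, hvψ⟩ := h x a ha
  refine ⟨fun b ij => v ((Finite.equivFin κ).symm ij.1) b ij.2, fun ij => hv _ _, ?_⟩
  filter_upwards [hvψ] with b hb y hy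
  rw [Gr.coord_iff, ← hb y hy]
  exact congrArg _ ((Finite.equivFin κ).symm.surjective.range_comp fun j => v j b)

lemma const (W : Submodule K (Fin n → K)) :
    IsRationallySpanned (Fin (Module.finrank K W)) fun _ : X => W := by
  intro x a _
  let c := Module.finBasis K W
  refine ⟨fun j _ => c j, fun j => IsRationalVecAt.const _, .of_forall fun b y _ => ?_⟩
  rw [show (fun j => (c j : Fin n → K)) = W.subtype ∘ c from rfl, Set.range_comp,
    Submodule.span_image, c.span_eq, Submodule.map_top, Submodule.range_subtype]

lemma map {n' : ℕ} (h : IsRationallySpanned κ W) (T : (Fin n → K) →ₗ[K] (Fin n' → K)) :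
    IsRationallySpanned κ fun x => (W x).map T := by
  intro x a ha
  obtain ⟨v, hv, hvW⟩ := h x a ha
  refine ⟨fun j b => T (v j b), fun j => (hv j).linearMap T, ?_⟩
  filter_upwards [hvW] with b hb y hy
  rw [← hb y hy, Submodule.map_span, ← Set.range_comp]
  rfl

lemma sup (h : IsRationallySpanned κ W) (h' : IsRationallySpanned μ W') :
    IsRationallySpanned (κ ⊕ μ) fun x => W x ⊔ W' x := by
  intro x a ha
  obtain ⟨v, hv, hvW⟩ := h x a ha
  obtain ⟨v', hv', hvW'⟩ := h' x a ha
  refine ⟨Sum.elim v v', Sum.rec hv hv', ?_⟩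
  filter_upwards [hvW, hvW'] with b hb hb' y hy
  rw [← hb y hy, ← hb' y hy, ← Submodule.span_union, ← Set.Sum.elim_range]
  congr 2
  exact funext (Sum.rec (fun _ => rfl) fun _ => rfl)

end IsRationallySpanned

lemma comap_eq_map_section_sup_ker {V V' : Type*} [AddCommGroup V] [Module K V] [AddCommGroup V']
    [Module K V'] {T : V →ₗ[K] V'} {S : V' →ₗ[K] V} (hS : ∀ v ∈ LinearMap.range T, T (S v) = v)
    {W : Submodule K V'} (hW : W ≤ LinearMap.range T) :
    W.comap T = W.map S ⊔ LinearMap.ker T := by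
  have hmap : (W.map S).map T = W := by
    rw [← Submodule.map_comp]
    exact SetLike.coe_injective (Set.EqOn.image_eq_self fun w hw => hS w (hW hw))
  rw [← Submodule.comap_map_eq, hmap]

lemma exists_section_on_range {V V' : Type*} [AddCommGroup V] [Module K V] [AddCommGroup V']
    [Module K V'] (T : V →ₗ[K] V') :
    ∃ S : V' →ₗ[K] V, ∀ v ∈ LinearMap.range T, T (S v) = v := by
  obtain ⟨g, hg⟩ := T.rangeRestrict.exists_rightInverse_of_surjective T.range_rangeRestrict
  obtain ⟨S, hS⟩ := g.exists_extend
  refine ⟨S, fun v hv => ?_⟩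
  rw [show S v = g ⟨v, hv⟩ from LinearMap.congr_fun hS ⟨v, hv⟩]
  exact congrArg Subtype.val (LinearMap.congr_fun hg ⟨v, hv⟩)

lemma HasRationalLifts.comap {m m' n' : ℕ} (T : (Fin n' → K) →ₗ[K] (Fin n → K)) {B : X → Gr K m n}
    (hB : HasRationalLifts K B) (hBT : ∀ x, (B x).1 ≤ LinearMap.range T)
    (hm : m + Module.finrank K (LinearMap.ker T) = m') {ψ : X → Gr K m' n'}
    (hψ : ∀ x, (ψ x).1 = (B x).1.comap T) : HasRationalLifts K ψ := by
  obtain ⟨S, hS⟩ := exists_section_on_range T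
  have hspan := (hB.isRationallySpanned.map S).sup (IsRationallySpanned.const (LinearMap.ker T))
  simp only [← comap_eq_map_section_sup_ker hS (hBT _), ← hψ] at hspan
  exact hspan.hasRationalLifts (by simp [hm])

/-- As `v b - u ∈ E` determines `v b`, Cramer's rule provides it as a rational function of `b`. -/
lemma HasRationalLifts.exists_rational_section {m : ℕ} {B : X → Gr K m n}
    (hB : HasRationalLifts K B) {x : X} {a : Idx K X → K} (ha : Coord a x)
    {E : Submodule K (Fin n → K)} (hE : IsCompl (B x).1 E) {u : Fin n → K} (hu : u ∈ (B x).1) :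
    ∃ v : (Idx K X → K) → Fin n → K, IsRationalVecAt v a ∧ v a = u ∧
      ∀ᶠ b in zarNhds a, ∀ y, Coord b y → v b ∈ (B y).1 ∧ v b - u ∈ E := by
  let P : (Fin n → K) →ₗ[K] (Fin m → K) :=
    (LinearEquiv.ofFinrankEq _ _ ((B x).2.trans (Module.finrank_fin_fun K).symm)).toLinearMap ∘ₗ
      (Submodule.quotientEquivOfIsCompl E (B x).1 hE.symm).toLinearMap ∘ₗ E.mkQ
  have hker : LinearMap.ker P = E := by
    rw [LinearMap.ker_comp_of_ker_eq_bot _ (LinearEquiv.ker _),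
      LinearMap.ker_comp_of_ker_eq_bot _ (LinearEquiv.ker _), Submodule.ker_mkQ]
  obtain ⟨r, hr, hrB⟩ := hB.isRationallySpanned x a ha
  have hli : LinearIndependent K fun i => P (r i a) :=
    (linearIndependent_comp_iff_disjoint_ker (self_of_eventually_zarNhds hrB x ha) (B x).2 P).2
      (by rw [hker]; exact hE.disjoint)
  obtain ⟨t, ht, htP⟩ := IsRationalVecAt.exists_solution (fun i => (hr i).linearMap P)
    (IsRationalVecAt.const (P u)) hli
  have hsec : ∀ᶠ b in zarNhds a, ∀ y, Coord b y →
      ∑ i, t i b • r i b ∈ (B y).1 ∧ ∑ i, t i b • r i b - u ∈ E := by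
    filter_upwards [hrB, htP] with b hrb htb y hy
    refine ⟨?_, ?_⟩
    · rw [← hrb y hy]
      exact Submodule.sum_mem _ fun i _ => Submodule.smul_mem _ _ (Submodule.subset_span ⟨i, rfl⟩)
    · rw [← hker, LinearMap.mem_ker, map_sub, map_sum, sub_eq_zero, ← htb]
      simp only [map_smul]
  obtain ⟨hmem, hsub⟩ := self_of_eventually_zarNhds hsec x ha
  exact ⟨_, IsRationalVecAt.sum_smul ht hr, sub_eq_zero.1
    (Submodule.disjoint_def.1 hE.disjoint _ (Submodule.sub_mem _ hmem hu) hsub), hsec⟩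

end Grassmannians

/-! ### Partial flags -/

namespace GrProd

variable {K : Type*} [Field K] {n r s : ℕ}

/-- The member of dimension `i` of a sequence of subspaces of dimensions `1, …, r`, prolonged by
`⊥` for `i = 0` and by `⊤` for `i > r`. -/
def flag (F : GrProd K n r) : ℕ → Submodule K (Fin n → K)
  | 0 => ⊥
  | i + 1 => if h : i < r then (F ⟨i, h⟩).1 else ⊤

@[simp] lemma flag_zero (F : GrProd K n r) : F.flag 0 = ⊥ := rfl

lemma flag_succ (F : GrProd K n r) {i : ℕ} (h : i < r) : F.flag (i + 1) = (F ⟨i, h⟩).1 :=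
  dif_pos h

lemma finrank_flag (F : GrProd K n r) {i : ℕ} (h : i ≤ r) :
    Module.finrank K (F.flag i) = i := by
  cases i with
  | zero => exact finrank_bot K _
  | succ i => rw [F.flag_succ h]; exact (F ⟨i, h⟩).2

lemma flag_trunc (h : r ≤ s) (F : GrProd K n s) {i : ℕ} (hi : i ≤ r) :
    (trunc K h F).flag i = F.flag i := by
  cases i with
  | zero => rfl
  | succ i => rw [flag_succ _ hi, flag_succ _ (hi.trans h)]; rfl

lemma ext_flag {F G : GrProd K n r} (h : ∀ i ≤ r, F.flag i = G.flag i) : F = G := by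
  refine funext fun i => Subtype.ext ?_
  simpa only [flag_succ _ i.2] using h (i + 1) i.2

/-- The member of dimension `i` as a point of the Grassmannian. -/
def member {i : ℕ} (h : i ≤ r) (F : GrProd K n r) : Gr K i n :=
  ⟨F.flag i, F.finrank_flag h⟩

lemma hasRationalLifts_member {i : ℕ} (h : i ≤ r) :
    HasRationalLifts K (member h : GrProd K n r → Gr K i n) := by
  suffices IsRationallySpanned (Fin i) fun F : GrProd K n r => F.flag i from
    this.hasRationalLifts (Nat.card_fin i)
  intro F a _
  cases i with
  | zero => exact ⟨finZeroElim, finZeroElim, .of_forall fun b G _ => by simp⟩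
  | succ i =>
    refine ⟨fun j b c => b ⟨⟨i, h⟩, (j, c)⟩, fun j c => IsRationalAt.coord _,
      .of_forall fun b G hG => ?_⟩
    exact (hG ⟨i, h⟩).trans (G.flag_succ h).symm

lemma hasRationalLifts_trunc (h : r ≤ s) :
    HasRationalLifts K (trunc K h : GrProd K n s → GrProd K n r) :=
  HasRationalLifts.of_forall _ (fun b i => b ⟨Fin.castLE h i.1, i.2⟩)
    (fun _ _ => IsRationalAt.coord _) fun _ _ hF i => hF (Fin.castLE h i)

/-- The sequence `F` followed by a subspace of the next dimension. -/
def snoc (F : GrProd K n r) (W : Gr K (r + 1) n) : GrProd K n (r + 1) :=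
  Fin.snoc (α := fun i : Fin (r + 1) => Gr K (i + 1) n) F W

lemma trunc_snoc (F : GrProd K n r) (W : Gr K (r + 1) n) :
    trunc K (Nat.le_succ r) (F.snoc W) = F :=
  funext fun i => Fin.snoc_castSucc (α := fun i : Fin (r + 1) => Gr K (i + 1) n) W F i

lemma flag_snoc_last (F : GrProd K n r) (W : Gr K (r + 1) n) :
    (F.snoc W).flag (r + 1) = W.1 := by
  rw [flag_succ _ (Nat.lt_succ_self r)]
  exact congrArg Subtype.val
    (Fin.snoc_last (α := fun i : Fin (r + 1) => Gr K (i + 1) n) W F)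

lemma flag_snoc (F : GrProd K n r) (W : Gr K (r + 1) n) {i : ℕ} (hi : i ≤ r) :
    (F.snoc W).flag i = F.flag i := by
  rw [← flag_trunc (Nat.le_succ r) _ hi, trunc_snoc]

lemma ext_trunc {F G : GrProd K n (r + 1)}
    (htrunc : trunc K (Nat.le_succ r) F = trunc K (Nat.le_succ r) G)
    (hlast : F.flag (r + 1) = G.flag (r + 1)) : F = G := by
  refine ext_flag fun i hi => ?_
  rcases Nat.lt_or_eq_of_le hi with hi | rfl
  · rw [← flag_trunc (Nat.le_succ r) F (Nat.lt_succ_iff.1 hi), htrunc,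
      flag_trunc _ _ (Nat.lt_succ_iff.1 hi)]
  · exact hlast

end GrProd

lemma HasRationalLifts.snoc {K : Type*} [Field K] {n r : ℕ} {X : Type*} [HomCoords K X]
    {φ : X → GrProd K n r} {ψ : X → Gr K (r + 1) n} (hφ : HasRationalLifts K φ)
    (hψ : HasRationalLifts K ψ) : HasRationalLifts K (fun x => (φ x).snoc (ψ x)) := by
  intro x a ha
  obtain ⟨L, hL, hLφ⟩ := hφ x a ha
  obtain ⟨M, hM, hMψ⟩ := hψ x a ha
  refine ⟨fun b s => Fin.snoc (α := fun i : Fin (r + 1) => Idx K (Gr K (i + 1) n) → K)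
    (fun i j => L b ⟨i, j⟩) (M b) s.1 s.2, ?_, ?_⟩
  · rintro ⟨i, j⟩
    induction i using Fin.lastCases with
    | last => simpa using hM j
    | cast i => simpa using hL ⟨i, j⟩
  · filter_upwards [hLφ, hMψ] with b hLb hMb y hy i
    induction i using Fin.lastCases with
    | last => simpa [GrProd.snoc] using hMb y hy
    | cast i => simpa [GrProd.snoc] using hLb y hy i

section Truncation

variable {K : Type*} [Field K] {n r : ℕ} {Z' : Set (GrProd K n (r + 1))} {Z : Set (GrProd K n r)}

/-- The map between sets of partial flags which forgets the last member. -/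
def truncMap (h : ∀ F ∈ Z', GrProd.trunc K (Nat.le_succ r) F ∈ Z) (F : Z') : Z :=
  ⟨GrProd.trunc K (Nat.le_succ r) F.1, h F.1 F.2⟩

lemma hasRationalLifts_truncMap (h : ∀ F ∈ Z', GrProd.trunc K (Nat.le_succ r) F ∈ Z) :
    HasRationalLifts K (truncMap h) :=
  ((GrProd.hasRationalLifts_trunc (Nat.le_succ r)).comp (HasRationalLifts.val _)).subtype_mk _

lemma exists_equiv_eq_truncMap (h : ∀ F ∈ Z', GrProd.trunc K (Nat.le_succ r) F ∈ Z)
    {ψ : Z → Gr K (r + 1) n} (hψ : HasRationalLifts K ψ)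
    (hZ : ∀ F : GrProd K n (r + 1), F ∈ Z' ↔
      ∃ hF : GrProd.trunc K (Nat.le_succ r) F ∈ Z, F.flag (r + 1) = (ψ ⟨_, hF⟩).1) :
    ∃ φ : Z' ≃ Z, HasRationalLifts K φ ∧ HasRationalLifts K φ.symm ∧ ⇑φ = truncMap h := by
  have hmem (F : Z) : F.1.snoc (ψ F) ∈ Z' := by
    have htrunc : GrProd.trunc K (Nat.le_succ r) (F.1.snoc (ψ F)) = F.1 := GrProd.trunc_snoc _ _
    refine (hZ _).2 ⟨by rw [htrunc]; exact F.2, ?_⟩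
    rw [GrProd.flag_snoc_last]
    congr 2
    exact Subtype.ext htrunc.symm
  refine ⟨⟨truncMap h, fun F => ⟨F.1.snoc (ψ F), hmem F⟩, fun F => ?_, fun F => ?_⟩,
    hasRationalLifts_truncMap h, ((HasRationalLifts.val _).snoc hψ).subtype_mk _, rfl⟩
  · refine Subtype.ext (GrProd.ext_trunc (GrProd.trunc_snoc _ _) ?_)
    rw [GrProd.flag_snoc_last]
    exact ((hZ F.1).1 F.2).2.symm
  · exact Subtype.ext (GrProd.trunc_snoc _ _)

end Truncation

/-! ### Pencils of subspaces -/

section Pencils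

variable {K : Type*} [Field K] {V : Type*} [AddCommGroup V] [Module K V]
  {W M C F : Submodule K V} {β : V →ₗ[K] (Fin 2 → K)}

/-- Linear data which identify the pencil of the subspaces `W < F < M` with `ℙ¹`: a complement `C`
of `W` and a linear map `β` which restricts to an isomorphism from `M ⊓ C` onto `K²`. The last
requirement is put as a disjointness, which is visibly an open condition on `M`. -/
structure IsPencilChart (W M C : Submodule K V) (β : V →ₗ[K] (Fin 2 → K)) : Prop where
  le : W ≤ M
  finrank_eq : Module.finrank K M = Module.finrank K W + 2
  isCompl : IsCompl W C
  disjoint : Disjoint M (C ⊓ LinearMap.ker β)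

/-- The member of the pencil of the subspaces `W < F < M` which corresponds to the line `l` in a
chart `(C, β)`. -/
def pencilMember (W M C : Submodule K V) (β : V →ₗ[K] (Fin 2 → K)) (l : ProjLine K) :
    Submodule K V :=
  W ⊔ M ⊓ C ⊓ l.submodule.comap β

lemma sup_inf_eq_of_isCompl (hC : IsCompl W C) (hWM : W ≤ M) : W ⊔ M ⊓ C = M := by
  rw [inf_comm, ← sup_inf_assoc_of_le _ hWM, hC.sup_eq_top, top_inf_eq]

lemma finrank_inf_of_isCompl [FiniteDimensional K V] (hC : IsCompl W C) (hWM : W ≤ M) :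
    Module.finrank K W + Module.finrank K (M ⊓ C : Submodule K V) = Module.finrank K M := by
  rw [← Submodule.finrank_sup_add_finrank_inf_eq, sup_inf_eq_of_isCompl hC hWM,
    (hC.disjoint.mono_right inf_le_right).eq_bot, finrank_bot, add_zero]

lemma sup_span_singleton_eq [FiniteDimensional K V] (hWF : W ≤ F)
    (hF : Module.finrank K F = Module.finrank K W + 1) {v : V} (hv : v ∈ F) (hvW : v ∉ W) :
    W ⊔ Submodule.span K {v} = F :=
  Submodule.eq_of_le_of_finrank_eq
    (sup_le hWF ((Submodule.span_singleton_le_iff_mem _ _).2 hv))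
    (by rw [Submodule.finrank_sup_span_singleton hvW, hF])

namespace IsPencilChart

lemma pencilMember_le (h : IsPencilChart W M C β) (l : ProjLine K) :
    pencilMember W M C β l ≤ M :=
  sup_le h.le (inf_le_left.trans inf_le_left)

lemma eq_of_apply_eq (h : IsPencilChart W M C β) {v v' : V} (hv : v ∈ M ⊓ C) (hv' : v' ∈ M ⊓ C)
    (heq : β v = β v') : v = v' := by
  have hsub := Submodule.sub_mem _ hv hv'
  exact sub_eq_zero.1 (Submodule.disjoint_def.1 h.disjoint _ hsub.1
    ⟨hsub.2, LinearMap.mem_ker.2 (by rw [map_sub, heq, sub_self])⟩)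

lemma inf_comap_mk (h : IsPencilChart W M C β) {v : V} (hv : v ∈ M ⊓ C) (hβv : β v ≠ 0) :
    M ⊓ C ⊓ (Projectivization.mk K (β v) hβv).submodule.comap β = Submodule.span K {v} := by
  rw [Projectivization.submodule_mk]
  refine le_antisymm ?_ ?_
  · rintro u ⟨hu, hβu⟩
    obtain ⟨c, hc⟩ := Submodule.mem_span_singleton.1 hβu
    refine Submodule.mem_span_singleton.2 ⟨c, ?_⟩
    exact h.eq_of_apply_eq (Submodule.smul_mem _ c hv) hu (by rw [map_smul, hc])
  · rw [Submodule.span_singleton_le_iff_mem]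
    exact ⟨hv, Submodule.mem_span_singleton_self (β v)⟩

variable [FiniteDimensional K V]

lemma exists_apply_eq (h : IsPencilChart W M C β) (t : Fin 2 → K) : ∃ v ∈ M ⊓ C, β v = t := by
  have hinj : Function.Injective (β ∘ₗ (M ⊓ C).subtype) := fun v v' heq =>
    Subtype.ext (h.eq_of_apply_eq v.2 v'.2 heq)
  have hfin : Module.finrank K (M ⊓ C : Submodule K V) = Module.finrank K (Fin 2 → K) := by
    rw [Module.finrank_fin_fun]
    have := finrank_inf_of_isCompl h.isCompl h.le
    have := h.finrank_eq
    lia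
  obtain ⟨v, hv⟩ := (LinearMap.injective_iff_surjective_of_finrank_eq_finrank hfin).1 hinj t
  exact ⟨v, v.2, hv⟩

lemma isCompl_inf_ker (h : IsPencilChart W M C β) : IsCompl M (C ⊓ LinearMap.ker β) := by
  refine ⟨h.disjoint, codisjoint_iff_le_sup.2 ?_⟩
  rw [← h.isCompl.sup_eq_top]
  refine sup_le (h.le.trans le_sup_left) fun c hc => ?_
  obtain ⟨v, hv, hβ⟩ := h.exists_apply_eq (β c)
  have hker : β (c - v) = 0 := by rw [map_sub, hβ, sub_self]
  exact Submodule.mem_sup.2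
    ⟨v, hv.1, c - v, ⟨Submodule.sub_mem _ hc hv.2, hker⟩, add_sub_cancel v c⟩

lemma pencilMember_injective (h : IsPencilChart W M C β) :
    Function.Injective (pencilMember W M C β) := by
  have hmap (l : ProjLine K) : (pencilMember W M C β l ⊓ C).map β = l.submodule := by
    rw [pencilMember, sup_comm, sup_inf_assoc_of_le _ (inf_le_left.trans inf_le_right),
      h.isCompl.inf_eq_bot, sup_bot_eq]
    refine le_antisymm (Submodule.map_le_iff_le_comap.2 inf_le_right) fun t ht => ?_
    obtain ⟨v, hv, rfl⟩ := h.exists_apply_eq t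
    exact Submodule.mem_map_of_mem ⟨hv, ht⟩
  intro l l' hl
  exact Projectivization.submodule_injective (by rw [← hmap l, ← hmap l', hl])

lemma finrank_pencilMember (h : IsPencilChart W M C β) (l : ProjLine K) :
    Module.finrank K (pencilMember W M C β l) = Module.finrank K W + 1 := by
  obtain ⟨v, hv, hβ⟩ := h.exists_apply_eq l.rep
  have hβv : β v ≠ 0 := hβ ▸ l.rep_nonzero
  have hl : Projectivization.mk K (β v) hβv = l := by
    simp only [hβ, Projectivization.mk_rep]
  rw [← hl, pencilMember, h.inf_comap_mk hv hβv,
    Submodule.finrank_sup_span_singleton fun hvW => hβv ?_]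
  rw [Submodule.disjoint_def.1 h.isCompl.disjoint v hvW hv.2, map_zero]

lemma eq_pencilMember (h : IsPencilChart W M C β) (hWF : W ≤ F) (hFM : F ≤ M)
    (hF : Module.finrank K F = Module.finrank K W + 1) {v : V} (hv : v ∈ F ⊓ C)
    (hβv : β v ≠ 0) : F = pencilMember W M C β (Projectivization.mk K (β v) hβv) := by
  rw [pencilMember, h.inf_comap_mk ⟨hFM hv.1, hv.2⟩ hβv,
    sup_span_singleton_eq hWF hF hv.1 fun hvW => hβv ?_]
  rw [Submodule.disjoint_def.1 h.isCompl.disjoint v hvW hv.2, map_zero]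

lemma exists_mem_apply_ne_zero (h : IsPencilChart W M C β) (hWF : W ≤ F) (hFM : F ≤ M)
    (hF : Module.finrank K F = Module.finrank K W + 1) : ∃ v ∈ F ⊓ C, β v ≠ 0 := by
  have hFC : F ⊓ C ≠ ⊥ := fun hbot => by
    have := finrank_inf_of_isCompl h.isCompl hWF
    rw [hbot, finrank_bot] at this
    lia
  obtain ⟨v, hv, hv0⟩ := Submodule.exists_mem_ne_zero_of_ne_bot hFC
  exact ⟨v, hv, fun hβ => hv0 (Submodule.disjoint_def.1 h.disjoint v (hFM hv.1) ⟨hv.2, hβ⟩)⟩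

lemma exists_eq_pencilMember (h : IsPencilChart W M C β) (hWF : W ≤ F) (hFM : F ≤ M)
    (hF : Module.finrank K F = Module.finrank K W + 1) : ∃ l, F = pencilMember W M C β l := by
  obtain ⟨v, hv, hβv⟩ := h.exists_mem_apply_ne_zero hWF hFM hF
  exact ⟨_, h.eq_pencilMember hWF hFM hF hv hβv⟩

end IsPencilChart

lemma exists_isPencilChart [FiniteDimensional K V] (hWM : W ≤ M)
    (hM : Module.finrank K M = Module.finrank K W + 2) :
    ∃ (C : Submodule K V) (β : V →ₗ[K] (Fin 2 → K)), IsPencilChart W M C β := by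
  obtain ⟨C, hC⟩ := W.exists_isCompl
  have hfin := finrank_inf_of_isCompl hC hWM
  let e : (M ⊓ C : Submodule K V) ≃ₗ[K] (Fin 2 → K) :=
    LinearEquiv.ofFinrankEq _ _ (by rw [Module.finrank_fin_fun]; lia)
  obtain ⟨β, hβ⟩ := e.toLinearMap.exists_extend
  refine ⟨C, β, hWM, hM, hC, Submodule.disjoint_def.2 fun v hvM hv => ?_⟩
  have hev : e ⟨v, hvM, hv.1⟩ = 0 := (LinearMap.congr_fun hβ ⟨v, hvM, hv.1⟩).symm.trans hv.2
  simpa using congrArg Subtype.val (e.map_eq_zero_iff.1 hev)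

end Pencils

section PencilBundles

variable {K : Type*} [Field K] {n r : ℕ} {C : Submodule K (Fin n → K)}
  {β : (Fin n → K) →ₗ[K] (Fin 2 → K)}

namespace IsPencilChart

variable {X : Type*} [HomCoords K X] {W : X → Gr K r n} {M : X → Gr K (r + 2) n}

lemma hasRationalLifts_of_eq_pencilMember
    (h : ∀ x, IsPencilChart (W x).1 (M x).1 C β) (hW : HasRationalLifts K W)
    (hM : HasRationalLifts K M) {ψ : X × ProjLine K → Gr K (r + 1) n}
    (hψ : ∀ x l, (ψ (x, l)).1 = pencilMember (W x).1 (M x).1 C β l) : HasRationalLifts K ψ := by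
  have hline : IsRationallySpanned Unit fun y : X × ProjLine K =>
      (M y.1).1 ⊓ C ⊓ y.2.submodule.comap β := by
    rintro ⟨x, l⟩ a ha
    choose u huMC huβ using fun i => (h x).exists_apply_eq (Pi.single i 1)
    choose s hs _ hsM using fun i => (hM.comp HasRationalLifts.fst).exists_rational_section
      ha (h x).isCompl_inf_ker (huMC i).1
    let k : (Idx K (X × ProjLine K) → K) → Fin n → K := fun b =>
      ∑ i : Fin 2, b (Sum.inr i) • s i b
    refine ⟨fun _ => k, fun _ => IsRationalVecAt.sum_smul (fun i => IsRationalAt.coord _) hs, ?_⟩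
    filter_upwards [Filter.eventually_all.2 hsM] with b hb y hy
    have hsC (i) : s i b ∈ (M y.1).1 ⊓ C :=
      ⟨(hb i y hy).1, (Submodule.sub_mem_iff_left _ (huMC i).2).1 (hb i y hy).2.1⟩
    have hsβ (i) : β (s i b) = Pi.single i 1 := by
      rw [← huβ, ← sub_eq_zero, ← map_sub]
      exact (hb i y hy).2.2
    have hk : k b ∈ (M y.1).1 ⊓ C := Submodule.sum_mem _ fun i _ => Submodule.smul_mem _ _ (hsC i)
    have hβ : β (k b) = fun i : Fin 2 => b (Sum.inr i) := by
      simp only [k, map_sum, map_smul, hsβ]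
      exact (pi_eq_sum_univ' _).symm
    obtain ⟨hb0, hyl⟩ := hy.2
    rw [← hyl, Set.range_const, ← (h y.1).inf_comap_mk hk (hβ ▸ hb0)]
    simp only [hβ]
    rfl
  have hsup := (hW.comp HasRationalLifts.fst).isRationallySpanned.sup hline
  exact IsRationallySpanned.hasRationalLifts (κ := Fin r ⊕ Unit)
    (by convert hsup using 2 with y; exact hψ y.1 y.2) (by simp)

lemma hasRationalLifts_of_pencilMember_eq
    (h : ∀ x, IsPencilChart (W x).1 (M x).1 C β) {F : X → Gr K (r + 1) n}
    (hF : HasRationalLifts K F) {φ : X → ProjLine K}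
    (hφ : ∀ x, (F x).1 = pencilMember (W x).1 (M x).1 C β (φ x)) : HasRationalLifts K φ := by
  have hWF (x) : (W x).1 ≤ (F x).1 := hφ x ▸ le_sup_left
  have hFM (x) : (F x).1 ≤ (M x).1 := hφ x ▸ (h x).pencilMember_le _
  have hfin (x) : Module.finrank K (F x).1 = Module.finrank K (W x).1 + 1 :=
    (F x).2.trans (congrArg (· + 1) (W x).2.symm)
  intro x a ha
  obtain ⟨v, hv, hβv⟩ := (h x).exists_mem_apply_ne_zero (hWF x) (hFM x) (hfin x)
  obtain ⟨E, hEC, hE⟩ : ∃ E ≤ C, IsCompl (F x).1 E := by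
    obtain ⟨E, hdisj, hsup⟩ :=
      IsModularLattice.exists_disjoint_and_sup_eq (inf_le_right : (F x).1 ⊓ C ≤ C)
    have hEC : E ≤ C := hsup ▸ le_sup_right
    refine ⟨E, hEC, disjoint_iff_inf_le.2 ?_, codisjoint_iff_le_sup.2 ?_⟩
    · exact (le_inf (le_inf inf_le_left (inf_le_right.trans hEC)) inf_le_right).trans
        hdisj.eq_bot.le
    · rw [← (h x).isCompl.sup_eq_top, ← hsup]
      exact sup_le ((hWF x).trans le_sup_left) (sup_le_sup_right inf_le_left _)
  obtain ⟨s, hs, hsa, hsF⟩ := hF.exists_rational_section ha hE hv.1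
  obtain ⟨i, hi⟩ := Function.ne_iff.1 (hsa.symm ▸ hβv : β (s a) ≠ 0)
  refine ⟨fun b => β (s b), hs.linearMap β, ?_⟩
  filter_upwards [hsF, (hs.linearMap β i).eventually_ne_zero hi] with b hb hbi y hy
  have hβs : β (s b) ≠ 0 := fun h0 => hbi (congrFun h0 i)
  have hsC : s b ∈ C := (Submodule.sub_mem_iff_left _ hv.2).1 (hEC (hb y hy).2)
  refine ⟨hβs, (h y).pencilMember_injective ?_⟩
  rw [← (h y).eq_pencilMember (hWF y) (hFM y) (hfin y) ⟨(hb y hy).1, hsC⟩ hβs, hφ]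

lemma isOpen_setOf (hW : HasRationalLifts K W) (hM : HasRationalLifts K M) {x : X}
    (hx : IsPencilChart (W x).1 (M x).1 C β) (hWM : ∀ y, (W y).1 ≤ (M y).1) :
    IsOpen[zariski K X] {y | IsPencilChart (W y).1 (M y).1 C β} := by
  have hchart (y) : IsPencilChart (W y).1 (M y).1 C β ↔
      Disjoint (W y).1 C ∧ Disjoint (M y).1 (C ⊓ LinearMap.ker β) := by
    refine ⟨fun h => ⟨h.isCompl.disjoint, h.disjoint⟩, fun ⟨hWC, hMC⟩ =>
      ⟨hWM y, (M y).2.trans (congrArg (· + 2) (W y).2.symm), ?_, hMC⟩⟩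
    refine (Submodule.isCompl_iff_disjoint _ _ ?_).2 hWC
    rw [(W y).2, ← (W x).2, Submodule.finrank_add_eq_of_isCompl hx.isCompl]
  simp only [hchart]
  let := zariski K X
  let := zariski K (Gr K r n)
  let := zariski K (Gr K (r + 2) n)
  exact ((Gr.isOpen_disjoint r C).preimage hW.continuous).inter
    ((Gr.isOpen_disjoint (r + 2) _).preimage hM.continuous)

end IsPencilChart

section TruncMap

variable {Z' : Set (GrProd K n (r + 1))} {Z : Set (GrProd K n r)} {M : Z → Gr K (r + 2) n}

lemma exists_equiv_prod_projLine (h : ∀ F ∈ Z', GrProd.trunc K (Nat.le_succ r) F ∈ Z)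
    (hZ : ∀ F : GrProd K n (r + 1), F ∈ Z' ↔ ∃ hF : GrProd.trunc K (Nat.le_succ r) F ∈ Z,
      F.flag r ≤ F.flag (r + 1) ∧ F.flag (r + 1) ≤ (M ⟨_, hF⟩).1)
    {U : Set Z} (hU : ∀ z ∈ U, IsPencilChart (z.1.flag r) (M z).1 C β) :
    ∃ e : {F : Z' // truncMap h F ∈ U} ≃ {z : Z // z ∈ U} × ProjLine K,
      ∀ F, ((e F).1 : Z) = truncMap h F.1 ∧ F.1.1.flag (r + 1) =
        pencilMember ((truncMap h F.1).1.flag r) (M (truncMap h F.1)).1 C β (e F).2 := by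
  have hline (F : {F : Z' // truncMap h F ∈ U}) : ∃ l, F.1.1.flag (r + 1) =
      pencilMember ((truncMap h F.1).1.flag r) (M (truncMap h F.1)).1 C β l := by
    obtain ⟨_, hWF, hFM⟩ := (hZ F.1.1).1 F.1.2
    rw [← GrProd.flag_trunc (Nat.le_succ r) F.1.1 le_rfl] at hWF
    refine (hU _ F.2).exists_eq_pencilMember hWF hFM ?_
    rw [GrProd.finrank_flag _ le_rfl, GrProd.finrank_flag _ le_rfl]
  choose φ hφ using hline
  let ψ (y : {z // z ∈ U} × ProjLine K) : Gr K (r + 1) n :=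
    ⟨pencilMember (y.1.1.1.flag r) (M y.1.1).1 C β y.2,
      ((hU _ y.1.2).finrank_pencilMember y.2).trans
        (congrArg (· + 1) (y.1.1.1.finrank_flag le_rfl))⟩
  have hmem (y : {z // z ∈ U} × ProjLine K) : y.1.1.1.snoc (ψ y) ∈ Z' := by
    rw [hZ, GrProd.flag_snoc _ _ le_rfl, GrProd.flag_snoc_last]
    simp only [GrProd.trunc_snoc]
    exact ⟨y.1.1.2, le_sup_left, (hU _ y.1.2).pencilMember_le y.2⟩
  have htrunc (y) : truncMap h ⟨_, hmem y⟩ = y.1.1 := Subtype.ext (GrProd.trunc_snoc _ _)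
  refine ⟨⟨fun F => (⟨truncMap h F.1, F.2⟩, φ F), fun y => ⟨⟨_, hmem y⟩,
    (htrunc y).symm ▸ y.1.2⟩, fun F => ?_, fun y => ?_⟩, fun F => ⟨rfl, hφ F⟩⟩
  · exact Subtype.ext <| Subtype.ext <| GrProd.ext_trunc (GrProd.trunc_snoc _ _)
      ((GrProd.flag_snoc_last _ _).trans (hφ F).symm)
  · refine Prod.ext (Subtype.ext (htrunc y)) ((hU _ y.1.2).pencilMember_injective ?_)
    have hlast := hφ ⟨⟨_, hmem y⟩, (htrunc y).symm ▸ y.1.2⟩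
    rw [GrProd.flag_snoc_last] at hlast
    simp only [htrunc] at hlast
    exact hlast.symm

lemma exists_trivialization_truncMap (h : ∀ F ∈ Z', GrProd.trunc K (Nat.le_succ r) F ∈ Z)
    (hM : HasRationalLifts K M)
    (hZ : ∀ F : GrProd K n (r + 1), F ∈ Z' ↔ ∃ hF : GrProd.trunc K (Nat.le_succ r) F ∈ Z,
      F.flag r ≤ F.flag (r + 1) ∧ F.flag (r + 1) ≤ (M ⟨_, hF⟩).1)
    {U : Set Z} (hU : ∀ z ∈ U, IsPencilChart (z.1.flag r) (M z).1 C β) :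
    ∃ e : {F : Z' // truncMap h F ∈ U} ≃ {z : Z // z ∈ U} × ProjLine K,
      HasRationalLifts K e ∧ HasRationalLifts K e.symm ∧ ∀ F, ((e F).1 : Z) = truncMap h F := by
  obtain ⟨e, he⟩ := exists_equiv_prod_projLine h hZ hU
  have hmember : HasRationalLifts K
      fun F : {F : Z' // truncMap h F ∈ U} => F.1.1.member (le_refl (r + 1)) :=
    (GrProd.hasRationalLifts_member le_rfl).comp
      ((HasRationalLifts.val _).comp (HasRationalLifts.val _))
  have htrunc : HasRationalLifts K fun F : {F : Z' // truncMap h F ∈ U} => truncMap h F.1 :=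
    (hasRationalLifts_truncMap h).comp (HasRationalLifts.val _)
  have hsnd : HasRationalLifts K fun F => (e F).2 :=
    IsPencilChart.hasRationalLifts_of_pencilMember_eq
      (W := fun F : {F : Z' // truncMap h F ∈ U} => (truncMap h F.1).1.member le_rfl)
      (M := fun F => M (truncMap h F.1))
      (fun F => hU (truncMap h F.1) F.2) hmember (φ := fun F => (e F).2) fun F => (he F).2
  have hsymm (y) : truncMap h (e.symm y).1 = y.1.1 := by rw [← (he _).1, e.apply_symm_apply]
  have hlast : HasRationalLifts K fun y => (e.symm y).1.1.member (le_refl (r + 1)) :=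
    IsPencilChart.hasRationalLifts_of_eq_pencilMember
      (W := fun z : {z // z ∈ U} => z.1.1.member le_rfl) (fun z => hU _ z.2)
      ((GrProd.hasRationalLifts_member le_rfl).comp
        ((HasRationalLifts.val _).comp (HasRationalLifts.val _)))
      (hM.comp (HasRationalLifts.val _)) fun z l => by
        have hmem := (he (e.symm (z, l))).2
        simp only [hsymm, e.apply_symm_apply] at hmem
        exact hmem
  have hsnoc : (fun y => (e.symm y).1.1) =
      fun y => y.1.1.1.snoc ((e.symm y).1.1.member (le_refl (r + 1))) := funext fun y => by
    refine GrProd.ext_trunc ?_ (GrProd.flag_snoc_last _ (GrProd.member le_rfl _)).symm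
    rw [GrProd.trunc_snoc, ← hsymm y]
    rfl
  have hfst : (fun F => ((e F).1 : Z)) = fun F => truncMap h F.1 := funext fun F => (he F).1
  have hfst_lift : HasRationalLifts K fun F => ((e F).1 : Z) := hfst ▸ htrunc
  have hlift : HasRationalLifts K fun y => (e.symm y).1.1 := hsnoc ▸ HasRationalLifts.snoc
    ((HasRationalLifts.val (· ∈ Z)).comp
      ((HasRationalLifts.val (· ∈ U)).comp HasRationalLifts.fst)) hlast
  exact ⟨e, (hfst_lift.subtype_mk fun F => (e F).1.2).prodMk hsnd, hlift, fun F => (he F).1⟩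

theorem isRationalProjLineBundle_truncMap (h : ∀ F ∈ Z', GrProd.trunc K (Nat.le_succ r) F ∈ Z)
    (hM : HasRationalLifts K M) (hWM : ∀ z : Z, z.1.flag r ≤ (M z).1)
    (hZ : ∀ F : GrProd K n (r + 1), F ∈ Z' ↔ ∃ hF : GrProd.trunc K (Nat.le_succ r) F ∈ Z,
      F.flag r ≤ F.flag (r + 1) ∧ F.flag (r + 1) ≤ (M ⟨_, hF⟩).1) :
    IsRationalProjLineBundle K (truncMap h) := by
  refine ⟨hasRationalLifts_truncMap h, fun z => ?_⟩
  have hW : HasRationalLifts K fun z : Z => z.1.member le_rfl :=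
    (GrProd.hasRationalLifts_member le_rfl).comp (HasRationalLifts.val _)
  obtain ⟨C, β, hz⟩ := exists_isPencilChart (hWM z)
    ((M z).2.trans (congrArg (· + 2) (z.1.finrank_flag le_rfl).symm))
  exact ⟨_, hz.isOpen_setOf hW hM hWM, hz, exists_trivialization_truncMap h hM hZ fun _ => id⟩

end TruncMap

end PencilBundles

/-! ### Nilpotent endomorphisms with two Jordan blocks -/

namespace Column

/-- The function of a column which is `a` on the left one and `b` on the right one. -/
def select {α : Type*} (a b : α) : Column → α
  | left => a
  | right => b

@[simp] lemma select_left {α : Type*} (a b : α) : Column.left.select a b = a := rfl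

@[simp] lemma select_right {α : Type*} (a b : α) : Column.right.select a b = b := rfl

end Column

section TwoBlocks

variable {K : Type*} [Field K] {V : Type*} [AddCommGroup V] [Module K V] {p q : ℕ}
  (e : Module.Basis (Fin p ⊕ Fin q) K V)

/-- The two chains of vectors of a basis, prolonged by `0`. -/
noncomputable def chain : Column → ℕ → V
  | .left, i => if h : i < p then e (Sum.inl ⟨i, h⟩) else 0
  | .right, i => if h : i < q then e (Sum.inr ⟨i, h⟩) else 0

/-- The coordinates along the two chains of a basis, prolonged by `0`. -/
noncomputable def chainCoord : Column → ℕ → V →ₗ[K] K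
  | .left, i => if h : i < p then e.coord (Sum.inl ⟨i, h⟩) else 0
  | .right, i => if h : i < q then e.coord (Sum.inr ⟨i, h⟩) else 0

/-- The span of the first `a` vectors of the left chain and the first `b` vectors of the right
chain, defined by the vanishing of the other coordinates. -/
def coordSub (a b : ℕ) : Submodule K V where
  carrier := {v | ∀ c i, Column.select a b c ≤ i → chainCoord e c i v = 0}
  add_mem' hv hw c i hi := by rw [map_add, hv c i hi, hw c i hi, add_zero]
  zero_mem' _ _ _ := map_zero _
  smul_mem' t v hv c i hi := by rw [map_smul, hv c i hi, smul_zero]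

variable {e}

lemma mem_coordSub {a b : ℕ} {v : V} :
    v ∈ coordSub e a b ↔ ∀ c i, Column.select a b c ≤ i → chainCoord e c i v = 0 := Iff.rfl

lemma chain_of_le {c : Column} {i : ℕ} (h : c.select p q ≤ i) : chain e c i = 0 := by
  cases c <;> exact dif_neg h.not_gt

lemma chainCoord_of_le {c : Column} {i : ℕ} (h : c.select p q ≤ i) : chainCoord e c i = 0 := by
  cases c <;> exact dif_neg h.not_gt

lemma chainCoord_chain_self {c : Column} {i : ℕ} (hi : i < c.select p q) :
    chainCoord e c i (chain e c i) = 1 := by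
  cases c <;> simp only [Column.select] at hi <;> simp [chain, chainCoord, hi]

lemma chainCoord_chain_of_ne {c d : Column} {i j : ℕ} (h : c ≠ d ∨ i ≠ j) :
    chainCoord e c i (chain e d j) = 0 := by
  cases c <;> cases d <;> simp only [chain, chainCoord] <;> split_ifs <;>
    simp_all [eq_comm]

lemma ext_chainCoord {v w : V} (h : ∀ c i, chainCoord e c i v = chainCoord e c i w) : v = w := by
  refine e.ext_elem ?_
  rintro (i | i)
  · simpa [chainCoord] using h .left i
  · simpa [chainCoord] using h .right i

lemma exists_chainCoord_eq (f : Column → ℕ → K) :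
    ∃ v : V, ∀ c i, chainCoord e c i v = if i < c.select p q then f c i else 0 := by
  refine ⟨e.repr.symm (Finsupp.equivFunOnFinite.symm
    (Sum.elim (fun i => f .left i) fun i => f .right i)), fun c i => ?_⟩
  by_cases hi : i < c.select p q <;> cases c <;> simp only [Column.select] at hi <;>
    simp [chainCoord, hi]

lemma coordSub_mono {a b a' b' : ℕ} (ha : a ≤ a') (hb : b ≤ b') :
    coordSub e a b ≤ coordSub e a' b' :=
  fun _ hv c i hi => hv c i (by cases c; exacts [ha.trans hi, hb.trans hi])

lemma coordSub_zero_zero : coordSub e 0 0 = ⊥ :=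
  eq_bot_iff.2 fun v hv => (Submodule.mem_bot K).2 <| ext_chainCoord (e := e) fun c i => by
    rw [hv c i (by cases c <;> exact i.zero_le), map_zero]

lemma coordSub_eq_top {a b : ℕ} (ha : p ≤ a) (hb : q ≤ b) : coordSub e a b = ⊤ :=
  eq_top_iff.2 fun v _ c i hi => by
    rw [chainCoord_of_le (by cases c; exacts [ha.trans hi, hb.trans hi]), LinearMap.zero_apply]

lemma coordSub_min (a b : ℕ) : coordSub e (min a p) (min b q) = coordSub e a b := by
  refine le_antisymm (coordSub_mono (min_le_left _ _) (min_le_left _ _)) fun v hv c i hi => ?_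
  by_cases hic : c.select p q ≤ i
  · rw [chainCoord_of_le hic, LinearMap.zero_apply]
  · refine hv c i ?_
    cases c <;> simp only [Column.select] at hi hic ⊢ <;> omega

lemma chain_mem_coordSub {a b : ℕ} {c : Column} {i : ℕ} (h : i < c.select a b) :
    chain e c i ∈ coordSub e a b := by
  refine fun d j hj => chainCoord_chain_of_ne ?_
  by_contra! hdj
  rw [hdj.1, hdj.2] at hj
  omega

lemma chain_mem_coordSub_iff {a b : ℕ} {c : Column} {i : ℕ} (hi : i < c.select p q) :
    chain e c i ∈ coordSub e a b ↔ i < c.select a b := by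
  refine ⟨fun h => not_le.1 fun hai => ?_, chain_mem_coordSub⟩
  exact one_ne_zero ((chainCoord_chain_self hi).symm.trans (h c i hai))

lemma chainCoord_sub_smul_chain_self (c : Column) (j : ℕ) (v : V) :
    chainCoord e c j (v - chainCoord e c j v • chain e c j) = 0 := by
  by_cases hj : j < c.select p q
  · rw [map_sub, map_smul, chainCoord_chain_self hj, smul_eq_mul, mul_one, sub_self]
  · rw [chainCoord_of_le (not_lt.1 hj), LinearMap.zero_apply]

lemma sub_smul_chain_mem {a b a' b' : ℕ} {c : Column} {j : ℕ} {v : V} (hv : v ∈ coordSub e a b)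
    (h : ∀ d i, d.select a' b' ≤ i → d.select a b ≤ i ∨ d = c ∧ i = j) :
    v - chainCoord e c j v • chain e c j ∈ coordSub e a' b' := by
  intro d i hi
  by_cases hdi : d = c ∧ i = j
  · rw [hdi.1, hdi.2, chainCoord_sub_smul_chain_self]
  · rw [map_sub, map_smul, chainCoord_chain_of_ne (not_and_or.1 hdi), smul_zero, sub_zero,
      hv d i ((h d i hi).resolve_right hdi)]

lemma sub_smul_chain_left_mem {a b : ℕ} {v : V} (hv : v ∈ coordSub e (a + 1) b) :
    v - chainCoord e .left a v • chain e .left a ∈ coordSub e a b :=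
  sub_smul_chain_mem hv fun d i hi => by
    cases d <;> simp only [Column.select, true_and] at hi ⊢ <;> omega

lemma linearMap_ext_chain {W : Type*} [AddCommGroup W] [Module K W] {f g : V →ₗ[K] W}
    (h : ∀ c i, i < c.select p q → f (chain e c i) = g (chain e c i)) : f = g := by
  refine e.ext ?_
  rintro (i | i)
  · simpa [chain] using h .left i i.2
  · simpa [chain] using h .right i i.2

lemma span_chain_eq_coordSub {a b : ℕ} (ha : a ≤ p) (hb : b ≤ q) :
    Submodule.span K (Set.range (e ∘ Sum.map (Fin.castLE ha) (Fin.castLE hb))) =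
      coordSub e a b := by
  apply le_antisymm
  · rw [Submodule.span_le]
    rintro _ ⟨i | i, rfl⟩
    · have hi := chain_mem_coordSub (e := e) (a := a) (b := b) (c := .left) i.2
      rwa [chain, dif_pos (i.2.trans_le ha)] at hi
    · have hi := chain_mem_coordSub (e := e) (a := a) (b := b) (c := .right) i.2
      rwa [chain, dif_pos (i.2.trans_le hb)] at hi
  · intro v hv
    rw [← e.sum_repr v]
    refine Submodule.sum_mem _ fun i _ => ?_
    rcases i with i | i
    · by_cases hi : (i : ℕ) < a
      · exact Submodule.smul_mem _ _ (Submodule.subset_span ⟨Sum.inl ⟨i, hi⟩, rfl⟩)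
      · have h_zero : e.repr v (Sum.inl i) = 0 := by
          simpa [chainCoord] using hv .left i (not_lt.1 hi)
        simp [h_zero]
    · by_cases hi : (i : ℕ) < b
      · exact Submodule.smul_mem _ _ (Submodule.subset_span ⟨Sum.inr ⟨i, hi⟩, rfl⟩)
      · have h_zero : e.repr v (Sum.inr i) = 0 := by
          simpa [chainCoord] using hv .right i (not_lt.1 hi)
        simp [h_zero]

lemma finrank_coordSub_of_le {a b : ℕ} (ha : a ≤ p) (hb : b ≤ q) :
    Module.finrank K (coordSub e a b) = a + b := by
  have h_linearIndependent :
      LinearIndependent K (e ∘ Sum.map (Fin.castLE ha) (Fin.castLE hb)) :=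
    e.linearIndependent.comp _
      (Sum.map_injective.2 ⟨Fin.castLE_injective ha, Fin.castLE_injective hb⟩)
  rw [← span_chain_eq_coordSub ha hb, finrank_span_eq_card h_linearIndependent]
  simp

lemma finrank_coordSub (a b : ℕ) : Module.finrank K (coordSub e a b) = min a p + min b q := by
  rw [← coordSub_min, finrank_coordSub_of_le (min_le_right _ _) (min_le_right _ _)]

variable (e) in
/-- `N` shifts both chains of the basis `e` downwards. -/
def IsShift (N : V →ₗ[K] V) : Prop :=
  ∀ c i v, chainCoord e c i (N v) = chainCoord e c (i + 1) v

lemma finrank_comap_eq [FiniteDimensional K V] (T : V →ₗ[K] V) (W : Submodule K V) :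
    Module.finrank K (W.comap T) =
      Module.finrank K (LinearMap.range T ⊓ W : Submodule K V) +
        Module.finrank K (LinearMap.ker T) := by
  have h := LinearMap.finrank_range_add_finrank_ker (T.domRestrict (W.comap T))
  rw [LinearMap.range_domRestrict, Submodule.map_comap_eq, LinearMap.ker_domRestrict] at h
  rw [← h]
  congr 1
  exact (Submodule.comapSubtypeEquivOfLe (LinearMap.ker_le_comap T)).finrank_eq

lemma IsShift.of_chain {N : V →ₗ[K] V} (h_zero : ∀ c, N (chain e c 0) = 0)
    (h_succ : ∀ c i, i + 1 < c.select p q → N (chain e c (i + 1)) = chain e c i) :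
    IsShift e N := by
  intro c i
  refine LinearMap.congr_fun (f := chainCoord e c i ∘ₗ N) (linearMap_ext_chain (e := e) ?_)
  rintro d (_ | j) hj <;> rw [LinearMap.comp_apply]
  · rw [h_zero, map_zero, chainCoord_chain_of_ne (.inr i.succ_ne_zero)]
  · rw [h_succ d j hj]
    by_cases hij : c = d ∧ i = j
    · rw [hij.1, hij.2, chainCoord_chain_self hj, chainCoord_chain_self (by omega)]
    · rw [chainCoord_chain_of_ne (not_and_or.1 hij),
        chainCoord_chain_of_ne ((not_and_or.1 hij).imp_right (by omega))]

namespace IsShift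

variable {N : V →ₗ[K] V} (hN : IsShift e N)

include hN

lemma chainCoord_pow (k : ℕ) (c : Column) (i : ℕ) (v : V) :
    chainCoord e c i ((N ^ k) v) = chainCoord e c (i + k) v := by
  induction k generalizing i with
  | zero => simp
  | succ k ih => rw [pow_succ', Module.End.mul_apply, hN, ih, add_assoc, add_comm 1]

lemma comap_pow_coordSub (k a b : ℕ) :
    (coordSub e a b).comap (N ^ k) = coordSub e (a + k) (b + k) := by
  have h_select (c : Column) : c.select (a + k) (b + k) = c.select a b + k := by cases c <;> rfl
  ext v
  simp only [Submodule.mem_comap, mem_coordSub, hN.chainCoord_pow, h_select]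
  refine forall_congr' fun c => ⟨fun h i hi => ?_, fun h i hi => h _ (by omega)⟩
  simpa only [Nat.sub_add_cancel (show k ≤ i by omega)] using h (i - k) (by omega)

lemma ker_pow (k : ℕ) : LinearMap.ker (N ^ k) = coordSub e k k := by
  rw [LinearMap.ker, ← coordSub_zero_zero (e := e), hN.comap_pow_coordSub, zero_add]

lemma range_pow (k : ℕ) : LinearMap.range (N ^ k) = coordSub e (p - k) (q - k) := by
  have h_select (c : Column) : c.select (p - k) (q - k) = c.select p q - k := by cases c <;> rfl
  ext v
  simp only [LinearMap.mem_range, mem_coordSub, h_select]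
  constructor
  · rintro ⟨v, rfl⟩ c i hi
    rw [hN.chainCoord_pow, chainCoord_of_le (by omega), LinearMap.zero_apply]
  · intro hv
    obtain ⟨w, hw⟩ := exists_chainCoord_eq (e := e) fun c i => chainCoord e c (i - k) v
    refine ⟨w, ext_chainCoord (e := e) fun c i => ?_⟩
    rw [hN.chainCoord_pow, hw, Nat.add_sub_cancel]
    split_ifs with h
    · rfl
    · rw [hv c i (by omega)]

lemma pow_chain {c : Column} {i k : ℕ} (hi : i + k < c.select p q) :
    (N ^ k) (chain e c (i + k)) = chain e c i := by
  refine ext_chainCoord (e := e) fun d j => ?_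
  rw [hN.chainCoord_pow]
  by_cases hdj : d = c ∧ j = i
  · rw [hdj.1, hdj.2, chainCoord_chain_self hi, chainCoord_chain_self (by omega)]
  · rw [chainCoord_chain_of_ne (not_and_or.1 hdj),
      chainCoord_chain_of_ne ((not_and_or.1 hdj).imp_right (by omega))]

lemma apply_chain {c : Column} {i : ℕ} (hi : i + 1 < c.select p q) :
    N (chain e c (i + 1)) = chain e c i := by
  simpa using hN.pow_chain (k := 1) hi

lemma apply_mem_coordSub {a b : ℕ} {v : V} (hv : v ∈ coordSub e a b) :
    N v ∈ coordSub e (a - 1) (b - 1) := by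
  intro c i hi
  rw [hN, hv c (i + 1) (by cases c <;> simp only [Column.select] at hi ⊢ <;> omega)]

lemma finrank_ker_pow {k : ℕ} (hk : k ≤ q) (hqp : q ≤ p) :
    Module.finrank K (LinearMap.ker (N ^ k)) = 2 * k := by
  rw [hN.ker_pow, finrank_coordSub_of_le (hk.trans hqp) hk, two_mul]

variable [FiniteDimensional K V]

lemma finrank_comap_le (k : ℕ) (W : Submodule K V) :
    Module.finrank K (W.comap (N ^ k)) ≤ Module.finrank K W + 2 * k := by
  rw [finrank_comap_eq, hN.ker_pow, finrank_coordSub]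
  have := Submodule.finrank_mono (inf_le_right : LinearMap.range (N ^ k) ⊓ W ≤ W)
  omega

lemma finrank_comap {k : ℕ} (hk : k ≤ q) (hqp : q ≤ p) {W : Submodule K V}
    (hW : W ≤ LinearMap.range (N ^ k)) :
    Module.finrank K (W.comap (N ^ k)) = Module.finrank K W + 2 * k := by
  rw [finrank_comap_eq, hN.finrank_ker_pow hk hqp, inf_eq_right.2 hW]

lemma eq_comap {k : ℕ} {F W : Submodule K V}
    (hF : Module.finrank K W + 2 * k ≤ Module.finrank K F) (h : F ≤ W.comap (N ^ k)) :
    F = W.comap (N ^ k) :=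
  Submodule.eq_of_le_of_finrank_le h ((hN.finrank_comap_le k W).trans hF)

end IsShift

end TwoBlocks

lemma IsAdaptedBasis.isShift {K : Type*} [Field K] {p q : ℕ}
    {x : Matrix.SpecialLinearGroup (Fin (p + q)) K}
    {e : Module.Basis (Fin p ⊕ Fin q) K (Fin (p + q) → K)} (he : IsAdaptedBasis K x e) :
    IsShift e (Matrix.toLin' ((x : Matrix (Fin (p + q)) (Fin (p + q)) K) - 1)) := by
  obtain ⟨hleft_zero, hleft_succ, hright_zero, hright_succ⟩ := he
  refine IsShift.of_chain (fun c => ?_) fun c i hi => ?_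
  · cases c <;> simp only [chain] <;> split_ifs
    exacts [hleft_zero _ rfl, map_zero _, hright_zero _ rfl, map_zero _]
  · cases c <;> simp only [Column.select] at hi <;>
      simp only [chain, hi, (Nat.lt_succ_self i).trans hi, ↓reduceDIte]
    exacts [hleft_succ _ _ rfl, hright_succ _ _ rfl]

/-! ### Words and their heights -/

section Words

/-- The number of letters `right` among the first `i` letters of a word. -/
def numRight (w : ℕ → Column) : ℕ → ℕ
  | 0 => 0
  | i + 1 => numRight w i + (w i).select 0 1

/-- The number of letters `left` among the first `i` letters of a word. -/
def numLeft (w : ℕ → Column) : ℕ → ℕ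
  | 0 => 0
  | i + 1 => numLeft w i + (w i).select 1 0

/-- The height after `i` steps of the lattice path attached to a word, which goes up at the letters
`right` and down at the letters `left`. -/
def height (w : ℕ → Column) (i : ℕ) : ℤ := numRight w i - numLeft w i

/-- The first `p + q` letters of `w` consist of `q` letters `right` and `p` letters `left`, and the
lattice path of `w` attains its minimum at the end.  Reading `right` as an opening and `left` as a
closing parenthesis, every opening parenthesis is closed. -/
structure IsBallot (w : ℕ → Column) (p q : ℕ) : Prop where
  lower : ∀ i ≤ p + q, (q : ℤ) - p ≤ height w i
  numRight_eq : numRight w (p + q) = q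

/-- The letters in positions `i, …, j - 1`, read as parentheses, are completely matched among
themselves. -/
def IsBalanced (w : ℕ → Column) (i j : ℕ) : Prop :=
  height w i = height w j ∧ ∀ m, i ≤ m → m ≤ j → height w i ≤ height w m

/-- The letter in position `i`, an opening parenthesis, is closed by the letter in position
`j - 1`. -/
def IsArc (w : ℕ → Column) (i j : ℕ) : Prop :=
  height w i = height w j ∧ ∀ m, i < m → m < j → height w i < height w m

/-- The lattice path of a word is in position `j` at most as high as before. -/
def IsLow (w : ℕ → Column) (j : ℕ) : Prop := ∀ m ≤ j, height w j ≤ height w m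

/-- The lattice path of a word is in position `j` strictly lower than before, so that the letter in
position `j - 1` is an unmatched closing parenthesis. -/
def IsRecord (w : ℕ → Column) (j : ℕ) : Prop := ∀ m < j, height w j < height w m

variable {w : ℕ → Column} {p q : ℕ}

lemma numRight_add_numLeft (w : ℕ → Column) (i : ℕ) : numRight w i + numLeft w i = i := by
  induction i with
  | zero => rfl
  | succ i ih => cases h : w i <;> simp only [numRight, numLeft, h, Column.select] <;> omega

lemma height_add (w : ℕ → Column) (i : ℕ) : height w i + i = 2 * numRight w i := by
  have := numRight_add_numLeft w i
  unfold height
  omega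

@[simp] lemma height_zero (w : ℕ → Column) : height w 0 = 0 := rfl

lemma numRight_succ_right {i : ℕ} (h : w i = .right) : numRight w (i + 1) = numRight w i + 1 := by
  simp [numRight, h]

lemma numRight_succ_left {i : ℕ} (h : w i = .left) : numRight w (i + 1) = numRight w i := by
  simp [numRight, h]

lemma numLeft_succ_right {i : ℕ} (h : w i = .right) : numLeft w (i + 1) = numLeft w i := by
  simp [numLeft, h]

lemma numLeft_succ_left {i : ℕ} (h : w i = .left) : numLeft w (i + 1) = numLeft w i + 1 := by
  simp [numLeft, h]

lemma height_succ_right {i : ℕ} (h : w i = .right) : height w (i + 1) = height w i + 1 := by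
  rw [height, height, numRight_succ_right h, numLeft_succ_right h]
  omega

lemma height_succ_left {i : ℕ} (h : w i = .left) : height w (i + 1) = height w i - 1 := by
  rw [height, height, numRight_succ_left h, numLeft_succ_left h]
  omega

lemma height_succ (w : ℕ → Column) (i : ℕ) :
    height w (i + 1) = height w i + 1 ∨ height w (i + 1) = height w i - 1 := by
  cases h : w i
  · exact Or.inr (height_succ_left h)
  · exact Or.inl (height_succ_right h)

lemma numRight_mono (w : ℕ → Column) : Monotone (numRight w) :=
  monotone_nat_of_le_succ fun _ => Nat.le_add_right _ _

lemma numLeft_mono (w : ℕ → Column) : Monotone (numLeft w) :=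
  monotone_nat_of_le_succ fun _ => Nat.le_add_right _ _

lemma numRight_eq_add_of_height_eq {i j k : ℕ} (hij : i + 2 * k = j)
    (h : height w i = height w j) : numRight w j = numRight w i + k := by
  have hi := height_add w i
  have hj := height_add w j
  omega

namespace IsBallot

lemma numRight_le (hw : IsBallot w p q) {i : ℕ} (hi : i ≤ p + q) : numRight w i ≤ q :=
  (numRight_mono w hi).trans hw.numRight_eq.le

lemma numLeft_eq (hw : IsBallot w p q) : numLeft w (p + q) = p := by
  have := numRight_add_numLeft w (p + q)
  have := hw.numRight_eq
  omega

lemma numLeft_le (hw : IsBallot w p q) {i : ℕ} (hi : i ≤ p + q) : numLeft w i ≤ p :=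
  (numLeft_mono w hi).trans hw.numLeft_eq.le

lemma height_eq (hw : IsBallot w p q) : height w (p + q) = q - p := by
  rw [height, hw.numLeft_eq, hw.numRight_eq]

end IsBallot

lemma IsArc.isBalanced {i j : ℕ} (h : IsArc w i j) : IsBalanced w i j := by
  refine ⟨h.1, fun m him hmj => ?_⟩
  rcases him.eq_or_lt with rfl | him
  · exact le_rfl
  rcases hmj.eq_or_lt with rfl | hmj
  · exact h.1.le
  · exact (h.2 m him hmj).le

lemma IsArc.isBalanced_inner {i r : ℕ} (h : IsArc w i (r + 1)) (hir : i < r) :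
    IsBalanced w (i + 1) r := by
  have h_start := h.2 (i + 1) (by omega) (by omega)
  have h_step := height_succ w i
  have h_end := h.2 r hir (by omega)
  have h_last := height_succ w r
  have h_eq := h.1
  refine ⟨by omega, fun m him hmr => ?_⟩
  have := h.2 m (by omega) (by omega)
  omega

lemma IsRecord.isLow {j : ℕ} (h : IsRecord w j) : IsLow w j := fun m hm => by
  rcases hm.eq_or_lt with rfl | hm
  · exact le_rfl
  · exact (h m hm).le

lemma IsRecord.isLow_pred {r : ℕ} (h : IsRecord w (r + 1)) : IsLow w r := fun m hm => by
  have := h m (by omega)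
  have := height_succ w r
  have := h r (by omega)
  omega

lemma IsRecord.exists_height_eq {r : ℕ} (h : IsRecord w (r + 1)) :
    ∃ t u, 2 * t + (u + 1) = r + 1 ∧ height w (r + 1) = -((u + 1 : ℕ) : ℤ) := by
  have h_neg := h 0 r.succ_pos
  have h_add := height_add w (r + 1)
  rw [height_zero] at h_neg
  exact ⟨numRight w (r + 1), r - 2 * numRight w (r + 1), by omega, by omega⟩

lemma lt_height_of_forall_ne {s r : ℕ} {h : ℤ} (hne : ∀ m, s ≤ m → m ≤ r → height w m ≠ h)
    (hr : h < height w r) {m : ℕ} (hsm : s ≤ m) (hmr : m ≤ r) : h < height w m := by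
  induction hmr using Nat.decreasingInduction with
  | self => exact hr
  | of_succ m hmr ih =>
    have h_succ := ih (by omega)
    have h_step := height_succ w m
    have h_ne := hne m hsm (by omega)
    omega

lemma exists_isArc_or_isRecord {r : ℕ} (hr : w r = .left) :
    (∃ i k, i + 2 * (k + 1) = r + 1 ∧ IsArc w i (r + 1)) ∨ IsRecord w (r + 1) := by
  have h_step := height_succ_left hr
  by_cases hex : ∃ i ≤ r, height w i = height w (r + 1)
  · left
    classical
    obtain ⟨i₀, hi₀, h_eq₀⟩ := hex
    obtain ⟨i, hi⟩ : ∃ i, Nat.findGreatest (fun i => height w i = height w (r + 1)) r = i :=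
      ⟨_, rfl⟩
    obtain ⟨hir, -, h_last⟩ := Nat.findGreatest_eq_iff.1 hi
    have h_eq : height w i = height w (r + 1) :=
      hi ▸ Nat.findGreatest_spec (P := fun i => height w i = height w (r + 1)) hi₀ h_eq₀
    have hi_add := height_add w i
    have hr_add := height_add w (r + 1)
    refine ⟨i, (r - i) / 2, by omega, h_eq, fun m him hmr => ?_⟩
    rw [h_eq]
    exact lt_height_of_forall_ne (s := i + 1) (fun l hil hlr => h_last (by omega) hlr) (by omega)
      him (Nat.lt_succ_iff.1 hmr)
  · right
    push Not at hex
    exact fun m hm => lt_height_of_forall_ne (s := 0) (fun l _ hlr => hex l hlr) (by omega)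
      m.zero_le (Nat.lt_succ_iff.1 hm)

end Words

/-! ### Partial flags matched to a word -/

section Matched

variable {K : Type*} [Field K] {V : Type*} [AddCommGroup V] [Module K V] {p q : ℕ}

lemma comap_pow_add (N : V →ₗ[K] V) (a b : ℕ) (W : Submodule K V) :
    W.comap (N ^ (a + b)) = (W.comap (N ^ a)).comap (N ^ b) := by
  rw [pow_add, Module.End.mul_eq_comp, Submodule.comap_comp]

/-- The conditions on a partial flag `G 0 ⊂ G 1 ⊂ ⋯ ⊂ G r` imposed by a word: `N` maps each member
to the previous one, a completely matched interval of length `2 k` gives `N ^ k (G j) ⊆ G i`, and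
the member in a position `2 t + u` where the height has its minimum `-u` is mapped by `N ^ t` to the
span of the first `u` vectors of the left chain. -/
structure IsMatched (e : Module.Basis (Fin p ⊕ Fin q) K V) (N : V →ₗ[K] V) (w : ℕ → Column) (r : ℕ)
    (G : ℕ → Submodule K V) : Prop where
  mono : ∀ i < r, G i ≤ G (i + 1)
  nil : ∀ i < r, G (i + 1) ≤ (G i).comap N
  bal : ∀ i j k, j ≤ r → i + 2 * k = j → IsBalanced w i j → G j ≤ (G i).comap (N ^ k)
  low : ∀ j t u : ℕ, j ≤ r → 2 * t + u = j → IsLow w j → height w j = -u →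
    G j ≤ (coordSub e u 0).comap (N ^ t)

variable {e : Module.Basis (Fin p ⊕ Fin q) K V} {N : V →ₗ[K] V} {w : ℕ → Column} {r : ℕ}
  {G G' : ℕ → Submodule K V}

namespace IsMatched

lemma congr (h : IsMatched e N w r G) (hG : ∀ i ≤ r, G i = G' i) : IsMatched e N w r G' where
  mono i hi := by rw [← hG i hi.le, ← hG (i + 1) hi]; exact h.mono i hi
  nil i hi := by rw [← hG i hi.le, ← hG (i + 1) hi]; exact h.nil i hi
  bal i j k hj hij := by rw [← hG i (by omega), ← hG j hj]; exact h.bal i j k hj hij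
  low j t u hj := by rw [← hG j hj]; exact h.low j t u hj

lemma of_le {s : ℕ} (h : IsMatched e N w r G) (hs : s ≤ r) : IsMatched e N w s G where
  mono i hi := h.mono i (hi.trans_le hs)
  nil i hi := h.nil i (hi.trans_le hs)
  bal i j k hj := h.bal i j k (hj.trans hs)
  low j t u hj := h.low j t u (hj.trans hs)

lemma zero (hG : G 0 = ⊥) : IsMatched e N w 0 G where
  mono i hi := absurd hi i.not_lt_zero
  nil i hi := absurd hi i.not_lt_zero
  bal i j k hj _ _ := by rw [Nat.le_zero.1 hj, hG]; exact bot_le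
  low j t u hj _ _ _ := by rw [Nat.le_zero.1 hj, hG]; exact bot_le

lemma succ (h : IsMatched e N w r G) (hmono : G r ≤ G (r + 1)) (hnil : G (r + 1) ≤ (G r).comap N)
    (hbal : ∀ i k, i + 2 * (k + 1) = r + 1 → IsBalanced w i (r + 1) →
      G (r + 1) ≤ (G i).comap (N ^ (k + 1)))
    (hlow : ∀ t u : ℕ, 2 * t + u = r + 1 → IsLow w (r + 1) → height w (r + 1) = -u →
      G (r + 1) ≤ (coordSub e u 0).comap (N ^ t)) : IsMatched e N w (r + 1) G where
  mono i hi := (Nat.lt_succ_iff_lt_or_eq.1 hi).elim (h.mono i) fun hir => hir ▸ hmono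
  nil i hi := (Nat.lt_succ_iff_lt_or_eq.1 hi).elim (h.nil i) fun hir => hir ▸ hnil
  bal i j k hj hij hb := by
    rcases hj.lt_or_eq with hj | rfl
    · exact h.bal i j k (Nat.lt_succ_iff.1 hj) hij hb
    cases k with
    | zero => rw [show i = r + 1 by omega, pow_zero]; exact le_rfl
    | succ k => exact hbal i k hij hb
  low j t u hj htu hl hu := by
    rcases hj.lt_or_eq with hj | rfl
    · exact h.low j t u (Nat.lt_succ_iff.1 hj) htu hl hu
    · exact hlow t u htu hl hu

lemma le_comap_self (h : IsMatched e N w r G) (h_zero : G 0 = ⊥) : G r ≤ (G r).comap N := by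
  cases r with
  | zero => rw [h_zero]; exact bot_le
  | succ r => exact (h.nil r r.lt_succ_self).trans (Submodule.comap_mono (h.mono r r.lt_succ_self))

lemma succ_right (h : IsMatched e N w r G) (hr : w r = .right) (hmono : G r ≤ G (r + 1))
    (hnil : G (r + 1) ≤ (G r).comap N) : IsMatched e N w (r + 1) G := by
  have h_step := height_succ_right hr
  refine h.succ hmono hnil (fun i k hik hb => ?_) fun t u _ hl _ => ?_
  · have := hb.2 r (by omega) (by omega)
    have := hb.1
    omega
  · have := hl r (by omega)
    omega

section Arc

variable {i k : ℕ} (hik : i + 2 * (k + 1) = r + 1) (harc : IsArc w i (r + 1))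

include hik harc

lemma le_comap_inner (h : IsMatched e N w r G) : G r ≤ (G (i + 1)).comap (N ^ k) :=
  h.bal (i + 1) r k le_rfl (by omega) (harc.isBalanced_inner (by omega))

lemma le_comap_of_isArc (h : IsMatched e N w r G) : G r ≤ (G i).comap (N ^ (k + 1)) := by
  rw [add_comm k, comap_pow_add, pow_one]
  exact (h.le_comap_inner hik harc).trans (Submodule.comap_mono (h.nil i (by omega)))

lemma succ_of_isArc [FiniteDimensional K V] (hN : IsShift e N) (h : IsMatched e N w r G)
    (hfin : ∀ i ≤ r, Module.finrank K (G i) = i) (hmono : G r ≤ G (r + 1))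
    (hle : G (r + 1) ≤ (G i).comap (N ^ (k + 1))) : IsMatched e N w (r + 1) G := by
  have h_eq : G r = (G (i + 1)).comap (N ^ k) := by
    refine hN.eq_comap ?_ (h.le_comap_inner hik harc)
    rw [hfin r le_rfl, hfin (i + 1) (by omega)]
    omega
  refine h.succ hmono ?_ (fun j l hjl hb => ?_) fun t u htu hl hu => ?_
  · rw [h_eq, ← pow_one N, ← pow_mul, one_mul, ← comap_pow_add]
    exact hle.trans (Submodule.comap_mono (h.mono i (by omega)))
  · have hji : j ≤ i := by
      by_contra! hij
      exact (harc.2 j hij (by omega)).ne (harc.1.trans hb.1.symm)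
    obtain ⟨m, hm⟩ : ∃ m, l + 1 = m + (k + 1) := ⟨l - k, by omega⟩
    have hb' : IsBalanced w j i :=
      ⟨hb.1.trans harc.1.symm, fun x hjx hxi => hb.2 x hjx (by omega)⟩
    rw [hm, comap_pow_add]
    exact hle.trans (Submodule.comap_mono (h.bal j i m (by omega) (by omega) hb'))
  · have hi_add := height_add w i
    have h_height := harc.1
    obtain ⟨m, rfl⟩ : ∃ m, t = m + (k + 1) := ⟨t - (k + 1), by omega⟩
    have hl' : IsLow w i := fun x hx => harc.1.trans_le (hl x (by omega))
    rw [comap_pow_add]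
    exact hle.trans
      (Submodule.comap_mono (h.low i m u (by omega) (by omega) hl' (harc.1.trans hu)))

end Arc

section Record

variable {t u : ℕ} (htu : 2 * t + (u + 1) = r + 1) (hrec : IsRecord w (r + 1))
  (hu : height w (r + 1) = -((u + 1 : ℕ) : ℤ))

include htu hrec hu

lemma le_comap_coordSub (h : IsMatched e N w r G) : G r ≤ (coordSub e u 0).comap (N ^ t) := by
  have h_step := height_succ w r
  have h_lt := hrec r (by omega)
  exact h.low r t u le_rfl (by omega) hrec.isLow_pred (by omega)

lemma le_comap_of_isRecord (h : IsMatched e N w r G) :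
    G r ≤ (coordSub e (u + 1) 0).comap (N ^ t) :=
  (h.le_comap_coordSub htu hrec hu).trans
    (Submodule.comap_mono (coordSub_mono u.le_succ le_rfl))

lemma succ_of_isRecord [FiniteDimensional K V] (hN : IsShift e N) (h : IsMatched e N w r G)
    (hfin : Module.finrank K (G r) = r) (hmono : G r ≤ G (r + 1))
    (hle : G (r + 1) ≤ (coordSub e (u + 1) 0).comap (N ^ t)) : IsMatched e N w (r + 1) G := by
  have h_eq : G r = (coordSub e u 0).comap (N ^ t) := by
    refine hN.eq_comap ?_ (h.le_comap_coordSub htu hrec hu)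
    rw [hfin, finrank_coordSub]
    omega
  refine h.succ hmono ?_ (fun j l hjl hb => ?_) fun t' u' htu' _ hu' => ?_
  · intro v hv
    have h_mem := hN.apply_mem_coordSub (hle hv)
    rw [← Module.End.mul_apply, ← pow_succ', pow_succ, Module.End.mul_apply] at h_mem
    rwa [h_eq]
  · exact absurd hb.1 (hrec j (by omega)).ne'
  · obtain rfl : u' = u + 1 := by omega
    obtain rfl : t' = t := by omega
    exact hle

end Record

lemma le_range (hN : IsShift e N) (hqp : q ≤ p) (hw : IsBallot w p q) (h : IsMatched e N w r G)
    (h_zero : G 0 = ⊥) (hr : r ≤ p + q) {i d : ℕ} (hi : i ≤ r) (hd : d + numRight w i ≤ q) :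
    G i ≤ LinearMap.range (N ^ d) := by
  rw [hN.range_pow]
  induction i using Nat.strong_induction_on generalizing d with
  | _ i ih =>
  rcases i with _ | i
  · rw [h_zero]
    exact bot_le
  cases hwi : w i with
  | left =>
    rcases exists_isArc_or_isRecord hwi with ⟨j, k, hjk, harc⟩ | hrec
    · have h_num := numRight_eq_add_of_height_eq hjk harc.1
      refine (h.bal j (i + 1) (k + 1) hi hjk harc.isBalanced).trans ((Submodule.comap_mono
        (ih j (by omega) (by omega) (d := d + (k + 1)) (by omega))).trans ?_)
      rw [hN.comap_pow_coordSub]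
      exact coordSub_mono (by omega) (by omega)
    · obtain ⟨t, u, htu, hu⟩ := hrec.exists_height_eq
      have h_add := height_add w (i + 1)
      have h_lower := hw.lower (i + 1) (by omega)
      refine (h.low (i + 1) t (u + 1) hi htu hrec.isLow hu).trans ?_
      rw [hN.comap_pow_coordSub]
      exact coordSub_mono (by omega) (by omega)
  | right =>
    have h_num := numRight_succ_right hwi
    refine (h.nil i (by omega)).trans ((Submodule.comap_mono
      (ih i (by omega) (by omega) (d := d + 1) (by omega))).trans ?_)
    rw [← pow_one N, hN.comap_pow_coordSub]
    exact coordSub_mono (by omega) (by omega)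

end IsMatched

end Matched

/-! ### The varieties of matched flags -/

section MatchedFlags

lemma HasRationalLifts.isClosed_le_comap {K : Type*} [Field K] {n l m : ℕ} {X : Type*}
    [HomCoords K X] {φ : X → Gr K l n} {ψ : X → Gr K m n} (hφ : HasRationalLifts K φ)
    (hψ : HasRationalLifts K ψ) (T : (Fin n → K) →ₗ[K] (Fin n → K)) :
    IsClosed[zariski K X] {x | (φ x).1 ≤ (ψ x).1.comap T} := by
  let _ := zariski K X
  refine ⟨isOpen_zariski_iff.2 fun x hx a ha => ?_⟩
  obtain ⟨u, hu, huψ⟩ := Set.not_subset.1 (show ¬ (φ x).1 ≤ (ψ x).1.comap T from hx)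
  obtain ⟨E, hE⟩ := (φ x).1.exists_isCompl
  obtain ⟨s, hs, hsa, hsφ⟩ := hφ.exists_rational_section ha hE hu
  obtain ⟨v, hv, hvψ⟩ := hψ.isRationallySpanned x a ha
  let rows (j : Option (Fin m)) (b : Idx K X → K) : Fin n → K :=
    j.elim (T (s b)) fun j => v j b
  have hrows : ∀ j, IsRationalVecAt (rows j) a := Option.rec (hs.linearMap T) hv
  have hspan := self_of_eventually_zarNhds hvψ x ha
  have hli : LinearIndependent K fun j => LinearMap.id (R := K) (rows j a) := by
    refine linearIndependent_option.2 ⟨?_, ?_⟩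
    · exact (linearIndependent_comp_iff_disjoint_ker hspan (ψ x).2 LinearMap.id).2 (by simp)
    · change T (s a) ∉ Submodule.span K (Set.range fun j => v j a)
      rwa [hspan, hsa]
  filter_upwards [IsRationalVecAt.eventually_linearIndependent hrows LinearMap.id hli, hsφ, hvψ]
    with b hlib hsb hvb y hy hle
  refine (linearIndependent_option.1 hlib).2 ?_
  change T (s b) ∈ Submodule.span K (Set.range fun j => v j b)
  rw [hvb y hy]
  exact hle (hsb y hy).1

variable {K : Type*} [Field K] {p q : ℕ} (e : Module.Basis (Fin p ⊕ Fin q) K (Fin (p + q) → K))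
  (N : (Fin (p + q) → K) →ₗ[K] (Fin (p + q) → K)) (w : ℕ → Column)

/-- The variety of partial flags matched to a word; for the word of a tableau `σ` it turns out to be
`Y_σ(r)`. -/
def matchedFlags (r : ℕ) : Set (GrProd K (p + q) r) := {F | IsMatched e N w r F.flag}

variable {e N w}

lemma trunc_mem_matchedFlags_of_le {r s : ℕ} (h : r ≤ s) {F : GrProd K (p + q) s}
    (hF : F ∈ matchedFlags e N w s) : GrProd.trunc K h F ∈ matchedFlags e N w r :=
  (IsMatched.of_le hF h).congr fun _ hi => (GrProd.flag_trunc h F hi).symm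

lemma trunc_mem_matchedFlags (r : ℕ) : ∀ F ∈ matchedFlags e N w (r + 1),
    GrProd.trunc K (Nat.le_succ r) F ∈ matchedFlags e N w r :=
  fun _ hF => trunc_mem_matchedFlags_of_le _ hF

lemma isMatched_of_trunc_mem {r : ℕ} {F : GrProd K (p + q) (r + 1)}
    (hF : GrProd.trunc K (Nat.le_succ r) F ∈ matchedFlags e N w r) : IsMatched e N w r F.flag :=
  IsMatched.congr hF fun _ hi => GrProd.flag_trunc _ F hi

lemma isClosed_matchedFlags (r : ℕ) :
    IsClosed[zariski K (GrProd K (p + q) r)] (matchedFlags e N w r) := by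
  let _ := zariski K (GrProd K (p + q) r)
  have hflag : ∀ i j, i ≤ r → j ≤ r → ∀ T : (Fin (p + q) → K) →ₗ[K] (Fin (p + q) → K),
      IsClosed {F : GrProd K (p + q) r | F.flag i ≤ (F.flag j).comap T} := fun i j hi hj T =>
    (GrProd.hasRationalLifts_member hi).isClosed_le_comap (GrProd.hasRationalLifts_member hj) T
  have hconst : ∀ j, j ≤ r → ∀ (W : Submodule K (Fin (p + q) → K))
      (T : (Fin (p + q) → K) →ₗ[K] (Fin (p + q) → K)),
      IsClosed {F : GrProd K (p + q) r | F.flag j ≤ W.comap T} := fun j hj W T =>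
    (GrProd.hasRationalLifts_member hj).isClosed_le_comap
      (HasRationalLifts.const (Y := Gr K (Module.finrank K W) (p + q)) ⟨W, rfl⟩) T
  have h_eq : matchedFlags e N w r =
      {F | ∀ i < r, F.flag i ≤ (F.flag (i + 1)).comap LinearMap.id} ∩
      {F | ∀ i < r, F.flag (i + 1) ≤ (F.flag i).comap N} ∩
      {F | ∀ i j k, j ≤ r → i + 2 * k = j → IsBalanced w i j →
        F.flag j ≤ (F.flag i).comap (N ^ k)} ∩
      {F | ∀ j t u : ℕ, j ≤ r → 2 * t + u = j → IsLow w j → height w j = -u →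
        F.flag j ≤ (coordSub e u 0).comap (N ^ t)} := by
    ext F
    exact ⟨fun h => ⟨⟨⟨h.mono, h.nil⟩, h.bal⟩, h.low⟩,
      fun ⟨⟨⟨hmono, hnil⟩, hbal⟩, hlow⟩ => ⟨hmono, hnil, hbal, hlow⟩⟩
  rw [h_eq]
  simp only [Set.ofPred_forall]
  refine ((IsClosed.inter ?_ ?_).inter ?_).inter ?_
  · exact isClosed_iInter fun i => isClosed_iInter fun hi => hflag _ _ hi.le hi _
  · exact isClosed_iInter fun i => isClosed_iInter fun hi => hflag _ _ hi hi.le _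
  · exact isClosed_iInter fun i => isClosed_iInter fun j => isClosed_iInter fun k =>
      isClosed_iInter fun hj => isClosed_iInter fun _ => isClosed_iInter fun _ =>
        hflag _ _ hj (by omega) _
  · exact isClosed_iInter fun j => isClosed_iInter fun t => isClosed_iInter fun u =>
      isClosed_iInter fun hj => isClosed_iInter fun _ => isClosed_iInter fun _ =>
        isClosed_iInter fun _ => hconst _ hj _ _

variable {r : ℕ}

lemma mem_matchedFlags_succ_iff_of_isArc (hN : IsShift e N) {i k : ℕ}
    (hik : i + 2 * (k + 1) = r + 1) (harc : IsArc w i (r + 1)) {F : GrProd K (p + q) (r + 1)} :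
    F ∈ matchedFlags e N w (r + 1) ↔ GrProd.trunc K (Nat.le_succ r) F ∈ matchedFlags e N w r ∧
      F.flag (r + 1) = (F.flag i).comap (N ^ (k + 1)) := by
  constructor
  · refine fun hF => ⟨trunc_mem_matchedFlags r F hF, hN.eq_comap ?_
      (IsMatched.bal hF i (r + 1) (k + 1) le_rfl hik harc.isBalanced)⟩
    rw [F.finrank_flag le_rfl, F.finrank_flag (by omega)]
    omega
  · rintro ⟨hF, h_eq⟩
    have hF' := isMatched_of_trunc_mem hF
    refine hF'.succ_of_isArc hik harc hN (fun j hj => F.finrank_flag (by omega)) ?_ h_eq.le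
    rw [h_eq]
    exact hF'.le_comap_of_isArc hik harc

lemma mem_matchedFlags_succ_iff_of_isRecord (hN : IsShift e N) {t u : ℕ}
    (htu : 2 * t + (u + 1) = r + 1) (hrec : IsRecord w (r + 1))
    (hu : height w (r + 1) = -((u + 1 : ℕ) : ℤ)) {F : GrProd K (p + q) (r + 1)} :
    F ∈ matchedFlags e N w (r + 1) ↔ GrProd.trunc K (Nat.le_succ r) F ∈ matchedFlags e N w r ∧
      F.flag (r + 1) = (coordSub e (u + 1) 0).comap (N ^ t) := by
  constructor
  · refine fun hF => ⟨trunc_mem_matchedFlags r F hF, hN.eq_comap ?_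
      (IsMatched.low hF (r + 1) t (u + 1) le_rfl htu hrec.isLow hu)⟩
    rw [F.finrank_flag le_rfl, finrank_coordSub]
    omega
  · rintro ⟨hF, h_eq⟩
    have hF' := isMatched_of_trunc_mem hF
    refine hF'.succ_of_isRecord htu hrec hu hN (F.finrank_flag (by omega)) ?_ h_eq.le
    rw [h_eq]
    exact hF'.le_comap_of_isRecord htu hrec hu

variable (hN : IsShift e N) (hqp : q ≤ p) (hw : IsBallot w p q)

include hN hqp hw

lemma exists_base_of_left (hr : r < p + q) (hwr : w r = .left) :
    ∃ (k m : ℕ) (B : matchedFlags e N w r → Gr K m (p + q)), HasRationalLifts K B ∧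
      m + 2 * k = r + 1 ∧ k ≤ q ∧ (∀ F, (B F).1 ≤ LinearMap.range (N ^ k)) ∧
      ∀ F : GrProd K (p + q) (r + 1), F ∈ matchedFlags e N w (r + 1) ↔
        ∃ hF : GrProd.trunc K (Nat.le_succ r) F ∈ matchedFlags e N w r,
          F.flag (r + 1) = (B ⟨_, hF⟩).1.comap (N ^ k) := by
  have h_count := hw.numRight_le (i := r + 1) hr
  rcases exists_isArc_or_isRecord hwr with ⟨i, k, hik, harc⟩ | hrec
  · have hi : i ≤ r := by omega
    have h_num := numRight_eq_add_of_height_eq hik harc.1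
    refine ⟨k + 1, i, fun F => F.1.member hi,
      (GrProd.hasRationalLifts_member hi).comp (HasRationalLifts.val _), hik, by omega,
      fun F => F.2.le_range hN hqp hw F.1.flag_zero hr.le hi (by omega), fun F => ?_⟩
    rw [mem_matchedFlags_succ_iff_of_isArc hN hik harc, ← GrProd.flag_trunc (Nat.le_succ r) F hi,
      ← exists_prop]
    rfl
  · obtain ⟨t, u, htu, hu⟩ := hrec.exists_height_eq
    have h_lower := hw.lower (r + 1) hr
    have h_add := height_add w (r + 1)
    have hfin : Module.finrank K (coordSub e (u + 1) 0) = u + 1 := by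
      rw [finrank_coordSub_of_le (by omega) (by omega), add_zero]
    refine ⟨t, u + 1, fun _ => ⟨coordSub e (u + 1) 0, hfin⟩, HasRationalLifts.const _, by omega,
      by omega, fun F => ?_, fun F => ?_⟩
    · rw [hN.range_pow]
      exact coordSub_mono (by omega) (by omega)
    · rw [mem_matchedFlags_succ_iff_of_isRecord hN htu hrec hu, exists_prop]

theorem exists_equiv_matchedFlags (hr : r < p + q) (hwr : w r = .left) :
    ∃ φ : matchedFlags e N w (r + 1) ≃ matchedFlags e N w r, HasRationalLifts K φ ∧
      HasRationalLifts K φ.symm ∧ ⇑φ = truncMap (trunc_mem_matchedFlags r) := by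
  obtain ⟨k, m, B, hB, hmk, hk, hBN, hF⟩ := exists_base_of_left hN hqp hw hr hwr
  have hfin : ∀ F, Module.finrank K ((B F).1.comap (N ^ k)) = r + 1 := fun F => by
    rw [hN.finrank_comap hk hqp (hBN F), (B F).2, hmk]
  let ψ (F : matchedFlags e N w r) : Gr K (r + 1) (p + q) := ⟨(B F).1.comap (N ^ k), hfin F⟩
  have hψ : HasRationalLifts K ψ :=
    hB.comap (N ^ k) hBN (by rw [hN.finrank_ker_pow hk hqp, hmk]) fun _ => rfl
  exact exists_equiv_eq_truncMap _ hψ hF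

theorem isRationalProjLineBundle_matchedFlags (hr : r < p + q) (hwr : w r = .right) :
    IsRationalProjLineBundle K
      (truncMap (trunc_mem_matchedFlags (e := e) (N := N) (w := w) r)) := by
  have h_count := hw.numRight_le (i := r + 1) hr
  rw [numRight_succ_right hwr] at h_count
  have hrange (F : matchedFlags e N w r) : F.1.flag r ≤ LinearMap.range (N ^ 1) :=
    F.2.le_range hN hqp hw F.1.flag_zero hr.le le_rfl (by omega)
  have hfin (F : matchedFlags e N w r) : Module.finrank K ((F.1.flag r).comap (N ^ 1)) = r + 2 := by
    rw [hN.finrank_comap (by omega) hqp (hrange F), F.1.finrank_flag le_rfl]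
  let M (F : matchedFlags e N w r) : Gr K (r + 2) (p + q) :=
    ⟨(F.1.flag r).comap (N ^ 1), hfin F⟩
  have hM : HasRationalLifts K M :=
    ((GrProd.hasRationalLifts_member le_rfl).comp (HasRationalLifts.val _)).comap (N ^ 1) hrange
      (by rw [hN.finrank_ker_pow (by omega) hqp]) fun _ => rfl
  have hM_trunc {F : GrProd K (p + q) (r + 1)}
      (hF : GrProd.trunc K (Nat.le_succ r) F ∈ matchedFlags e N w r) :
      (M ⟨_, hF⟩).1 = (F.flag r).comap N := by
    change ((GrProd.trunc K (Nat.le_succ r) F).flag r).comap (N ^ 1) = _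
    rw [pow_one, GrProd.flag_trunc _ _ le_rfl]
  refine isRationalProjLineBundle_truncMap _ hM (fun F => ?_) fun F => ⟨fun hF => ?_, ?_⟩
  · simpa only [M, pow_one] using F.2.le_comap_self F.1.flag_zero
  · refine ⟨trunc_mem_matchedFlags r F hF, IsMatched.mono hF r r.lt_succ_self, ?_⟩
    rw [hM_trunc]
    exact IsMatched.nil hF r r.lt_succ_self
  · rintro ⟨hF, hmono, hnil⟩
    rw [hM_trunc] at hnil
    exact (isMatched_of_trunc_mem hF).succ_right hwr hmono hnil

lemma irreducibleSpace_matchedFlags [Infinite K] (hr : r ≤ p + q) :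
    @IrreducibleSpace (matchedFlags e N w r) (zariski K _) := by
  let _ (s : ℕ) := zariski K (matchedFlags e N w s)
  induction r with
  | zero =>
    have : Subsingleton (matchedFlags e N w 0) :=
      ⟨fun F G => Subtype.ext (funext fun i => i.elim0)⟩
    exact { toNonempty := ⟨⟨fun i => i.elim0, IsMatched.zero rfl⟩⟩ }
  | succ r ih =>
    cases hwr : w r with
    | left =>
      obtain ⟨φ, -, hφ, -⟩ := exists_equiv_matchedFlags hN hqp hw hr hwr
      have := ih (by omega)
      rw [irreducibleSpace_def, Set.top_eq_univ, ← φ.symm.surjective.range_eq, ← Set.image_univ]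
      exact (IrreducibleSpace.isIrreducible_univ _).image _ hφ.continuous.continuousOn
    | right =>
      exact (isRationalProjLineBundle_matchedFlags hN hqp hw hr hwr).irreducibleSpace
        (ih (by omega))

lemma exists_prolongation_matchedFlags {s : ℕ} (hrs : r ≤ s) (hs : s ≤ p + q)
    {F : GrProd K (p + q) r} (hF : F ∈ matchedFlags e N w r) :
    ∃ F' ∈ matchedFlags e N w s, GrProd.trunc K hrs F' = F := by
  induction s, hrs using Nat.le_induction with
  | base => exact ⟨F, hF, rfl⟩
  | succ s hrs ih =>
    obtain ⟨F', hF', rfl⟩ := ih (by omega)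
    suffices h : ∃ G : matchedFlags e N w (s + 1),
        truncMap (trunc_mem_matchedFlags s) G = ⟨F', hF'⟩ by
      obtain ⟨G, hG⟩ := h
      have hG' : GrProd.trunc K (Nat.le_succ s) G.1 = F' := congrArg Subtype.val hG
      exact ⟨G.1, G.2, by rw [← hG']; rfl⟩
    cases hws : w s with
    | left =>
      obtain ⟨φ, -, -, hφ⟩ := exists_equiv_matchedFlags hN hqp hw hs hws
      rw [← hφ]
      exact φ.surjective _
    | right =>
      obtain ⟨φ, -⟩ := (isRationalProjLineBundle_matchedFlags hN hqp hw hs hws).exists_fiber_equiv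
        ⟨F', hF'⟩
      exact ⟨_, (φ.symm (Classical.arbitrary _)).2⟩

end MatchedFlags

/-! ### The strata -/

section Unrolling

/-- The condition `InStratum` for the subquotients of a flag `G` of a fixed space, in terms of
representatives: it describes the `m` members `G (r + 1), …, G (r + m)`, where `u (numLeft w r + i)`
and `W i` represent the two chains of the adapted basis of the quotient by `G r`. -/
def InStratumFrom {K : Type*} [Field K] {V : Type*} [AddCommGroup V] [Module K V] (u : ℕ → V)
    (w : ℕ → Column) (G : ℕ → Submodule K V) : ℕ → ℕ → (ℕ → V) → Prop
  | 0, _, _ => True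
  | m + 1, r, W =>
    match w r with
    | .left => G (r + 1) = G r ⊔ Submodule.span K {u (numLeft w r)} ∧
        InStratumFrom u w G m (r + 1) W
    | .right => ∃ a : K, G (r + 1) = G r ⊔ Submodule.span K {a • u (numLeft w r) + W 0} ∧
        InStratumFrom u w G m (r + 1) fun i => a • u (numLeft w r + (i + 1)) + W (i + 1)

variable {K : Type*} [Field K] {V : Type v} [AddCommGroup V] [Module K V]

lemma map_eq_span_singleton_iff {V' : Type*} [AddCommGroup V'] [Module K V'] (π : V →ₗ[K] V')
    {F : Submodule K V} (hF : LinearMap.ker π ≤ F) (v : V) :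
    F.map π = Submodule.span K {π v} ↔ F = LinearMap.ker π ⊔ Submodule.span K {v} := by
  rw [← Set.image_singleton, ← Submodule.map_span]
  refine ⟨fun h => ?_, fun h => ?_⟩
  · have h_comap := congrArg (Submodule.comap π) h
    rwa [Submodule.comap_map_eq, Submodule.comap_map_eq, sup_eq_left.2 hF, sup_comm] at h_comap
  · rw [h, Submodule.map_sup, (LinearMap.le_ker_iff_map).1 le_rfl, bot_sup_eq]

lemma inStratum_iff_inStratumFrom {u : ℕ → V} {w : ℕ → Column} {G : ℕ → Submodule K V}
    (hG : Monotone G) {m r : ℕ} {V' : Type v} [AddCommGroup V'] [Module K V'] {π : V →ₗ[K] V'}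
    (hπ : Function.Surjective π) (h_ker : LinearMap.ker π = G r) {W : ℕ → V} :
    InStratum K (List.ofFn fun i : Fin m => w (r + i)) V' (fun i => π (u (numLeft w r + i)))
        (fun i => π (W i)) (fun i => (G (r + 1 + i)).map π) ↔ InStratumFrom u w G m r W := by
  induction m generalizing r V' W with
  | zero => simp only [List.ofFn_zero, InStratum, InStratumFrom]
  | succ m ih =>
    have h_step : G r ≤ G (r + 1) := hG r.le_succ
    let π' : V →ₗ[K] V' ⧸ (G (r + 1)).map π := ((G (r + 1)).map π).mkQ ∘ₗ π
    have hπ' : Function.Surjective π' := (Submodule.mkQ_surjective _).comp hπ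
    have h_ker' : LinearMap.ker π' = G (r + 1) := by
      rw [LinearMap.ker_comp, Submodule.ker_mkQ, Submodule.comap_map_eq, h_ker,
        sup_eq_left.2 h_step]
    have h_line (v : V) : (G (r + 1)).map π = Submodule.span K {π v} ↔
        G (r + 1) = G r ⊔ Submodule.span K {v} := by
      rw [map_eq_span_singleton_iff π (h_ker.trans_le h_step), h_ker]
    have h_letters : (List.ofFn fun i : Fin (m + 1) => w (r + i)) =
        w r :: List.ofFn fun i : Fin m => w (r + 1 + i) := by
      simp only [List.ofFn_succ, Fin.val_zero, add_zero, Fin.val_succ, add_assoc, add_comm 1]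
    rw [h_letters]
    cases hwr : w r with
    | left =>
      simp only [InStratum, InStratumFrom, hwr, add_zero, h_line, ← ih hπ' h_ker',
        numLeft_succ_left hwr, ← Submodule.map_comp, add_assoc, add_comm 1]
      exact Iff.rfl
    | right =>
      simp only [InStratum, InStratumFrom, hwr, add_zero, ← map_smul, ← map_add, h_line,
        ← ih hπ' h_ker', numLeft_succ_right hwr, ← Submodule.map_comp, add_assoc, add_comm 1]
      exact Iff.rfl

end Unrolling

section Strata

variable {K : Type*} [Field K] {V : Type*} [AddCommGroup V] [Module K V] {p q : ℕ}
  {e : Module.Basis (Fin p ⊕ Fin q) K V} {N : V →ₗ[K] V} {w : ℕ → Column} {r : ℕ}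
  {G : ℕ → Submodule K V} {W : ℕ → V}

variable (e N w G r W) in
/-- The vectors `W 0, W 1, …` represent the second Jordan chain of an adapted basis modulo `G r`,
and agree with the vectors of the right chain of `e` modulo the left one. -/
structure IsSecondChain : Prop where
  apply_zero : numRight w r < q → N (W 0) ∈ G r
  apply_succ : ∀ i, i + 1 + numRight w r < q → N (W (i + 1)) = W i
  sub_mem : ∀ i, W i - chain e .right (numRight w r + i) ∈ coordSub e p 0

lemma chain_left_mem_coordSub (i : ℕ) : chain e .left i ∈ coordSub e p 0 := by
  by_cases hi : i < p
  · exact chain_mem_coordSub hi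
  · rw [chain_of_le (not_lt.1 hi)]
    exact Submodule.zero_mem _

namespace IsSecondChain

lemma succ_left (hW : IsSecondChain e N w r G W) (hwr : w r = .left) (hG : G r ≤ G (r + 1)) :
    IsSecondChain e N w (r + 1) G W where
  apply_zero h := hG (hW.apply_zero (numRight_succ_left hwr ▸ h))
  apply_succ i h := hW.apply_succ i (numRight_succ_left hwr ▸ h)
  sub_mem := numRight_succ_left hwr ▸ hW.sub_mem

lemma succ_right (hN : IsShift e N) (hw : IsBallot w p q) (hr : r ≤ p + q)
    (hW : IsSecondChain e N w r G W) (hwr : w r = .right) {a : K}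
    (ha : a • chain e .left (numLeft w r) + W 0 ∈ G (r + 1)) :
    IsSecondChain e N w (r + 1) G
      fun i => a • chain e .left (numLeft w r + (i + 1)) + W (i + 1) := by
  have hlow := hw.lower r hr
  unfold height at hlow
  have h_left {i : ℕ} (hi : numRight w r + i + 1 < q) :
      N (chain e .left (numLeft w r + (i + 1))) = chain e .left (numLeft w r + i) :=
    hN.apply_chain (c := .left) (i := numLeft w r + i) (by rw [Column.select_left]; omega)
  constructor <;> rw [numRight_succ_right hwr]
  · intro h
    rwa [map_add, map_smul, h_left (by omega), hW.apply_succ 0 (by omega)]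
  · intro i hi
    rw [map_add, map_smul, h_left (by omega), hW.apply_succ (i + 1) (by omega)]
  · intro i
    rw [add_assoc, add_comm 1 i, add_sub_assoc]
    exact Submodule.add_mem _ (Submodule.smul_mem _ _ (chain_left_mem_coordSub _))
      (hW.sub_mem (i + 1))

end IsSecondChain

lemma inf_coordSub_le (hN : IsShift e N) {F : Submodule K V} (hF : F ≤ F.comap N) {l : ℕ}
    (hl : coordSub e l 0 ≤ F) (h_notMem : l < p → chain e .left l ∉ F) :
    F ⊓ coordSub e p 0 ≤ coordSub e l 0 := by
  rintro v ⟨hvF, hvp⟩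
  suffices h : ∀ d, v ∈ coordSub e (l + d) 0 → v ∈ coordSub e l 0 from
    h p (coordSub_mono (Nat.le_add_left p l) le_rfl hvp)
  intro d
  induction d with
  | zero => exact id
  | succ d ih =>
    intro hv
    apply ih
    by_cases hlp : l + d < p
    swap
    · exact coordSub_mono (not_lt.1 hlp) le_rfl hvp
    have h_sub := sub_smul_chain_left_mem (show v ∈ coordSub e (l + d + 1) 0 from hv)
    suffices h_coord : chainCoord e .left (l + d) v = 0 by
      rwa [h_coord, zero_smul, sub_zero] at h_sub
    -- Otherwise `N ^ d` maps `v` to a nonzero multiple of `chain e .left l` modulo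
    -- `coordSub e l 0`.
    by_contra h_coord
    have h_pow_sub : (N ^ d) (v - chainCoord e .left (l + d) v • chain e .left (l + d)) ∈ F := by
      refine hl ((?_ : _ ≤ (coordSub e l 0).comap (N ^ d)) h_sub)
      rw [hN.comap_pow_coordSub]
      exact coordSub_mono le_rfl (Nat.zero_le _)
    rw [map_sub, map_smul, hN.pow_chain (c := .left) hlp] at h_pow_sub
    have h_smul := Submodule.sub_mem _ (Module.End.pow_apply_mem_of_forall_mem d hF v hvF) h_pow_sub
    rw [sub_sub_cancel, Submodule.smul_mem_iff _ h_coord] at h_smul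
    exact h_notMem (by omega) h_smul

section FiniteDimensional

variable [FiniteDimensional K V]

namespace IsMatched

lemma coordSub_le (hN : IsShift e N) (h : IsMatched e N w r G)
    (hfin : ∀ i ≤ r, Module.finrank K (G i) = i) : coordSub e (numLeft w r) 0 ≤ G r := by
  induction r using Nat.strong_induction_on with
  | _ r ih =>
  rcases r with _ | r
  · rw [numLeft, coordSub_zero_zero]
    exact bot_le
  have ih' (s : ℕ) (hs : s ≤ r) : coordSub e (numLeft w s) 0 ≤ G s :=
    ih s (by omega) (h.of_le (by omega)) fun i hi => hfin i (by omega)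
  have h_count := numRight_add_numLeft w (r + 1)
  cases hwr : w r with
  | left =>
    rcases exists_isArc_or_isRecord hwr with ⟨i, k, hik, harc⟩ | hrec
    · have h_num := numRight_eq_add_of_height_eq hik harc.1
      have h_count' := numRight_add_numLeft w i
      rw [hN.eq_comap (by rw [hfin _ le_rfl, hfin i (by omega)]; omega)
        (h.bal i (r + 1) (k + 1) le_rfl hik harc.isBalanced)]
      refine le_trans ?_ (Submodule.comap_mono (ih' i (by omega)))
      rw [hN.comap_pow_coordSub]
      exact coordSub_mono (by omega) (Nat.zero_le _)
    · obtain ⟨t, u, htu, hu⟩ := hrec.exists_height_eq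
      have h_add := height_add w (r + 1)
      rw [hN.eq_comap (by rw [hfin _ le_rfl, finrank_coordSub]; omega)
        (h.low (r + 1) t (u + 1) le_rfl htu hrec.isLow hu), hN.comap_pow_coordSub]
      exact coordSub_mono (by omega) (Nat.zero_le _)
  | right =>
    rw [numLeft_succ_right hwr]
    exact (ih' r le_rfl).trans (h.mono r r.lt_succ_self)

lemma succ_left_of_eq_sup (hN : IsShift e N) (h : IsMatched e N w r G)
    (hfin : ∀ i ≤ r, Module.finrank K (G i) = i) (hwr : w r = .left)
    (hG : G (r + 1) = G r ⊔ Submodule.span K {chain e .left (numLeft w r)}) :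
    IsMatched e N w (r + 1) G := by
  have hmono : G r ≤ G (r + 1) := hG ▸ le_sup_left
  have h_chain : chain e .left (numLeft w r) ∈ coordSub e (numLeft w (r + 1)) 0 :=
    chain_mem_coordSub (by rw [numLeft_succ_left hwr]; exact Nat.lt_succ_self _)
  have h_count := numRight_add_numLeft w (r + 1)
  rcases exists_isArc_or_isRecord hwr with ⟨i, k, hik, harc⟩ | hrec
  · have h_num := numRight_eq_add_of_height_eq hik harc.1
    have h_count' := numRight_add_numLeft w i
    refine h.succ_of_isArc hik harc hN hfin hmono (hG ▸ sup_le (h.le_comap_of_isArc hik harc) ?_)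
    have h_le : coordSub e (numLeft w i) 0 ≤ G i :=
      (h.of_le (by omega)).coordSub_le hN fun j hj => hfin j (by omega)
    refine ((Submodule.span_singleton_le_iff_mem _ _).2 ?_).trans (Submodule.comap_mono h_le)
    rw [hN.comap_pow_coordSub]
    exact coordSub_mono (by omega) (Nat.zero_le _) h_chain
  · obtain ⟨t, u, htu, hu⟩ := hrec.exists_height_eq
    have h_add := height_add w (r + 1)
    refine h.succ_of_isRecord htu hrec hu hN (hfin r le_rfl) hmono
      (hG ▸ sup_le (h.le_comap_of_isRecord htu hrec hu) ?_)
    rw [Submodule.span_singleton_le_iff_mem, hN.comap_pow_coordSub]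
    exact coordSub_mono (by omega) (Nat.zero_le _) h_chain

lemma succ_right_of_eq_sup (hN : IsShift e N) (h : IsMatched e N w r G)
    (hfin : ∀ i ≤ r, Module.finrank K (G i) = i) (hwr : w r = .right) {a : K} {v : V}
    (hv : N v ∈ G r)
    (hG : G (r + 1) = G r ⊔ Submodule.span K {a • chain e .left (numLeft w r) + v}) :
    IsMatched e N w (r + 1) G := by
  have h_zero : G 0 = ⊥ := Submodule.finrank_eq_zero.1 (hfin 0 r.zero_le)
  have h_chain : N (chain e .left (numLeft w r)) ∈ coordSub e (numLeft w r) 0 :=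
    hN.apply_mem_coordSub (a := numLeft w r + 1) (b := 0) (chain_mem_coordSub (c := .left)
      (Nat.lt_succ_self _))
  refine h.succ_right hwr (hG ▸ le_sup_left) (hG ▸ sup_le (h.le_comap_self h_zero) ?_)
  rw [Submodule.span_singleton_le_iff_mem, Submodule.mem_comap, map_add, map_smul]
  exact Submodule.add_mem _ (Submodule.smul_mem _ _ (h.coordSub_le hN hfin h_chain)) hv

end IsMatched

lemma isMatched_of_inStratumFrom (hN : IsShift e N) (hw : IsBallot w p q)
    (hfin : ∀ i ≤ p + q, Module.finrank K (G i) = i) {m : ℕ} (hrm : r + m = p + q)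
    (h : IsMatched e N w r G) (hW : IsSecondChain e N w r G W)
    (hG : InStratumFrom (chain e .left) w G m r W) : IsMatched e N w (p + q) G := by
  induction m generalizing r W with
  | zero => exact hrm ▸ h
  | succ m ih =>
    have hfin' : ∀ i ≤ r, Module.finrank K (G i) = i := fun i hi => hfin i (by omega)
    cases hwr : w r with
    | left =>
      simp only [InStratumFrom, hwr] at hG
      exact ih (by omega) (h.succ_left_of_eq_sup hN hfin' hwr hG.1)
        (hW.succ_left hwr (hG.1 ▸ le_sup_left)) hG.2
    | right =>
      simp only [InStratumFrom, hwr] at hG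
      obtain ⟨a, ha, hG⟩ := hG
      have h_count := hw.numRight_le (i := r + 1) (by omega)
      rw [numRight_succ_right hwr] at h_count
      have h_mem : a • chain e .left (numLeft w r) + W 0 ∈ G (r + 1) :=
        ha ▸ Submodule.mem_sup_right (Submodule.mem_span_singleton_self _)
      exact ih (by omega) (h.succ_right_of_eq_sup hN hfin' hwr (hW.apply_zero h_count) ha)
        (hW.succ_right hN hw (by omega) hwr h_mem) hG

variable (e N w G) in
/-- The complete flags in the open stratum of the variety of matched flags: they contain as little
of the left chain as possible. -/
structure IsGenericMatched : Prop where
  finrank_eq : ∀ i ≤ p + q, Module.finrank K (G i) = i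
  isMatched : IsMatched e N w (p + q) G
  chain_notMem : ∀ i ≤ p + q, numLeft w i < p → chain e .left (numLeft w i) ∉ G i

namespace IsGenericMatched

variable (h : IsGenericMatched e N w G) (hN : IsShift e N)

include h hN

lemma coordSub_le (hr : r ≤ p + q) : coordSub e (numLeft w r) 0 ≤ G r :=
  (h.isMatched.of_le hr).coordSub_le hN fun i hi => h.finrank_eq i (hi.trans hr)

lemma inf_coordSub_le (hr : r ≤ p + q) : G r ⊓ coordSub e p 0 ≤ coordSub e (numLeft w r) 0 :=
  _root_.inf_coordSub_le hN
    ((h.isMatched.of_le hr).le_comap_self (Submodule.finrank_eq_zero.1 (h.finrank_eq 0 (by omega))))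
    (h.coordSub_le hN hr) (h.chain_notMem r hr)

variable (hw : IsBallot w p q)

include hw

lemma eq_sup_chain_left (hr : r < p + q) (hwr : w r = .left) :
    G (r + 1) = G r ⊔ Submodule.span K {chain e .left (numLeft w r)} := by
  have h_count := hw.numLeft_le (i := r + 1) hr
  rw [numLeft_succ_left hwr] at h_count
  refine (sup_span_singleton_eq (h.isMatched.mono r hr) ?_ ?_ (h.chain_notMem r hr.le h_count)).symm
  · rw [h.finrank_eq r hr.le, h.finrank_eq (r + 1) hr]
  · refine h.coordSub_le hN (r := r + 1) hr (chain_mem_coordSub ?_)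
    rw [numLeft_succ_left hwr]
    exact Nat.lt_succ_self _

lemma le_coordSub (hr : r ≤ p + q) : G r ≤ coordSub e p (numRight w r) := by
  induction r with
  | zero =>
    rw [Submodule.finrank_eq_zero.1 (h.finrank_eq 0 hr)]
    exact bot_le
  | succ r ih =>
    cases hwr : w r with
    | left =>
      rw [h.eq_sup_chain_left hN hw hr hwr, numRight_succ_left hwr]
      refine sup_le (ih (by omega)) ((Submodule.span_singleton_le_iff_mem _ _).2 ?_)
      exact coordSub_mono le_rfl (Nat.zero_le _) (chain_left_mem_coordSub _)
    | right =>
      rw [numRight_succ_right hwr]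
      refine (h.isMatched.nil r hr).trans ((Submodule.comap_mono (ih (by omega))).trans ?_)
      rw [← pow_one N, hN.comap_pow_coordSub, ← coordSub_min]
      exact coordSub_mono (min_le_right _ _) (min_le_left _ _)

lemma coordSub_sup_eq (hr : r ≤ p + q) : coordSub e p 0 ⊔ G r = coordSub e p (numRight w r) := by
  refine Submodule.eq_of_le_of_finrank_le
    (sup_le (coordSub_mono le_rfl (Nat.zero_le _)) (h.le_coordSub hN hw hr)) ?_
  have h_dim := Submodule.finrank_sup_add_finrank_inf_eq (coordSub e p 0) (G r)
  have h_inf := Submodule.finrank_mono (h.inf_coordSub_le hN hr)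
  have h_count := numRight_add_numLeft w r
  have h_right := hw.numRight_le hr
  rw [inf_comm, finrank_coordSub] at h_inf
  rw [h.finrank_eq r hr, finrank_coordSub] at h_dim
  rw [finrank_coordSub]
  omega

lemma exists_eq_sup (hr : r < p + q) (hwr : w r = .right) {x : V} (hNx : N x ∈ G r)
    (hx : x - chain e .right (numRight w r) ∈ coordSub e p 0) :
    ∃ a : K, G (r + 1) = G r ⊔ Submodule.span K {a • chain e .left (numLeft w r) + x} := by
  have h_count := hw.numRight_le (i := r + 1) hr
  rw [numRight_succ_right hwr] at h_count
  have hx_mem : x ∈ coordSub e p (numRight w (r + 1)) := by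
    rw [← sub_add_cancel x (chain e .right (numRight w r)), numRight_succ_right hwr]
    exact Submodule.add_mem _ (coordSub_mono le_rfl (Nat.zero_le _) hx)
      (chain_mem_coordSub (Nat.lt_succ_self _))
  rw [← h.coordSub_sup_eq hN hw hr] at hx_mem
  obtain ⟨y, hy, f, hf, rfl⟩ := Submodule.mem_sup.1 hx_mem
  have hNy : N y ∈ coordSub e (numLeft w r) 0 := by
    have hNy_mem : N y ∈ G r := by
      simpa only [map_add, add_sub_cancel_right] using
        Submodule.sub_mem _ hNx (h.isMatched.nil r hr hf)
    exact h.inf_coordSub_le hN hr.le ⟨hNy_mem, coordSub_mono (Nat.sub_le _ _) le_rfl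
      (hN.apply_mem_coordSub hy)⟩
  have hy' : y ∈ coordSub e (numLeft w r + 1) 0 := by
    have h_comap := hN.comap_pow_coordSub 1 (numLeft w r) 0
    rw [pow_one] at h_comap
    have hy_comap : y ∈ coordSub e (numLeft w r + 1) (0 + 1) := h_comap ▸ hNy
    rintro (_ | _) i hi
    exacts [hy_comap .left i hi, hy .right i hi]
  refine ⟨-chainCoord e .left (numLeft w r) y, (sup_span_singleton_eq (h.isMatched.mono r hr)
    (by rw [h.finrank_eq r hr.le, h.finrank_eq (r + 1) hr]) ?_ fun h_mem => ?_).symm⟩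
  · rw [neg_smul, neg_add_eq_sub, add_sub_right_comm]
    exact Submodule.add_mem _ (h.isMatched.mono r hr (h.coordSub_le hN hr.le
      (sub_smul_chain_left_mem hy'))) hf
  · have h_le := h.le_coordSub hN hw hr.le
    have h_left : chain e .left (numLeft w r) ∈ coordSub e p (numRight w r) :=
      coordSub_mono le_rfl (Nat.zero_le _) (chain_left_mem_coordSub _)
    have hx_right := (Submodule.add_mem_iff_right _ (Submodule.smul_mem _ _ h_left)).1 (h_le h_mem)
    have h_chain := Submodule.sub_mem _ hx_right (coordSub_mono le_rfl (Nat.zero_le _) hx)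
    rw [sub_sub_cancel, chain_mem_coordSub_iff h_count] at h_chain
    exact lt_irrefl _ h_chain

lemma inStratumFrom {m : ℕ} (hrm : r + m = p + q) (hW : IsSecondChain e N w r G W) :
    InStratumFrom (chain e .left) w G m r W := by
  induction m generalizing r W with
  | zero => trivial
  | succ m ih =>
    cases hwr : w r with
    | left =>
      simp only [InStratumFrom, hwr]
      exact ⟨h.eq_sup_chain_left hN hw (by omega) hwr,
        ih (by omega) (hW.succ_left hwr (h.isMatched.mono r (by omega)))⟩
    | right =>
      simp only [InStratumFrom, hwr]
      have h_count := hw.numRight_le (i := r + 1) (by omega)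
      rw [numRight_succ_right hwr] at h_count
      obtain ⟨a, ha⟩ := h.exists_eq_sup hN hw (by omega) hwr (hW.apply_zero h_count) (hW.sub_mem 0)
      have h_mem : a • chain e .left (numLeft w r) + W 0 ∈ G (r + 1) :=
        ha ▸ Submodule.mem_sup_right (Submodule.mem_span_singleton_self _)
      exact ⟨a, ha, ih (by omega) (hW.succ_right hN hw (by omega) hwr h_mem)⟩

end IsGenericMatched

end FiniteDimensional

end Strata

/-! ### Coordinate flags -/

section Reflection

variable {w w' : ℕ → Column} {p q : ℕ}

lemma exists_isArc_of_right {i n : ℕ} (hi : w i = .right) (hin : i < n)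
    (hn : height w n ≤ height w i) : ∃ j ≤ n, i < j ∧ IsArc w i j := by
  classical
  have hex : ∃ j, i < j ∧ height w j ≤ height w i := ⟨n, hin, hn⟩
  obtain ⟨j, hj⟩ : ∃ j, Nat.find hex = j := ⟨_, rfl⟩
  obtain ⟨⟨hij, h_le⟩, h_first⟩ := (Nat.find_eq_iff hex).1 hj
  have h_lt : ∀ m, i < m → m < j → height w i < height w m := fun m him hmj =>
    not_le.1 fun h_le_m => h_first m hmj ⟨him, h_le_m⟩
  refine ⟨j, hj ▸ Nat.find_min' hex ⟨hin, hn⟩, hij, ?_, h_lt⟩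
  obtain ⟨l, rfl⟩ : ∃ l, j = l + 1 := ⟨j - 1, by omega⟩
  have h_first_step := height_succ_right hi
  have h_last_step := height_succ w l
  rcases (Nat.lt_succ_iff.1 hij).eq_or_lt with rfl | hil
  · omega
  · have := h_lt l hil l.lt_succ_self
    omega

lemma numRight_le_numRight {n : ℕ} (h : ∀ i < n, w' i = .right → w i = .right) :
    numRight w' n ≤ numRight w n := by
  induction n with
  | zero => exact le_rfl
  | succ n ih =>
    have h_le := ih fun i hi => h i (hi.trans n.lt_succ_self)
    cases hn : w' n with
    | left => rw [numRight_succ_left hn]; exact h_le.trans (numRight_mono w n.le_succ)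
    | right =>
      rw [numRight_succ_right hn, numRight_succ_right (h n n.lt_succ_self hn)]
      exact Nat.succ_le_succ h_le

lemma eq_of_numRight_eq {n : ℕ} (h : ∀ i < n, w' i = .right → w i = .right)
    (hn : numRight w n = numRight w' n) : ∀ i < n, w i = w' i := by
  induction n with
  | zero => exact fun i hi => absurd hi i.not_lt_zero
  | succ n ih =>
    have h_init : ∀ i < n, w' i = .right → w i = .right := fun i hi => h i (by omega)
    have h_le := numRight_le_numRight h_init
    suffices h_last : w n = w' n by
      intro i hi
      rcases Nat.lt_succ_iff_lt_or_eq.1 hi with hi | rfl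
      · exact ih h_init (by simpa only [numRight, h_last, Nat.add_right_cancel_iff] using hn) i hi
      · exact h_last
    cases hw' : w' n with
    | right => exact h n n.lt_succ_self hw'
    | left =>
      cases hw : w n with
      | left => rfl
      | right =>
        rw [numRight_succ_left hw', numRight_succ_right hw] at hn
        omega

/-- The word whose lattice path has the height function `g`. -/
def wordOfHeight (g : ℕ → ℤ) (i : ℕ) : Column := if g i < g (i + 1) then .right else .left

lemma height_wordOfHeight {g : ℕ → ℤ} (h_zero : g 0 = 0)
    (h_step : ∀ i, g (i + 1) = g i + 1 ∨ g (i + 1) = g i - 1) (i : ℕ) :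
    height (wordOfHeight g) i = g i := by
  induction i with
  | zero => rw [h_zero, height_zero]
  | succ i ih =>
    rcases h_step i with h | h
    · rw [height_succ_right (if_pos (by omega)), ih, h]
    · rw [height_succ_left (if_neg (by omega)), ih, h]

/-- The lattice path of `l` has the same height at both ends of every interval which `w` matches
completely, and the height of `w` wherever the latter is minimal. -/
structure IsCompatible (w : ℕ → Column) (n : ℕ) (l : ℕ → Column) : Prop where
  bal : ∀ i j, i ≤ j → j ≤ n → IsBalanced w i j → height l i = height l j
  low : ∀ j ≤ n, IsLow w j → height l j = height w j

lemma IsCompatible.refl (w : ℕ → Column) (n : ℕ) : IsCompatible w n w :=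
  ⟨fun _ _ _ _ h => h.1, fun _ _ _ => rfl⟩

/-- The height function of `w`, with the part above the height at `m` reflected downwards from
position `m` on. -/
def reflectedHeight (w : ℕ → Column) (m i : ℕ) : ℤ :=
  if i ≤ m then height w i else min (height w i) (2 * height w m - height w i)

lemma reflectedHeight_of_le {m i : ℕ} (h : i ≤ m) : reflectedHeight w m i = height w i :=
  if_pos h

lemma reflectedHeight_of_ge {m i : ℕ} (h : m ≤ i) :
    reflectedHeight w m i = min (height w i) (2 * height w m - height w i) := by
  rcases h.eq_or_lt with rfl | h
  · rw [reflectedHeight_of_le le_rfl]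
    omega
  · exact if_neg (not_le.2 h)

lemma height_wordOfHeight_reflectedHeight (w : ℕ → Column) (m i : ℕ) :
    height (wordOfHeight (reflectedHeight w m)) i = reflectedHeight w m i := by
  refine height_wordOfHeight (reflectedHeight_of_le m.zero_le) (fun i => ?_) i
  have h_step := height_succ w i
  rcases Nat.lt_or_ge i m with h | h
  · rwa [reflectedHeight_of_le h.le, reflectedHeight_of_le h]
  · rw [reflectedHeight_of_ge h, reflectedHeight_of_ge (h.trans (Nat.le_add_right i 1))]
    omega

lemma isCompatible_wordOfHeight_reflectedHeight (w : ℕ → Column) (n m : ℕ) :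
    IsCompatible w n (wordOfHeight (reflectedHeight w m)) where
  bal i j hij _ hb := by
    rw [height_wordOfHeight_reflectedHeight, height_wordOfHeight_reflectedHeight]
    have h_eq := hb.1
    rcases le_total m i with hmi | him
    · rw [reflectedHeight_of_ge hmi, reflectedHeight_of_ge (hmi.trans hij), h_eq]
    rcases le_total m j with hmj | hjm
    · have := hb.2 m him hmj
      rw [reflectedHeight_of_le him, reflectedHeight_of_ge hmj]
      omega
    · rw [reflectedHeight_of_le him, reflectedHeight_of_le hjm, h_eq]
  low j _ hl := by
    rw [height_wordOfHeight_reflectedHeight]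
    rcases le_total j m with hjm | hmj
    · exact reflectedHeight_of_le hjm
    · have := hl m hmj
      rw [reflectedHeight_of_ge hmj]
      omega

lemma IsBallot.numRight_wordOfHeight_reflectedHeight (hw : IsBallot w p q) {m : ℕ}
    (hm : m ≤ p + q) : numRight (wordOfHeight (reflectedHeight w m)) (p + q) = q := by
  have h_add := height_add (wordOfHeight (reflectedHeight w m)) (p + q)
  rw [height_wordOfHeight_reflectedHeight, reflectedHeight_of_ge hm] at h_add
  have h_lower := hw.lower m hm
  have h_end := hw.height_eq
  omega

/-- Where `w'` opens an arc and `w` goes down, the reflection of `w` after this step is not level on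
that arc. -/
lemma IsBallot.eq_right_of_isCompatible (hw : IsBallot w p q) (hw' : IsBallot w' p q)
    (h : ∀ l, numRight l (p + q) = q → IsCompatible w (p + q) l →
      ∀ i j, i ≤ j → j ≤ p + q → IsBalanced w' i j → height l i = height l j)
    {i : ℕ} (hi : i < p + q) (hi' : w' i = .right) : w i = .right := by
  obtain ⟨j, hj, hij, harc⟩ :=
    exists_isArc_of_right hi' hi (hw'.height_eq.trans_le (hw'.lower i hi.le))
  have h_self := h w hw.numRight_eq (.refl w _) i j hij.le hj harc.isBalanced
  have h_refl := h _ (hw.numRight_wordOfHeight_reflectedHeight (m := i + 1) hi)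
    (isCompatible_wordOfHeight_reflectedHeight w _ _) i j hij.le hj harc.isBalanced
  rw [height_wordOfHeight_reflectedHeight, height_wordOfHeight_reflectedHeight,
    reflectedHeight_of_le (Nat.le_add_right i 1), reflectedHeight_of_ge (m := i + 1) hij] at h_refl
  cases hwi : w i with
  | right => rfl
  | left =>
    have h_step := height_succ_left hwi
    omega

end Reflection

section CoordFlags

variable {K : Type*} [Field K] {V : Type*} [AddCommGroup V] [Module K V] {p q : ℕ}
  {w w' l : ℕ → Column}

lemma coordSub_le_coordSub_iff {e : Module.Basis (Fin p ⊕ Fin q) K V} {a b a' b' : ℕ}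
    (ha : a ≤ p) (hb : b ≤ q) : coordSub e a b ≤ coordSub e a' b' ↔ a ≤ a' ∧ b ≤ b' := by
  refine ⟨fun h => ⟨?_, ?_⟩, fun h => coordSub_mono h.1 h.2⟩
  · by_contra! ha'
    exact lt_irrefl a' ((chain_mem_coordSub_iff (c := .left) (i := a') (by simp; omega)).1
      (h (chain_mem_coordSub (c := .left) ha')))
  · by_contra! hb'
    exact lt_irrefl b' ((chain_mem_coordSub_iff (c := .right) (i := b') (by simp; omega)).1
      (h (chain_mem_coordSub (c := .right) hb')))

lemma IsCompatible.isMatched {e : Module.Basis (Fin p ⊕ Fin q) K V} {N : V →ₗ[K] V}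
    (hN : IsShift e N) {r : ℕ} (h : IsCompatible w r l) :
    IsMatched e N w r fun i => coordSub e (numLeft l i) (numRight l i) where
  mono i _ := coordSub_mono (numLeft_mono l i.le_succ) (numRight_mono l i.le_succ)
  nil i _ := by
    rw [← pow_one N, hN.comap_pow_coordSub]
    cases hi : l i <;> simp only [numLeft, numRight, hi, Column.select] <;>
      exact coordSub_mono (by omega) (by omega)
  bal i j k hj hij hb := by
    have h_num := numRight_eq_add_of_height_eq hij (h.bal i j (by omega) hj hb)
    have hi_add := numRight_add_numLeft l i
    have hj_add := numRight_add_numLeft l j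
    rw [hN.comap_pow_coordSub]
    exact coordSub_mono (by omega) (by omega)
  low j t u hj htu hl hu := by
    have h_height := h.low j hj hl
    have h_height_add := height_add l j
    have h_add := numRight_add_numLeft l j
    rw [hN.comap_pow_coordSub]
    exact coordSub_mono (by omega) (by omega)

lemma numLeft_le_and_numRight_le (hl : numRight l (p + q) = q) {i : ℕ} (hi : i ≤ p + q) :
    numLeft l i ≤ p ∧ numRight l i ≤ q := by
  have h_add := numRight_add_numLeft l (p + q)
  exact ⟨(numLeft_mono l hi).trans (by omega), (numRight_mono l hi).trans hl.le⟩

lemma height_eq_of_isMatched {e : Module.Basis (Fin p ⊕ Fin q) K V} {N : V →ₗ[K] V}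
    (hN : IsShift e N) (hl : numRight l (p + q) = q)
    (h : IsMatched e N w (p + q) fun i => coordSub e (numLeft l i) (numRight l i))
    {i j : ℕ} (hij : i ≤ j) (hj : j ≤ p + q) (hb : IsBalanced w i j) :
    height l i = height l j := by
  obtain ⟨k, rfl⟩ : ∃ k, j = i + 2 * k := by
    have hi_add := height_add w i
    have hj_add := height_add w j
    have h_eq := hb.1
    exact ⟨(j - i) / 2, by omega⟩
  have h_le := h.bal i _ k hj rfl hb
  obtain ⟨h_left, h_right⟩ := numLeft_le_and_numRight_le hl hj
  rw [hN.comap_pow_coordSub, coordSub_le_coordSub_iff h_left h_right] at h_le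
  have hi_add := numRight_add_numLeft l i
  have hj_add := numRight_add_numLeft l (i + 2 * k)
  unfold height
  omega

lemma finrank_coordSub_num (e : Module.Basis (Fin p ⊕ Fin q) K V) (hl : numRight l (p + q) = q)
    {i : ℕ} (hi : i ≤ p + q) :
    Module.finrank K (coordSub e (numLeft l i) (numRight l i)) = i := by
  obtain ⟨h_left, h_right⟩ := numLeft_le_and_numRight_le hl hi
  rw [finrank_coordSub_of_le h_left h_right, add_comm, numRight_add_numLeft]

variable {e : Module.Basis (Fin p ⊕ Fin q) K (Fin (p + q) → K)}

variable (e) in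
/-- The flag of coordinate subspaces in which the vectors of the two chains are adjoined in the
order given by a word. -/
def coordFlag (hl : numRight l (p + q) = q) : GrProd K (p + q) (p + q) :=
  fun i => ⟨coordSub e (numLeft l (i + 1)) (numRight l (i + 1)), finrank_coordSub_num e hl i.2⟩

lemma flag_coordFlag (hl : numRight l (p + q) = q) {i : ℕ} (hi : i ≤ p + q) :
    (coordFlag e hl).flag i = coordSub e (numLeft l i) (numRight l i) := by
  cases i with
  | zero => exact coordSub_zero_zero.symm
  | succ i => rw [GrProd.flag_succ _ hi]; rfl

lemma IsBallot.eq_of_matchedFlags_subset {N : (Fin (p + q) → K) →ₗ[K] (Fin (p + q) → K)}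
    (hN : IsShift e N) (hw : IsBallot w p q) (hw' : IsBallot w' p q)
    (h : matchedFlags e N w (p + q) ⊆ matchedFlags e N w' (p + q)) : ∀ i < p + q, w i = w' i := by
  refine eq_of_numRight_eq (fun i hi => hw.eq_right_of_isCompatible hw' ?_ hi)
    (hw.numRight_eq.trans hw'.numRight_eq.symm)
  intro l hl hc i j hij hj hb
  have h_mem : coordFlag e hl ∈ matchedFlags e N w (p + q) :=
    (hc.isMatched hN).congr fun i hi => (flag_coordFlag hl hi).symm
  have h_matched : IsMatched e N w' (p + q) (coordFlag e hl).flag := h h_mem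
  exact height_eq_of_isMatched hN hl (h_matched.congr fun i hi => flag_coordFlag hl hi) hij hj hb

end CoordFlags

/-! ### The words of the flags in the Springer fiber -/

section Cover

variable {K : Type*} [Field K] {V : Type*} [AddCommGroup V] [Module K V] {p q : ℕ}
  {e : Module.Basis (Fin p ⊕ Fin q) K V} {N : V →ₗ[K] V} {G : ℕ → Submodule K V}

lemma IsShift.isNilpotent (hN : IsShift e N) : IsNilpotent N :=
  ⟨max p q, by
    rw [← LinearMap.ker_eq_top, hN.ker_pow, coordSub_eq_top (le_max_left _ _) (le_max_right _ _)]⟩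

lemma le_comap_of_isNilpotent [FiniteDimensional K V] (hN : IsNilpotent N) {W W' : Submodule K V}
    (hWW' : W ≤ W') (h_finrank : Module.finrank K W' = Module.finrank K W + 1)
    (h : W ≤ W.comap N) (h' : W' ≤ W'.comap N) : W' ≤ W.comap N := by
  by_contra h_not_le
  obtain ⟨v, hv, hvW⟩ := Set.not_subset.1 h_not_le
  have h_sup : W' ≤ W ⊔ W'.map N :=
    (sup_span_singleton_eq hWW' h_finrank (h' hv) hvW).ge.trans (sup_le_sup_left
      ((Submodule.span_singleton_le_iff_mem _ _).2 (Submodule.mem_map_of_mem hv)) _)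
  have h_sup_pow (k : ℕ) : W' ≤ W ⊔ W'.map (N ^ k) := by
    induction k with
    | zero => rw [pow_zero, Module.End.one_eq_id, Submodule.map_id]; exact le_sup_right
    | succ k ih =>
      refine h_sup.trans (sup_le le_sup_left ((Submodule.map_mono ih).trans ?_))
      rw [Submodule.map_sup, ← Submodule.map_comp, ← Module.End.mul_eq_comp, ← pow_succ']
      exact sup_le_sup_right (Submodule.map_le_iff_le_comap.2 h) _
  obtain ⟨k, hk⟩ := hN
  have h_le := h_sup_pow k
  rw [hk, Submodule.map_zero, sup_bot_eq] at h_le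
  exact hvW (h_le (h' hv))

/-- The smallest `k` such that `W` contains the range of `N ^ k`, for nilpotent `N`. -/
noncomputable def rangeOrder (N : V →ₗ[K] V) (W : Submodule K V) : ℕ :=
  sInf {k | LinearMap.range (N ^ k) ≤ W}

lemma rangeOrder_le {W : Submodule K V} {k : ℕ} (h : LinearMap.range (N ^ k) ≤ W) :
    rangeOrder N W ≤ k :=
  Nat.sInf_le h

lemma rangeOrder_top : rangeOrder N ⊤ = 0 :=
  Nat.le_zero.1 (rangeOrder_le le_top)

lemma range_pow_rangeOrder_le (hN : IsNilpotent N) (W : Submodule K V) :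
    LinearMap.range (N ^ rangeOrder N W) ≤ W := by
  obtain ⟨k, hk⟩ := hN
  refine Nat.sInf_mem (s := {k | LinearMap.range (N ^ k) ≤ W}) ⟨k, ?_⟩
  rw [Set.mem_ofPred_eq, hk, LinearMap.range_zero]
  exact bot_le

lemma rangeOrder_le_succ (hN : IsNilpotent N) {W W' : Submodule K V} (h : W' ≤ W.comap N) :
    rangeOrder N W ≤ rangeOrder N W' + 1 := by
  refine rangeOrder_le ?_
  rw [pow_succ', Module.End.mul_eq_comp, LinearMap.range_comp]
  exact Submodule.map_le_iff_le_comap.2 ((range_pow_rangeOrder_le hN W').trans h)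

lemma IsShift.rangeOrder_bot (hN : IsShift e N) (hqp : q ≤ p) : rangeOrder N ⊥ = p := by
  refine le_antisymm (rangeOrder_le ?_) ?_
  · rw [hN.range_pow, Nat.sub_self, Nat.sub_eq_zero_of_le hqp, coordSub_zero_zero]
  · have h_le : coordSub e (p - rangeOrder N ⊥) (q - rangeOrder N ⊥) ≤ coordSub e 0 0 := by
      rw [← hN.range_pow, coordSub_zero_zero]
      exact range_pow_rangeOrder_le hN.isNilpotent ⊥
    rw [coordSub_le_coordSub_iff (Nat.sub_le _ _) (Nat.sub_le _ _)] at h_le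
    omega

/-- The word of a complete flag whose letter in position `i` is `left` if `G (i + 1)` contains the
range of a smaller power of `N` than `G i` does. -/
noncomputable def rangeWord (N : V →ₗ[K] V) (G : ℕ → Submodule K V) (i : ℕ) : Column :=
  if rangeOrder N (G (i + 1)) < rangeOrder N (G i) then .left else .right

lemma rangeWord_eq_left_iff {i : ℕ} :
    rangeWord N G i = .left ↔ rangeOrder N (G (i + 1)) < rangeOrder N (G i) := by
  rw [rangeWord]
  split_ifs with h <;> simp [h]

variable [FiniteDimensional K V] (hN : IsShift e N) (hqp : q ≤ p)
  (hfin : ∀ i ≤ p + q, Module.finrank K (G i) = i)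
  (hmono : ∀ i < p + q, G i ≤ G (i + 1)) (hnil : ∀ i < p + q, G (i + 1) ≤ (G i).comap N)

include hN hfin hmono

lemma le_sup_range_pow_rangeOrder {r : ℕ} (hr : r < p + q)
    (h : rangeWord N G r = .left) :
    G (r + 1) ≤ G r ⊔ LinearMap.range (N ^ rangeOrder N (G (r + 1))) := by
  have h_not_le : ¬ LinearMap.range (N ^ rangeOrder N (G (r + 1))) ≤ G r := fun h_le =>
    (rangeWord_eq_left_iff.1 h).not_ge (rangeOrder_le h_le)
  obtain ⟨v, hv, hvr⟩ := Set.not_subset.1 h_not_le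
  have h_sup : G r ⊔ Submodule.span K {v} = G (r + 1) := by
    refine sup_span_singleton_eq (hmono r hr) ?_
      (range_pow_rangeOrder_le hN.isNilpotent _ hv) hvr
    rw [hfin r hr.le, hfin (r + 1) hr]
  exact h_sup.ge.trans <| sup_le_sup_left ((Submodule.span_singleton_le_iff_mem _ _).2 hv) _

include hqp hnil

lemma numLeft_rangeWord_add {i : ℕ} (hi : i ≤ p + q) :
    numLeft (rangeWord N G) i + rangeOrder N (G i) = p := by
  induction i with
  | zero => rw [Submodule.finrank_eq_zero.1 (hfin 0 hi), hN.rangeOrder_bot hqp, numLeft, zero_add]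
  | succ i ih =>
    have h_ind := ih (by omega)
    have h_le := rangeOrder_le ((range_pow_rangeOrder_le hN.isNilpotent _).trans (hmono i hi))
    have h_le_succ := rangeOrder_le_succ hN.isNilpotent (hnil i hi)
    have h_left := rangeWord_eq_left_iff (N := N) (G := G) (i := i)
    cases hwi : rangeWord N G i <;> simp only [hwi, numLeft, Column.select, true_iff, reduceCtorEq,
      false_iff] at h_left ⊢ <;> omega

lemma isBallot_rangeWord : IsBallot (rangeWord N G) p q where
  lower i hi := by
    have h_num := numLeft_rangeWord_add hN hqp hfin hmono hnil hi
    have h_add := numRight_add_numLeft (rangeWord N G) i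
    have h_range := Submodule.finrank_mono (range_pow_rangeOrder_le hN.isNilpotent (G i))
    rw [hfin i hi, hN.range_pow, finrank_coordSub] at h_range
    unfold height
    omega
  numRight_eq := by
    have h_num := numLeft_rangeWord_add hN hqp hfin hmono hnil le_rfl
    have h_add := numRight_add_numLeft (rangeWord N G) (p + q)
    have h_top : G (p + q) = ⊤ := by
      refine Submodule.eq_top_of_finrank_eq ((hfin _ le_rfl).trans ?_)
      rw [Module.finrank_eq_card_basis e, Fintype.card_sum, Fintype.card_fin, Fintype.card_fin]
    rw [h_top, rangeOrder_top] at h_num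
    omega

lemma isMatched_rangeWord {r : ℕ} (hr : r ≤ p + q) : IsMatched e N (rangeWord N G) r G := by
  induction r with
  | zero => exact .zero (Submodule.finrank_eq_zero.1 (hfin 0 hr))
  | succ r ih =>
    have h := ih (by omega)
    cases hwr : rangeWord N G r with
    | right => exact h.succ_right hwr (hmono r hr) (hnil r hr)
    | left =>
      have h_sup := le_sup_range_pow_rangeOrder hN hfin hmono hr hwr
      have h_num := numLeft_rangeWord_add hN hqp hfin hmono hnil hr
      have h_add := height_add (rangeWord N G) (r + 1)
      have h_count := numRight_add_numLeft (rangeWord N G) (r + 1)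
      rcases exists_isArc_or_isRecord hwr with ⟨i, k, hik, harc⟩ | hrec
      · refine h.succ_of_isArc hik harc hN (fun i hi => hfin i (by omega)) (hmono r hr)
          (h_sup.trans (sup_le (h.le_comap_of_isArc hik harc) ?_))
        have h_num_i := numLeft_rangeWord_add hN hqp hfin hmono hnil (i := i) (by omega)
        have h_count_i := numRight_add_numLeft (rangeWord N G) i
        have h_right := numRight_eq_add_of_height_eq hik harc.1
        have h_exp : k + 1 + rangeOrder N (G (r + 1)) = rangeOrder N (G i) := by omega
        rw [← Submodule.map_le_iff_le_comap, ← LinearMap.range_comp, ← Module.End.mul_eq_comp,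
          ← pow_add, h_exp]
        exact range_pow_rangeOrder_le hN.isNilpotent _
      · obtain ⟨t, u, htu, hu⟩ := hrec.exists_height_eq
        have h_lower := (isBallot_rangeWord hN hqp hfin hmono hnil).lower (r + 1) hr
        refine h.succ_of_isRecord htu hrec hu hN (hfin r (by omega)) (hmono r hr)
          (h_sup.trans (sup_le (h.le_comap_of_isRecord htu hrec hu) ?_))
        rw [hN.range_pow, hN.comap_pow_coordSub]
        exact coordSub_mono (by omega) (by omega)

end Cover

/-! ### Words of standard tableaux -/

section Tableau

variable {p q : ℕ} (σ : StandardTableau p q)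

/-- The column `ψ(j + 1)` in which the number `j + 1` appears in a tableau, prolonged by `left` to
all natural numbers. -/
def StandardTableau.word (j : ℕ) : Column := if h : j < p + q then σ.column ⟨j, h⟩ else .left

lemma StandardTableau.word_val (r : Fin (p + q)) : σ.word r = σ.column r := dif_pos r.2

lemma StandardTableau.word_eq_right_iff {j : ℕ} (hj : j < p + q) :
    σ.word j = .right ↔ ∃ k, (σ.entry (Sum.inr k) : ℕ) = j := by
  rw [word, dif_pos hj]
  obtain ⟨x, hx⟩ := σ.entry.surjective ⟨j, hj⟩
  have hj' : j = σ.entry x := by rw [hx]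
  cases x <;> simp [column, hj', ← Fin.ext_iff]

lemma StandardTableau.word_eq_left_iff {j : ℕ} (hj : j < p + q) :
    σ.word j = .left ↔ ∃ k, (σ.entry (Sum.inl k) : ℕ) = j := by
  rw [word, dif_pos hj]
  obtain ⟨x, hx⟩ := σ.entry.surjective ⟨j, hj⟩
  have hj' : j = σ.entry x := by rw [hx]
  cases x <;> simp [column, hj', ← Fin.ext_iff]

lemma card_filter_lt_succ {m : ℕ} {f : Fin m → ℕ} (hf : Function.Injective f) (i : ℕ) :
    (Finset.univ.filter fun j => f j < i + 1).card =
      (Finset.univ.filter fun j => f j < i).card + if ∃ k, f k = i then 1 else 0 := by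
  split_ifs with h
  · obtain ⟨k, rfl⟩ := h
    rw [← Finset.card_insert_of_notMem (a := k) (by simp)]
    congr 1
    ext j
    simp only [Finset.mem_filter, Finset.mem_univ, true_and, Finset.mem_insert,
      Nat.lt_succ_iff_lt_or_eq, hf.eq_iff, or_comm]
  · push Not at h
    simp only [Nat.lt_succ_iff_lt_or_eq, h, or_false, add_zero]

lemma StandardTableau.numRight_word {i : ℕ} (hi : i ≤ p + q) :
    numRight σ.word i = (Finset.univ.filter fun k => (σ.entry (Sum.inr k) : ℕ) < i).card := by
  classical
  induction i with
  | zero => simp [numRight]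
  | succ i ih =>
    have h_inj : Function.Injective fun k => (σ.entry (Sum.inr k) : ℕ) :=
      Fin.val_injective.comp (σ.entry.injective.comp Sum.inr_injective)
    rw [numRight, ih (by omega), card_filter_lt_succ h_inj,
      if_congr (σ.word_eq_right_iff hi).symm rfl rfl]
    cases σ.word i <;> simp only [Column.select, if_true, if_false, reduceCtorEq]

lemma StandardTableau.numLeft_word {i : ℕ} (hi : i ≤ p + q) :
    numLeft σ.word i = (Finset.univ.filter fun k => (σ.entry (Sum.inl k) : ℕ) < i).card := by
  classical
  induction i with
  | zero => simp [numLeft]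
  | succ i ih =>
    have h_inj : Function.Injective fun k => (σ.entry (Sum.inl k) : ℕ) :=
      Fin.val_injective.comp (σ.entry.injective.comp Sum.inl_injective)
    rw [numLeft, ih (by omega), card_filter_lt_succ h_inj,
      if_congr (σ.word_eq_left_iff hi).symm rfl rfl]
    cases σ.word i <;> simp only [Column.select, if_true, if_false, reduceCtorEq]

lemma StandardTableau.isBallot_word (hqp : q ≤ p) : IsBallot σ.word p q where
  lower i hi := by
    have h_right := Finset.card_filter_add_card_filter_not (s := (Finset.univ : Finset (Fin q)))
      fun k => (σ.entry (Sum.inr k) : ℕ) < i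
    have h_left := Finset.card_filter_add_card_filter_not (s := (Finset.univ : Finset (Fin p)))
      fun k => (σ.entry (Sum.inl k) : ℕ) < i
    have h_row : (Finset.univ.filter fun k => ¬ (σ.entry (Sum.inr k) : ℕ) < i).card ≤
        (Finset.univ.filter fun k => ¬ (σ.entry (Sum.inl k) : ℕ) < i).card := by
      refine Finset.card_le_card_of_injOn (Fin.castLE hqp) (fun k hk => ?_)
        (Fin.castLE_injective hqp).injOn
      have h_lt : (σ.entry (Sum.inr k) : ℕ) < σ.entry (Sum.inl (Fin.castLE hqp k)) :=
        σ.row_anti (Fin.castLE hqp k) k rfl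
      simp only [Finset.coe_filter, Finset.mem_univ, true_and, Set.mem_ofPred_eq] at hk ⊢
      omega
    rw [Finset.card_univ, Fintype.card_fin, ← σ.numRight_word hi] at h_right
    rw [Finset.card_univ, Fintype.card_fin, ← σ.numLeft_word hi] at h_left
    unfold height
    omega
  numRight_eq := by
    rw [σ.numRight_word le_rfl, Finset.filter_true_of_mem fun k _ => (σ.entry (Sum.inr k)).2,
      Finset.card_univ, Fintype.card_fin]

end Tableau

/-! ### The closures of the strata -/

lemma GrProd.monotone_flag_iff {K : Type*} [Field K] {n r : ℕ} {F : GrProd K n r} :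
    Monotone F.flag ↔ ∀ i < r, F.flag i ≤ F.flag (i + 1) := by
  refine ⟨fun h i _ => h i.le_succ, fun h => monotone_nat_of_le_succ fun i => ?_⟩
  by_cases hi : i < r
  · exact h i hi
  · rw [show F.flag (i + 1) = ⊤ from dif_neg hi]
    exact le_top

lemma mem_flagVariety_iff {K : Type*} [Field K] {n : ℕ} {F : GrProd K n n} :
    F ∈ flagVariety K n ↔ Monotone F.flag := by
  constructor
  · intro h
    rw [GrProd.monotone_flag_iff]
    rintro (_ | i) hi
    · exact bot_le
    · rw [F.flag_succ hi, F.flag_succ (Nat.lt_of_succ_lt hi)]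
      exact h _ _ (Fin.mk_le_mk.2 i.le_succ)
  · intro h i j hij
    rw [← F.flag_succ i.2, ← F.flag_succ j.2]
    exact h (Nat.succ_le_succ hij)

section Component

variable {K : Type*} [Field K] {p q : ℕ} {e : Module.Basis (Fin p ⊕ Fin q) K (Fin (p + q) → K)}

lemma mem_stratum_iff (σ : StandardTableau p q) {F : GrProd K (p + q) (p + q)} :
    F ∈ stratum K e σ ↔ Monotone F.flag ∧
      InStratumFrom (chain e .left) σ.word F.flag (p + q) 0 (chain e .right) := by
  refine (and_congr_left' mem_flagVariety_iff).trans (and_congr_right fun hF => ?_)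
  have h := inStratum_iff_inStratumFrom (u := chain e .left) (w := σ.word) hF (m := p + q) (r := 0)
    (π := LinearMap.id) Function.surjective_id LinearMap.ker_id (W := chain e .right)
  simp only [Submodule.map_id, LinearMap.id_apply, zero_add, numLeft, add_comm 1, σ.word_val] at h
  exact h

variable (e) in
/-- The flags which avoid the vectors of the first chain as long as possible.  Among the flags
matched to a word they form a dense open subset. -/
def genericFlags (w : ℕ → Column) : Set (GrProd K (p + q) (p + q)) :=
  {F | ∀ i ≤ p + q, numLeft w i < p → chain e .left (numLeft w i) ∉ F.flag i}

lemma isOpen_genericFlags (w : ℕ → Column) :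
    IsOpen[zariski K (GrProd K (p + q) (p + q))] (genericFlags e w) := by
  let _ := zariski K (GrProd K (p + q) (p + q))
  have h_inter : genericFlags e w = ⋂ i ∈ {i | i ≤ p + q ∧ numLeft w i < p},
      {F | chain e .left (numLeft w i) ∉ F.flag i} := by
    ext F
    simp only [Set.mem_iInter, genericFlags, Set.mem_ofPred_eq, and_imp]
  rw [h_inter]
  refine ((Set.finite_Iic (p + q)).subset fun i hi => hi.1).isOpen_biInter fun i hi => ?_
  exact @IsOpen.preimage _ _ (_) (_) _ (GrProd.hasRationalLifts_member hi.1).continuous _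
    (Gr.isOpen_notMem i (chain e .left (numLeft w i)))

lemma coordFlag_mem_genericFlags {w : ℕ → Column} (hw : numRight w (p + q) = q) :
    coordFlag e hw ∈ genericFlags e w := by
  intro i hi h_lt
  rw [flag_coordFlag hw hi, chain_mem_coordSub_iff (c := .left) h_lt]
  exact lt_irrefl _

variable {N : (Fin (p + q) → K) →ₗ[K] (Fin (p + q) → K)} (hN : IsShift e N)

include hN

lemma isSecondChain_chain_right {w : ℕ → Column} {G : ℕ → Submodule K (Fin (p + q) → K)} :
    IsSecondChain e N w 0 G (chain e .right) where
  apply_zero _ := by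
    have h : N (chain e .right 0) ∈ coordSub e 0 0 :=
      hN.apply_mem_coordSub (chain_mem_coordSub (a := 0) (b := 1) Nat.zero_lt_one)
    rw [coordSub_zero_zero, Submodule.mem_bot] at h
    rw [h]
    exact Submodule.zero_mem _
  apply_succ i hi := hN.apply_chain (c := .right) hi
  sub_mem i := by
    rw [numRight, zero_add, sub_self]
    exact Submodule.zero_mem _

variable (hqp : q ≤ p)

include hqp

lemma stratum_subset_matchedFlags (σ : StandardTableau p q) :
    stratum K e σ ⊆ matchedFlags e N σ.word (p + q) := fun F hF =>
  isMatched_of_inStratumFrom hN (σ.isBallot_word hqp) (fun _ hi => F.finrank_flag hi) (zero_add _)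
    (IsMatched.zero F.flag_zero) (isSecondChain_chain_right hN) ((mem_stratum_iff σ).1 hF).2

lemma matchedFlags_inter_genericFlags_subset (σ : StandardTableau p q) :
    matchedFlags e N σ.word (p + q) ∩ genericFlags e σ.word ⊆ stratum K e σ := by
  rintro F ⟨hF, h_generic⟩
  have h : IsGenericMatched e N σ.word F.flag := ⟨fun _ hi => F.finrank_flag hi, hF, h_generic⟩
  exact (mem_stratum_iff σ).2 ⟨GrProd.monotone_flag_iff.2 hF.mono,
    h.inStratumFrom hN (σ.isBallot_word hqp) (zero_add _) (isSecondChain_chain_right hN)⟩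

lemma isIrreducible_matchedFlags [Infinite K] {w : ℕ → Column} (hw : IsBallot w p q) :
    @IsIrreducible _ (zariski K (GrProd K (p + q) (p + q))) (matchedFlags e N w (p + q)) := by
  let _ := zariski K (GrProd K (p + q) (p + q))
  let _ := zariski K (matchedFlags e N w (p + q))
  have := irreducibleSpace_matchedFlags hN hqp hw le_rfl
  have h_range := IsIrreducible.image ((irreducibleSpace_def _).1 this) Subtype.val
    (HasRationalLifts.val (K := K) (· ∈ matchedFlags e N w (p + q))).continuous.continuousOn
  rwa [Set.top_eq_univ, Set.image_univ, Subtype.range_val] at h_range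

theorem component_eq_matchedFlags [Infinite K] (σ : StandardTableau p q) :
    component K e σ = matchedFlags e N σ.word (p + q) := by
  let _ := zariski K (GrProd K (p + q) (p + q))
  have hw := σ.isBallot_word hqp
  refine (closure_minimal (stratum_subset_matchedFlags hN hqp σ)
    (isClosed_matchedFlags _)).antisymm ?_
  have h_nonempty : (matchedFlags e N σ.word (p + q) ∩ genericFlags e σ.word).Nonempty :=
    ⟨coordFlag e hw.numRight_eq,
      ((IsCompatible.refl _ _).isMatched hN).congr fun i hi => (flag_coordFlag _ hi).symm,
      coordFlag_mem_genericFlags _⟩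
  exact (subset_closure_inter_of_isPreirreducible_of_isOpen
    (isIrreducible_matchedFlags hN hqp hw).2 (isOpen_genericFlags σ.word) h_nonempty).trans
    (closure_mono (matchedFlags_inter_genericFlags_subset hN hqp σ))

lemma componentImage_eq_matchedFlags [Infinite K] (σ : StandardTableau p q) {r : ℕ}
    (hr : r ≤ p + q) : componentImage K e σ r hr = matchedFlags e N σ.word r := by
  rw [componentImage, component_eq_matchedFlags hN hqp]
  refine Set.Subset.antisymm ?_ fun F hF => ?_
  · rintro _ ⟨F, hF, rfl⟩
    exact trunc_mem_matchedFlags_of_le hr hF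
  · exact exists_prolongation_matchedFlags hN hqp (σ.isBallot_word hqp) hr le_rfl hF

lemma exists_isVarietyIso_componentProj [Infinite K] {σ : StandardTableau p q} {r : Fin (p + q)}
    (hr : σ.column r = .left) :
    ∃ φ : componentImage K e σ (r + 1) r.2 ≃ componentImage K e σ r r.2.le,
      IsVarietyIso K φ ∧ ⇑φ = componentProj K e σ r := by
  suffices h_trunc : ∀ (Z' : Set (GrProd K (p + q) (r + 1))) (Z : Set (GrProd K (p + q) r)),
      Z' = matchedFlags e N σ.word (r + 1) → Z = matchedFlags e N σ.word r →
      ∀ h : ∀ F ∈ Z', GrProd.trunc K (Nat.le_succ r) F ∈ Z,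
        ∃ φ : Z' ≃ Z, IsVarietyIso K φ ∧ ⇑φ = truncMap h from
    h_trunc _ _ (componentImage_eq_matchedFlags hN hqp σ r.2)
      (componentImage_eq_matchedFlags hN hqp σ r.2.le) fun F hF => (componentProj K e σ r ⟨F, hF⟩).2
  rintro _ _ rfl rfl _
  obtain ⟨φ, hφ, hφ_symm, h_eq⟩ :=
    exists_equiv_matchedFlags hN hqp (σ.isBallot_word hqp) r.2 ((σ.word_val r).trans hr)
  exact ⟨φ, hφ.isVarietyIso hφ_symm, h_eq⟩

lemma isRationalProjLineBundle_componentProj [Infinite K] {σ : StandardTableau p q}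
    {r : Fin (p + q)} (hr : σ.column r = .right) :
    IsRationalProjLineBundle K (componentProj K e σ r) := by
  suffices h_trunc : ∀ (Z' : Set (GrProd K (p + q) (r + 1))) (Z : Set (GrProd K (p + q) r)),
      Z' = matchedFlags e N σ.word (r + 1) → Z = matchedFlags e N σ.word r →
      ∀ h : ∀ F ∈ Z', GrProd.trunc K (Nat.le_succ r) F ∈ Z,
        IsRationalProjLineBundle K (truncMap h) from
    h_trunc _ _ (componentImage_eq_matchedFlags hN hqp σ r.2)
      (componentImage_eq_matchedFlags hN hqp σ r.2.le) fun F hF => (componentProj K e σ r ⟨F, hF⟩).2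
  rintro _ _ rfl rfl _
  exact isRationalProjLineBundle_matchedFlags hN hqp (σ.isBallot_word hqp) r.2
    ((σ.word_val r).trans hr)

end Component

/-! ### Irreducible components of the Springer fiber -/

lemma height_congr {w w' : ℕ → Column} {r : ℕ} (h : ∀ i < r, w i = w' i) :
    ∀ i ≤ r, height w i = height w' i := by
  intro i hi
  induction i with
  | zero => rfl
  | succ i ih =>
    have h_height := ih (by omega)
    have h_letter := h i hi
    cases hwi : w i
    · rw [height_succ_left hwi, height_succ_left (h_letter ▸ hwi), h_height]
    · rw [height_succ_right hwi, height_succ_right (h_letter ▸ hwi), h_height]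

lemma IsMatched.of_height_eq {K V : Type*} [Field K] [AddCommGroup V] [Module K V] {p q : ℕ}
    {e : Module.Basis (Fin p ⊕ Fin q) K V} {N : V →ₗ[K] V} {G : ℕ → Submodule K V}
    {w w' : ℕ → Column} {r : ℕ} (hG : IsMatched e N w r G)
    (h : ∀ i ≤ r, height w i = height w' i) : IsMatched e N w' r G where
  mono := hG.mono
  nil := hG.nil
  bal i j k hj hij hb := by
    refine hG.bal i j k hj hij ⟨?_, fun m him hmj => ?_⟩
    · rw [h i (by omega), h j hj, hb.1]
    · rw [h i (by omega), h m (by omega)]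
      exact hb.2 m him hmj
  low j t u hj htu hl hu := by
    refine hG.low j t u hj htu (fun m hm => ?_) ((h j hj).trans hu)
    rw [h j hj, h m (by omega)]
    exact hl m hm

section SpringerFiber

variable {K : Type*} [Field K] {p q : ℕ} {e : Module.Basis (Fin p ⊕ Fin q) K (Fin (p + q) → K)}
  {N : (Fin (p + q) → K) →ₗ[K] (Fin (p + q) → K)} {w w' : ℕ → Column}

lemma matchedFlags_congr {r : ℕ} (h : ∀ i < r, w i = w' i) :
    matchedFlags e N w r = matchedFlags e N w' r :=
  Set.ext fun _ => ⟨fun hF => hF.of_height_eq (height_congr h),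
    fun hF => hF.of_height_eq fun i hi => (height_congr h i hi).symm⟩

variable (e N) in
lemma finite_range_matchedFlags (r : ℕ) : (Set.range fun w => matchedFlags e N w r).Finite := by
  have : Finite Column := .of_injective (Column.select false true) <| by
    rintro ⟨⟩ ⟨⟩ <;> simp only [Column.select, reduceCtorEq, imp_self]
  refine (Set.finite_range fun f : Fin r → Column =>
    matchedFlags e N (fun i => if h : i < r then f ⟨i, h⟩ else .left) r).subset ?_
  rintro _ ⟨w, rfl⟩
  exact ⟨fun i => w i, matchedFlags_congr fun i hi => dif_pos hi⟩

lemma le_comap_toLin'_sub_one_iff {n : ℕ} {A : Matrix (Fin n) (Fin n) K}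
    {W : Submodule K (Fin n → K)} :
    W ≤ W.comap (Matrix.toLin' (A - 1)) ↔ W.map (Matrix.toLin' A) ≤ W := by
  rw [Submodule.map_le_iff_le_comap]
  refine forall₂_congr fun v hv => ?_
  rw [Submodule.mem_comap, Submodule.mem_comap, map_sub, Matrix.toLin'_one, LinearMap.sub_apply,
    LinearMap.id_apply, Submodule.sub_mem_iff_left _ hv]

lemma mem_springerFiber_iff {x : Matrix.SpecialLinearGroup (Fin (p + q)) K}
    (hN : IsNilpotent (Matrix.toLin' (x.1 - 1))) {F : GrProd K (p + q) (p + q)} :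
    F ∈ springerFiber K x ↔ (∀ i < p + q, F.flag i ≤ F.flag (i + 1)) ∧
      ∀ i < p + q, F.flag (i + 1) ≤ (F.flag i).comap (Matrix.toLin' (x.1 - 1)) := by
  refine (and_congr_left' (mem_flagVariety_iff.trans GrProd.monotone_flag_iff)).trans
    (and_congr_right fun h_mono => ?_)
  constructor
  · intro h i hi
    have h_stable : ∀ j ≤ p + q,
        F.flag j ≤ (F.flag j).comap (Matrix.toLin' (x.1 - 1)) := by
      rintro (_ | j) hj
      · exact bot_le
      · rw [F.flag_succ hj]
        exact le_comap_toLin'_sub_one_iff.2 (h ⟨j, hj⟩)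
    refine le_comap_of_isNilpotent hN (h_mono i hi) ?_ (h_stable i hi.le) (h_stable (i + 1) hi)
    rw [F.finrank_flag hi, F.finrank_flag hi.le]
  · intro h i
    rw [← le_comap_toLin'_sub_one_iff, ← F.flag_succ i.2]
    exact (h i i.2).trans (Submodule.comap_mono (h_mono i i.2))

lemma exists_mem_matchedFlags_of_mem_springerFiber
    {x : Matrix.SpecialLinearGroup (Fin (p + q)) K}
    (hN : IsShift e (Matrix.toLin' (x.1 - 1))) (hqp : q ≤ p) {F : GrProd K (p + q) (p + q)}
    (hF : F ∈ springerFiber K x) :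
    ∃ w, IsBallot w p q ∧ F ∈ matchedFlags e (Matrix.toLin' (x.1 - 1)) w (p + q) := by
  obtain ⟨h_mono, h_nil⟩ := (mem_springerFiber_iff hN.isNilpotent).1 hF
  have hfin : ∀ i ≤ p + q, Module.finrank K (F.flag i) = i := fun i hi => F.finrank_flag hi
  exact ⟨_, isBallot_rangeWord hN hqp hfin h_mono h_nil,
    isMatched_rangeWord hN hqp hfin h_mono h_nil le_rfl⟩

lemma exists_subset_matchedFlags_of_isIrreducible
    {x : Matrix.SpecialLinearGroup (Fin (p + q)) K}
    (hN : IsShift e (Matrix.toLin' (x.1 - 1))) (hqp : q ≤ p)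
    {Z : Set (GrProd K (p + q) (p + q))} (hZ : Z ⊆ springerFiber K x)
    (h_irred : @IsIrreducible _ (zariski K (GrProd K (p + q) (p + q))) Z) :
    ∃ w, IsBallot w p q ∧ Z ⊆ matchedFlags e (Matrix.toLin' (x.1 - 1)) w (p + q) := by
  let _ := zariski K (GrProd K (p + q) (p + q))
  let N := Matrix.toLin' (x.1 - 1)
  have h_finite : {Y | ∃ w, IsBallot w p q ∧ matchedFlags e N w (p + q) = Y}.Finite :=
    (finite_range_matchedFlags e N (p + q)).subset fun _ ⟨w, _, h⟩ => ⟨w, h⟩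
  have h_closed : ∀ Y ∈ h_finite.toFinset, IsClosed Y := by
    intro Y hY
    obtain ⟨w, -, rfl⟩ := h_finite.mem_toFinset.1 hY
    exact isClosed_matchedFlags _
  have h_cover : Z ⊆ ⋃₀ h_finite.toFinset := by
    intro F hF
    obtain ⟨w, hw, hFw⟩ := exists_mem_matchedFlags_of_mem_springerFiber hN hqp (hZ hF)
    exact ⟨_, h_finite.mem_toFinset.2 ⟨w, hw, rfl⟩, hFw⟩
  obtain ⟨Y, hY, hZY⟩ := isIrreducible_iff_sUnion_isClosed.1 h_irred _ h_closed h_cover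
  obtain ⟨w, hw, rfl⟩ := h_finite.mem_toFinset.1 hY
  exact ⟨w, hw, hZY⟩

theorem maximal_component [Infinite K] (hqp : q ≤ p)
    {x : Matrix.SpecialLinearGroup (Fin (p + q)) K} (he : IsAdaptedBasis K x e)
    (σ : StandardTableau p q) :
    Maximal (fun Z : Set (GrProd K (p + q) (p + q)) =>
        Z ⊆ springerFiber K x ∧ @IsIrreducible _ (zariski K (GrProd K (p + q) (p + q))) Z)
      (component K e σ) := by
  have hN := he.isShift
  have hw := σ.isBallot_word hqp
  rw [component_eq_matchedFlags hN hqp]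
  refine ⟨⟨fun F hF => (mem_springerFiber_iff hN.isNilpotent).2 ⟨hF.mono, hF.nil⟩,
    isIrreducible_matchedFlags hN hqp hw⟩, fun Z ⟨hZ, h_irred⟩ h_le => ?_⟩
  obtain ⟨w', hw', hZw'⟩ := exists_subset_matchedFlags_of_isIrreducible hN hqp hZ h_irred
  rwa [matchedFlags_congr (hw.eq_of_matchedFlags_subset hN hw' (h_le.trans hZw'))]

end SpringerFiber

theorem mainTheorem1_general {K : Type*} [Field K] [Infinite K] {p q : ℕ} (hqp : q ≤ p)
    (x : Matrix.SpecialLinearGroup (Fin (p + q)) K)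
    (e : Module.Basis (Fin p ⊕ Fin q) K (Fin (p + q) → K)) (he : IsAdaptedBasis K x e)
    (σ : StandardTableau p q) :
    Maximal (fun Z : Set (GrProd K (p + q) (p + q)) =>
        Z ⊆ springerFiber K x ∧ @IsIrreducible _ (zariski K (GrProd K (p + q) (p + q))) Z)
      (component K e σ) ∧
    ∀ r : Fin (p + q),
      (σ.column r = Column.left →
        (∀ z : componentImage K e σ r r.2.le,
          ∃! y : componentImage K e σ (r + 1) r.2, componentProj K e σ r y = z) ∧
        ∃ φ : componentImage K e σ (r + 1) r.2 ≃ componentImage K e σ r r.2.le,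
          IsVarietyIso K φ ∧ ⇑φ = componentProj K e σ r) ∧
      (σ.column r = Column.right →
        (∀ z : componentImage K e σ r r.2.le,
          ∃ φ : {y : componentImage K e σ (r + 1) r.2 // componentProj K e σ r y = z} ≃ ProjLine K,
            IsVarietyIso K φ) ∧
        IsProjLineBundle K (componentProj K e σ r)) := by
  refine ⟨maximal_component hqp he σ, fun r => ⟨fun hr => ?_, fun hr => ?_⟩⟩
  · obtain ⟨φ, h_iso, h_eq⟩ := exists_isVarietyIso_componentProj he.isShift hqp hr
    refine ⟨fun z => ?_, φ, h_iso, h_eq⟩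
    rw [← h_eq]
    exact φ.bijective.existsUnique z
  · have h_bundle := isRationalProjLineBundle_componentProj he.isShift hqp hr
    refine ⟨fun z => ?_, h_bundle.isProjLineBundle⟩
    obtain ⟨φ, hφ, hφ_symm⟩ := h_bundle.exists_fiber_equiv z
    exact ⟨φ, hφ.isVarietyIso hφ_symm⟩

theorem mainTheorem1 {K : Type*} [Field K] [IsAlgClosed K] {p q : ℕ} (hqp : q ≤ p)
    (x : Matrix.SpecialLinearGroup (Fin (p + q)) K)
    (e : Module.Basis (Fin p ⊕ Fin q) K (Fin (p + q) → K)) (he : IsAdaptedBasis K x e)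
    (σ : StandardTableau p q) :
    Maximal (fun Z : Set (GrProd K (p + q) (p + q)) =>
        Z ⊆ springerFiber K x ∧ @IsIrreducible _ (zariski K (GrProd K (p + q) (p + q))) Z)
      (component K e σ) ∧
    ∀ r : Fin (p + q),
      (σ.column r = Column.left →
        (∀ z : componentImage K e σ r r.2.le,
          ∃! y : componentImage K e σ (r + 1) r.2, componentProj K e σ r y = z) ∧
        ∃ φ : componentImage K e σ (r + 1) r.2 ≃ componentImage K e σ r r.2.le,
          IsVarietyIso K φ ∧ ⇑φ = componentProj K e σ r) ∧
      (σ.column r = Column.right →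
        (∀ z : componentImage K e σ r r.2.le,
          ∃ φ : {y : componentImage K e σ (r + 1) r.2 // componentProj K e σ r y = z} ≃ ProjLine K,
            IsVarietyIso K φ) ∧
        IsProjLineBundle K (componentProj K e σ r)) :=
  mainTheorem1_general hqp x e he σ
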